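/- **Setting.** Let $M$ be a Hausdorff, second countable smooth manifold of dimension $m$; functions are smooth and complex valued, and vector fields on an open set $W$ are the derivations of $C^\infty(W)$. Let $A$ be a transitive Lie algebroid over $M$, given by its sheaf of sections: a locally free sheaf of $C^\infty$-modules of finite rank, with a Lie bracket and a surjective anchor $\rho:A\to\Gamma(TM)$ such that $[X,fY]=f[X,Y]+(\rho(X)f)Y$, all compatible with restriction. Let $L=\ker\rho$. $\Omega^q(A,L)$ is the space of $C^\infty$-multilinear alternating $q$-forms on $A$ with values in $L$ and $\hat d$ is its Chevalley–Eilenberg differential, for the adjoint action of $A$ on $L$. Let $\mathfrak g$ be a finite-dimensional complex Lie algebra. The trivial Lie algebroid on an open $U$ is $\mathrm{TLA}(U,\mathfrak g)=\Gamma(TU)\oplus\Gamma(U\times\mathfrak g)$ with $[X\oplus\gamma,Y\oplus\eta]=[X,Y]\oplus(X\cdot\eta-Y\cdot\gamma+[\gamma,\eta])$ and anchor $X\oplus\gamma\mapsto X$; $(\Omega^\bullet_{\mathrm{TLA}}(U,\mathfrak g),\hat d_{\mathrm{TLA}})$ is the corresponding complex of forms with values in the kernel $\Gamma(U\times\mathfrak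 g)$. A local trivialization $(U,\Psi,\nabla^0)$ of $A$ is an isomorphism $\Psi:U\times\mathfrak g\cong L_{|U}$ of bundles in Lie algebras together with a flat connection $\nabla^0:TU\to A_{|U}$ (a bracket-preserving $C^\infty$-linear section of $\rho$) such that $[\nabla^0_X,\Psi\gamma]=\Psi(X\cdot\gamma)$. It gives an isomorphism $S:\mathrm{TLA}(U,\mathfrak g)\to A_{|U}$, $S(X\oplus\gamma)=\nabla^0_X+\Psi\gamma$; the local expression of $\omega\in\Omega^q(A,L)$ is $\omega_{\mathrm{loc}}=\Psi^{-1}\circ\omega_{|U}\circ S$. For local trivializations over $U$ and over $V\subset U$ put $\hat\alpha_U^V(\omega)=\Psi_V^{-1}\Psi_U\circ\omega\circ(S_U^{-1}S_V)$ and $i_U^V(\omega)=\hat\alpha_U^V(\omega_{|V})$, a map $\Omega^q_{\mathrm{TLA}}(U,\mathfrak g)\to\Omega^q_{\mathrm{TLA}}(V,\mathfrak g)$. Let $\mathcal U=\{U_i\}_{i\in I}$ be a good cover of $M$ ($I$ totally ordered, all nonempty finite intersections $U_{i_0\cdots i_p}$ diffeomorphic to $\mathbb R^m$), with a chosen local trivialization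 of $A$ with fibre $\mathfrak g$ over every nonempty $U_{i_0\cdots i_p}$ (those over the $U_i$ form a Lie algebroid atlas). Put $$C^{p,q}=\prod_{i_0<\cdots<i_p,\;U_{i_0\cdots i_p}\neq\emptyset}\Omega^q_{\mathrm{TLA}}(U_{i_0\cdots i_p},\mathfrak g)\quad(p,q\ge0),\qquad C^{-1,q}=\Omega^q(A,L),$$ let $\hat d_{\mathrm{TLA}}:C^{p,q}\to C^{p,q+1}$ act componentwise, let $\delta:C^{-1,q}\to C^{0,q}$ be $\omega\mapsto(\omega_{\mathrm{loc}})_i$, and for $p\ge0$ let $$(\delta\omega)_{i_0\cdots i_{p+1}}=\sum_{k=0}^{p+1}(-1)^{k+1}\,i_{U_{i_0\cdots\widehat{i_k}\cdots i_{p+1}}}^{U_{i_0\cdots i_{p+1}}}\big(\omega_{i_0\cdots\widehat{i_k}\cdots i_{p+1}}\big).$$ **Statement.** 1. $\hat d^2=0$, $\hat d_{\mathrm{TLA}}^2=0$, $\delta^2=0$ on $C^{p,q}$ for $p\ge0$, $\delta\hat d_{\mathrm{TLA}}=\hat d_{\mathrm{TLA}}\delta$, and the augmentation $\delta:\Omega^\bullet(A,L)\to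 C^{0,\bullet}$ satisfies $\delta\hat d=\hat d_{\mathrm{TLA}}\delta$. 2. For every $q\ge0$ the sequence $0\to\Omega^q(A,L)\xrightarrow{\delta}C^{0,q}\xrightarrow{\delta}C^{1,q}\xrightarrow{\delta}C^{2,q}\to\cdots$ is exact. 3. For every $n\ge0$ the augmentation induces an isomorphism from $H^n(\Omega^\bullet(A,L),\hat d)$ onto the $n$-th cohomology of the total complex $\big(\bigoplus_{p+q=n}C^{p,q},\;D=\delta+(-1)^p\hat d_{\mathrm{TLA}}\big)$. 4. Let $E_r^{p,q}$ be the terms associated with the filtration $F^p=\bigoplus_{k\ge p}C^{k,\bullet}$ of the total complex, that is $E_r^{p,q}=Z_r^{p,q}/(Z_{r-1}^{p+1,q-1}+DZ_{r-1}^{p-r+1,q+r-2})$, where $Z_r^{p,q}$ consists of the elements $c$ of $F^p$ of total degree $p+q$ with $Dc\in F^{p+r}$. With $d_r[c]=[Dc]$, $d_r:E_r^{p,q}\to E_r^{p+r,q-r+1}$, they form a spectral sequence ($r\ge0$): $d_r$ is well defined, $d_r^2=0$, and $E_{r+1}$ is the cohomology of $(E_r,d_r)$ through $[c]\mapsto[c]$.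 Let $\mathcal H^q(U)=H^q(\Omega^\bullet_{\mathrm{TLA}}(U,\mathfrak g),\hat d_{\mathrm{TLA}})$, with the restriction maps induced by the $i_U^V$ on the sets $U_{i_0\cdots i_p}$. For all $p,q\ge0$, taking the component of bidegree $(p,q)$ of a representative induces isomorphisms $$E_1^{p,q}\cong C^p(\mathcal U,\mathcal H^q)=\prod_{i_0<\cdots<i_p,\;U_{i_0\cdots i_p}\neq\emptyset}\mathcal H^q(U_{i_0\cdots i_p}),\qquad E_2^{p,q}\cong H^p(\mathcal U;\mathcal H^q),$$ where $H^p(\mathcal U;\mathcal H^q)$ is the Čech cohomology of the good cover $\mathcal U$ with coefficients in $\mathcal H^q$ (the cohomology of $C^\bullet(\mathcal U,\mathcal H^q)$ for the differential given by the formula for $\delta$). 5. For every nonempty $U_{i_0\cdots i_p}$ and every $q\ge0$, sending a cocycle $c$ to the constant form $(X_1\oplus\gamma_1,\dots,X_q\oplus\gamma_q)\mapsto c(\gamma_1,\dots,\gamma_q)$ induces an isomorphism $H^q(\mathfrak g;\mathfrak g)\cong\mathcal H^q(U_{i_0\cdots i_p})$, where $H^q(\mathfrak g;\mathfrak g)$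 is the Lie algebra cohomology with coefficients in the adjoint representation. -/

import Mathlib

open Set Filter Topology TopologicalSpace
open scoped Manifold ContDiff TensorProduct

noncomputable section

namespace TransLie

section CE
variable {K N : Type*} [LieRing K] [LieAlgebra ℂ K] [AddCommGroup N] [Module ℂ N]
  [LieRingModule K N] [LieModule ℂ K N] {q : ℕ}

/-- The Lie derivative of a cochain:
`(L_x η)(Y₁, …, Y_q) = x · η(Y₁, …, Y_q) - ∑ k, η(Y₁, …, [x, Y_k], …, Y_q)`. -/
def lieDer (x : K) (η : K [⋀^Fin q]→ₗ[ℂ] N) : K [⋀^Fin q]→ₗ[ℂ] N where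
  toFun Y := ⁅x, η Y⁆ - ∑ k, η (Function.update Y k ⁅x, Y k⁆)
  map_update_add' := by
    intro inst Y i a b
    obtain rfl := Subsingleton.elim inst (instDecidableEqFin q)
    have h : ∀ k, η (Function.update (Function.update Y i (a + b)) k
          ⁅x, Function.update Y i (a + b) k⁆)
        = η (Function.update (Function.update Y i a) k ⁅x, Function.update Y i a k⁆)
          + η (Function.update (Function.update Y i b) k ⁅x, Function.update Y i b k⁆) := by
      intro k
      rcases eq_or_ne k i with rfl | hk
      · simp
      · simp only [Function.update_of_ne hk]
        simp only [Function.update_comm hk.symm]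
        simp
    simp only [h, η.map_update_add, lie_add, Finset.sum_add_distrib]
    abel
  map_update_smul' := by
    intro inst Y i c a
    obtain rfl := Subsingleton.elim inst (instDecidableEqFin q)
    have h : ∀ k, η (Function.update (Function.update Y i (c • a)) k
          ⁅x, Function.update Y i (c • a) k⁆)
        = c • η (Function.update (Function.update Y i a) k ⁅x, Function.update Y i a k⁆) := by
      intro k
      rcases eq_or_ne k i with rfl | hk
      · simp
      · simp only [Function.update_of_ne hk]
        simp only [Function.update_comm hk.symm]
        simp
    simp only [h, η.map_update_smul, lie_smul, smul_sub, Finset.smul_sum]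
  map_eq_zero_of_eq' := by
    intro Y i j hY hij
    have h1 : η Y = 0 := η.map_eq_zero_of_eq Y hY hij
    have h2 : ∑ k, η (Function.update Y k ⁅x, Y k⁆) = 0 := by
      rw [Fintype.sum_eq_add i j hij]
      · have := η.map_swap (Function.update Y i ⁅x, Y i⁆) hij
        have h3 : (Function.update Y i ⁅x, Y i⁆) ∘ (Equiv.swap i j)
            = Function.update Y j ⁅x, Y j⁆ := by
          funext k
          rcases eq_or_ne k i with rfl | hki
          · simp [Function.update_of_ne hij, Function.update_of_ne hij.symm, hY]
          · rcases eq_or_ne k j with rfl | hkj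
            · simp [hY]
            · simp [Equiv.swap_apply_of_ne_of_ne hki hkj, Function.update_of_ne hki,
                Function.update_of_ne hkj]
        rw [h3] at this
        rw [this]; abel
      · rintro k ⟨hki, hkj⟩
        refine η.map_eq_zero_of_eq _ ?_ hij
        rw [Function.update_of_ne hki.symm, Function.update_of_ne hkj.symm, hY]
    simp [h1, h2]

lemma lieDer_apply (x : K) (η : K [⋀^Fin q]→ₗ[ℂ] N) (Y : Fin q → K) :
    lieDer x η Y = ⁅x, η Y⁆ - ∑ k, η (Function.update Y k ⁅x, Y k⁆) := rfl

/-- `x ↦ x · η`. -/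
def actL (η : K [⋀^Fin q]→ₗ[ℂ] N) : K →ₗ[ℂ] K [⋀^Fin q]→ₗ[ℂ] N where
  toFun x := (LieModule.toEnd ℂ K N x).compAlternatingMap η
  map_add' x y := by ext Y; simp
  map_smul' c x := by ext Y; simp

/-- `x ↦ L_x η`. -/
def lieDerL (η : K [⋀^Fin q]→ₗ[ℂ] N) : K →ₗ[ℂ] K [⋀^Fin q]→ₗ[ℂ] N where
  toFun x := lieDer x η
  map_add' x y := by
    ext Y; simp [lieDer_apply, Finset.sum_add_distrib]; abel
  map_smul' c x := by
    ext Y; simp [lieDer_apply, Finset.smul_sum, smul_sub]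

/-- The Chevalley–Eilenberg differential on alternating cochains of the Lie algebra `K` with
values in the `K`-module `N`.  It is written here as a sum of two manifestly alternating terms;
`ceD_apply` is the usual formula. -/
def ceD : (K [⋀^Fin q]→ₗ[ℂ] N) →ₗ[ℂ] (K [⋀^Fin (q + 1)]→ₗ[ℂ] N) where
  toFun η := (2⁻¹ : ℂ) • (AlternatingMap.alternatizeUncurryFin (actL η) + AlternatingMap.alternatizeUncurryFin (lieDerL η))
  map_add' η ξ := by
    have h1 : actL (η + ξ) = actL η + actL ξ := by ext x Y; simp [actL]
    have h2 : lieDerL (η + ξ) = lieDerL η + lieDerL ξ := by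
      ext x Y; simp [lieDerL, lieDer_apply, Finset.sum_add_distrib]; abel
    rw [h1, h2, AlternatingMap.alternatizeUncurryFin_add, AlternatingMap.alternatizeUncurryFin_add,
      ← smul_add]
    congr 1; abel
  map_smul' c η := by
    have h1 : actL (c • η) = c • actL η := by ext x Y; simp [actL]
    have h2 : lieDerL (c • η) = c • lieDerL η := by
      ext x Y; simp [lieDerL, lieDer_apply, Finset.smul_sum, smul_sub]
    rw [h1, h2, AlternatingMap.alternatizeUncurryFin_smul,
      AlternatingMap.alternatizeUncurryFin_smul, ← smul_add, smul_comm, RingHom.id_apply]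

lemma two_smul_ceD_apply (η : K [⋀^Fin q]→ₗ[ℂ] N) (X : Fin (q + 1) → K) :
    (2 : ℂ) • ceD η X = ∑ i : Fin (q + 1), (-1 : ℤ) ^ (i : ℕ) • ⁅X i, η (i.removeNth X)⁆
      + ∑ i : Fin (q + 1), (-1 : ℤ) ^ (i : ℕ) • lieDer (X i) η (i.removeNth X) := by
  have : ceD η X = (2⁻¹ : ℂ) • (AlternatingMap.alternatizeUncurryFin (actL η) X
    + AlternatingMap.alternatizeUncurryFin (lieDerL η) X) := rfl
  rw [this, smul_smul, AlternatingMap.alternatizeUncurryFin_apply,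
    AlternatingMap.alternatizeUncurryFin_apply]
  norm_num
  rfl

/-- The usual formula
`(dη)(X₀, …, X_q) = ∑ i, (-1)^i X_i · η(…, X̂_i, …) + ∑_{i < j} (-1)^{i+j} η([X_i, X_j], …)`,
where the bracket has been moved to the place of `X_j` (which costs the sign `(-1)^{j-1}`). -/
lemma ceD_apply (η : K [⋀^Fin q]→ₗ[ℂ] N) (X : Fin (q + 1) → K) :
    ceD η X = ∑ i : Fin (q + 1), (-1 : ℤ) ^ (i : ℕ) • ⁅X i, η (i.removeNth X)⁆
      - ∑ i : Fin (q + 1), ∑ k : Fin q, if i ≤ k.castSucc then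
          (-1 : ℤ) ^ (i : ℕ) • η (Function.update (i.removeNth X) k ⁅X i, X k.succ⁆) else 0 := by
  set F : Fin (q + 1) × Fin q → N := fun p =>
    (-1 : ℤ) ^ (p.1 : ℕ) • η (Function.update (p.1.removeNth X) p.2 ⁅X p.1, p.1.removeNth X p.2⁆)
    with hF
  have hinv : ∀ p : Fin (q + 1) × Fin q, F (p.1.succAbove p.2, p.2.predAbove p.1) = F p := by
    rintro ⟨i, k⟩
    obtain ⟨m, rfl⟩ : ∃ m, q = m + 1 := ⟨q - 1, by have := k.pos; omega⟩
    have hupd : ∀ (Z : Fin (m + 1) → K) (k : Fin (m + 1)) (v : K),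
        Function.update Z k v = k.insertNth v (k.removeNth Z) := by
      intro Z k v; simp
    have hj : (i.succAbove k).removeNth X (k.predAbove i) = X i := by
      simp [Fin.removeNth, Fin.succAbove_succAbove_predAbove]
    have hi : i.removeNth X k = X (i.succAbove k) := rfl
    have hR := Fin.removeNth_removeNth_eq_swap X k i
    simp only [hF, hj, hupd, AlternatingMap.map_insertNth, hi, smul_smul, ← pow_add]
    have hs : (-1 : ℤ) ^ ((i.succAbove k : ℕ) + (k.predAbove i : ℕ)) = -(-1) ^ ((i : ℕ) + (k : ℕ)) :=
      Fin.neg_one_pow_succAbove_add_predAbove i k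
    have hv : η (Matrix.vecCons ⁅X (i.succAbove k), X i⁆
        ((k.predAbove i).removeNth ((i.succAbove k).removeNth X)))
        = - η (Matrix.vecCons ⁅X i, X (i.succAbove k)⁆ (k.removeNth (i.removeNth X))) := by
      rw [hR, ← lie_skew (X i) (X (i.succAbove k)), ← neg_one_smul ℂ ⁅X (i.succAbove k), X i⁆]
      rw [AlternatingMap.map_vecCons_smul, neg_one_smul, neg_neg]
    rw [hs, hv, neg_smul, smul_neg, neg_neg]
  have hsplit : ∑ p, F p = (2 : ℂ) • ∑ p : Fin (q + 1) × Fin q,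
      if p.1 ≤ p.2.castSucc then F p else 0 := by
    rw [← Finset.sum_filter, ← Finset.sum_filter_add_sum_filter_not Finset.univ
      (fun p : Fin (q + 1) × Fin q => p.1 ≤ p.2.castSucc) F, two_smul]
    congr 1
    refine Finset.sum_nbij' (fun p => (p.1.succAbove p.2, p.2.predAbove p.1))
      (fun p => (p.1.succAbove p.2, p.2.predAbove p.1)) ?_ ?_ ?_ ?_ ?_
    · rintro ⟨i, k⟩ h
      simp only [Finset.mem_filter, Finset.mem_univ, true_and, not_le] at h ⊢
      rw [Fin.succAbove_of_castSucc_lt _ _ h, Fin.predAbove_of_castSucc_lt _ _ h]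
      rw [Fin.le_iff_val_le_val]; rw [Fin.lt_def] at h
      simp at h ⊢; omega
    · rintro ⟨i, k⟩ h
      simp only [Finset.mem_filter, Finset.mem_univ, true_and, not_le] at h ⊢
      rw [Fin.succAbove_of_le_castSucc _ _ h, Fin.predAbove_of_le_castSucc _ _ h]
      rw [Fin.lt_def]; rw [Fin.le_def] at h
      simp at h ⊢; omega
    · rintro ⟨i, k⟩ h; simp [Fin.succAbove_succAbove_predAbove, Fin.predAbove_predAbove_succAbove]
    · rintro ⟨i, k⟩ h; simp [Fin.succAbove_succAbove_predAbove, Fin.predAbove_predAbove_succAbove]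
    · rintro p h; exact (hinv p).symm
  have h2 := two_smul_ceD_apply η X
  have h3 : ∑ i : Fin (q + 1), (-1 : ℤ) ^ (i : ℕ) • lieDer (X i) η (i.removeNth X)
      = ∑ i : Fin (q + 1), (-1 : ℤ) ^ (i : ℕ) • ⁅X i, η (i.removeNth X)⁆ - ∑ p, F p := by
    rw [Fintype.sum_prod_type, ← Finset.sum_sub_distrib]
    refine Finset.sum_congr rfl fun i _ => ?_
    rw [lieDer_apply, smul_sub, Finset.smul_sum]
  have h4 : ∑ i : Fin (q + 1), ∑ k : Fin q, (if i ≤ k.castSucc then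
          (-1 : ℤ) ^ (i : ℕ) • η (Function.update (i.removeNth X) k ⁅X i, X k.succ⁆) else 0)
      = ∑ p : Fin (q + 1) × Fin q, if p.1 ≤ p.2.castSucc then F p else 0 := by
    rw [Fintype.sum_prod_type]
    refine Finset.sum_congr rfl fun i _ => Finset.sum_congr rfl fun k _ => ?_
    split_ifs with h
    · simp only [hF, Fin.removeNth, Fin.succAbove_of_le_castSucc _ _ h]
    · rfl
  rw [h4]
  rw [h3, hsplit] at h2
  have h5 : (2 : ℂ) • ceD η X = (2 : ℂ) • (∑ i : Fin (q + 1), (-1 : ℤ) ^ (i : ℕ) •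
      ⁅X i, η (i.removeNth X)⁆ - ∑ p : Fin (q + 1) × Fin q,
        if p.1 ≤ p.2.castSucc then F p else 0) := by
    rw [h2, smul_sub, two_smul ℂ (∑ i : Fin (q + 1), (-1 : ℤ) ^ (i : ℕ) • ⁅X i, η (i.removeNth X)⁆)]
    abel
  exact smul_right_injective N (two_ne_zero (α := ℂ)) h5

end CE

section Smooth
variable (m : ℕ) {M : Type*} [TopologicalSpace M] [ChartedSpace (EuclideanSpace ℝ (Fin m)) M]

/-- The complex valued smooth functions on an open subset `W` of a manifold of dimension `m`. -/
def smoothSubalgebra (W : Opens M) : Subalgebra ℂ (W → ℂ) where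
  carrier := {f | ContMDiff (𝓡 m) 𝓘(ℝ, ℂ) ∞ f}
  mul_mem' hf hg :=
    (contDiff_mul (𝕜 := ℝ) (𝔸 := ℂ) (n := ∞)).contMDiff.comp (hf.prodMk_space hg)
  add_mem' hf hg := ContMDiff.add (M := W) hf hg
  algebraMap_mem' _ := contMDiff_const

/-- The algebra `C^∞(W)` of complex valued smooth functions on `W`. -/
def Sm (W : Opens M) : Type _ := smoothSubalgebra m W

instance (W : Opens M) : CommRing (Sm m W) := inferInstanceAs (CommRing (smoothSubalgebra m W))
instance (W : Opens M) : Algebra ℂ (Sm m W) := inferInstanceAs (Algebra ℂ (smoothSubalgebra m W))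
instance (W : Opens M) : FunLike (Sm m W) W ℂ where
  coe f := f.1
  coe_injective := Subtype.val_injective

/-- The Lie algebra `Γ(TW)` of (complex) smooth vector fields on `W`: the derivations of
`C^∞(W)`. -/
abbrev VF (W : Opens M) : Type _ := Derivation ℂ (Sm m W) (Sm m W)

variable {m}

namespace Sm
variable {W : Opens M}

/-- A smooth function as an element of `Sm m W`. -/
def mk (f : W → ℂ) (hf : ContMDiff (𝓡 m) 𝓘(ℝ, ℂ) ∞ f) : Sm m W := ⟨f, hf⟩

@[simp] lemma mk_apply (f : W → ℂ) (hf : ContMDiff (𝓡 m) 𝓘(ℝ, ℂ) ∞ f) (x : W) :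
    mk f hf x = f x := rfl

protected lemma contMDiff (f : Sm m W) : ContMDiff (𝓡 m) 𝓘(ℝ, ℂ) ∞ f := f.2

@[ext] protected lemma ext {f h : Sm m W} (H : ∀ x, f x = h x) : f = h := DFunLike.ext _ _ H

@[simp] lemma zero_apply (x : W) : (0 : Sm m W) x = 0 := rfl
@[simp] lemma one_apply (x : W) : (1 : Sm m W) x = 1 := rfl
@[simp] lemma add_apply (f h : Sm m W) (x : W) : (f + h) x = f x + h x := rfl
@[simp] lemma sub_apply (f h : Sm m W) (x : W) : (f - h) x = f x - h x := rfl
@[simp] lemma neg_apply (f : Sm m W) (x : W) : (-f) x = -f x := rfl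
@[simp] lemma mul_apply (f h : Sm m W) (x : W) : (f * h) x = f x * h x := rfl
@[simp] lemma smul_apply (c : ℂ) (f : Sm m W) (x : W) : (c • f) x = c * f x := rfl

end Sm

/-- Restriction of smooth functions. -/
def rho {V W : Opens M} (h : W ≤ V) : Sm m V →ₐ[ℂ] Sm m W where
  toFun f := ⟨fun x => f (inclusion h x), f.contMDiff.comp (contMDiff_inclusion h)⟩
  map_one' := rfl
  map_mul' _ _ := rfl
  map_zero' := rfl
  map_add' _ _ := rfl
  commutes' _ := rfl

lemma rho_apply {V W : Opens M} (h : W ≤ V) (f : Sm m V) (x : W) :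
    rho h f x = f (inclusion h x) := rfl

@[simp] lemma rho_refl {W : Opens M} (f : Sm m W) : rho (le_refl W) f = f := rfl

lemma rho_rho {V W Z : Opens M} (h : W ≤ V) (h' : Z ≤ W) (f : Sm m V) :
    rho h' (rho h f) = rho (h'.trans h) f := rfl

variable [IsManifold (𝓡 m) ∞ M] [T2Space M]

lemma Sm.exists_bump {V : Opens M} (x : V) {s : Set V} (hs : s ∈ 𝓝 x) :
    ∃ c : Sm m V, (∀ᶠ y in 𝓝 x, c y = 1) ∧ tsupport c ⊆ s := by
  obtain ⟨f, -, hf⟩ :=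
    ((SmoothBumpFunction.nhds_basis_tsupport (I := 𝓡 m) x).mem_iff).1 hs
  have hsm : ContMDiff (𝓡 m) 𝓘(ℝ, ℂ) ∞ (fun y : V => ((f y : ℝ) : ℂ)) :=
    (Complex.ofRealCLM.contDiff (n := ∞)).contMDiff.comp f.contMDiff
  refine ⟨Sm.mk _ hsm, ?_, ?_⟩
  · filter_upwards [f.eventuallyEq_one] with y hy
    simp [hy]
  · refine subset_trans (closure_mono ?_) hf
    intro y hy
    simpa using hy

/-- Every smooth function on `W ⊆ V` agrees near a given point of `W` with one on `V`. -/
lemma Sm.exists_ext {V W : Opens M} (h : W ≤ V) (g : Sm m W) (x : W) :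
    ∃ F : Sm m V, ∀ᶠ y in 𝓝 x, F (inclusion h y) = g y := by
  classical
  have hs : {y : V | (y : M) ∈ W} ∈ 𝓝 (inclusion h x) :=
    (W.isOpen.preimage continuous_subtype_val).mem_nhds x.2
  obtain ⟨c, hc1, hc2⟩ := Sm.exists_bump (m := m) (inclusion h x) hs
  set f0 : M → ℂ := fun y => if hy : y ∈ W then g ⟨y, hy⟩ else 0 with hf0
  have hf0W : (fun z : W => f0 z) = g := by
    funext z; simp [hf0]
  refine ⟨Sm.mk (fun y => c y * f0 y) ?_, ?_⟩
  · refine contMDiff_of_tsupport fun y hy => ?_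
    have hy' : (y : M) ∈ W := hc2 (closure_mono (fun z hz => by
      simp only [Function.mem_support] at hz ⊢; exact left_ne_zero_of_mul hz) hy)
    have h1 : ContMDiffAt (𝓡 m) 𝓘(ℝ, ℂ) ∞ (fun z : V => f0 z) y := by
      rw [contMDiffAt_subtype_iff]
      rw [← contMDiffAt_subtype_iff (U := W) (x := ⟨y, hy'⟩), hf0W]
      exact g.contMDiff _
    exact (contDiff_mul (𝕜 := ℝ) (𝔸 := ℂ) (n := ∞)).contMDiff.contMDiffAt.comp y
      ((c.contMDiff y).prodMk_space h1)
  · have hcont : Continuous (inclusion h : W → V) := continuous_inclusion h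
    filter_upwards [hcont.continuousAt.eventually hc1] with y hy
    have : f0 (y : M) = g y := congrFun hf0W y
    simp [hy, this]

lemma VF.congr_nhds {V : Opens M} (D : VF m V) {F G : Sm m V} {x : V}
    (h : ∀ᶠ y in 𝓝 x, F y = G y) : D F x = D G x := by
  obtain ⟨c, hc1, hc2⟩ := Sm.exists_bump (m := m) x h
  have h0 : c * (F - G) = 0 := by
    ext y
    by_cases hy : c y = 0
    · simp [hy]
    · have : F y = G y := hc2 (subset_closure hy)
      simp [this]
  have h1 : (D (c * (F - G))) x = 0 := by rw [h0, map_zero]; rfl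
  rw [D.leibniz, map_sub] at h1
  have hx : F x = G x := h.self_of_nhds
  have hcx : c x = 1 := hc1.self_of_nhds
  simp [hx, hcx] at h1
  exact sub_eq_zero.1 h1

lemma VF.value_eq {V W : Opens M} (h : W ≤ V) (D : VF m V) (g : Sm m W) (x : W) {F : Sm m V}
    (hF : ∀ᶠ y in 𝓝 x, F (inclusion h y) = g y) :
    (D (Sm.exists_ext h g x).choose) (inclusion h x) = D F (inclusion h x) := by
  apply VF.congr_nhds
  have hop : Topology.IsOpenEmbedding (inclusion h : W → V) := by
    refine ⟨Topology.IsEmbedding.inclusion (show (W : Set M) ⊆ V from h), ?_⟩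
    rw [Set.range_inclusion (show (W : Set M) ⊆ V from h)]
    exact W.isOpen.preimage continuous_subtype_val
  rw [← hop.map_nhds_eq, Filter.eventually_map]
  filter_upwards [(Sm.exists_ext h g x).choose_spec, hF] with y h1 h2
  rw [h1, h2]

/-- The action of `D` on functions on `W ⊆ V`, through local extensions. -/
def VF.resFun {V W : Opens M} (h : W ≤ V) (D : VF m V) (g : Sm m W) : Sm m W :=
  Sm.mk (fun x => (D (Sm.exists_ext h g x).choose) (inclusion h x)) (by
    intro x
    obtain ⟨F, hF⟩ := Sm.exists_ext h g x
    have h1 : ContMDiffAt (𝓡 m) 𝓘(ℝ, ℂ) ∞ (rho h (D F)) x := (rho h (D F)).contMDiff x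
    refine h1.congr_of_eventuallyEq ?_
    filter_upwards [hF.eventually_nhds] with y hy
    exact VF.value_eq h D g y hy)

lemma VF.resFun_apply {V W : Opens M} (h : W ≤ V) (D : VF m V) (g : Sm m W) (x : W) {F : Sm m V}
    (hF : ∀ᶠ y in 𝓝 x, F (inclusion h y) = g y) :
    VF.resFun h D g x = D F (inclusion h x) := VF.value_eq h D g x hF

/-- Restriction of vector fields to a smaller open subset; it is characterised by
`VF.res_rho`. -/
def VF.res {V W : Opens M} (h : W ≤ V) (D : VF m V) : VF m W :=
  Derivation.mk' (R := ℂ) (A := Sm m W) (M := Sm m W)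
    { toFun := VF.resFun h D
      map_add' := fun f g => by
        ext x
        obtain ⟨F, hF⟩ := Sm.exists_ext h f x
        obtain ⟨G, hG⟩ := Sm.exists_ext h g x
        have hFG : ∀ᶠ y in 𝓝 x, (F + G) (inclusion h y) = (f + g) y := by
          filter_upwards [hF, hG] with y h1 h2
          simp [h1, h2]
        rw [Sm.add_apply, VF.resFun_apply h D _ x hFG, VF.resFun_apply h D _ x hF,
          VF.resFun_apply h D _ x hG, map_add, Sm.add_apply]
      map_smul' := fun a f => by
        ext x
        obtain ⟨F, hF⟩ := Sm.exists_ext h f x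
        have hFG : ∀ᶠ y in 𝓝 x, (a • F) (inclusion h y) = (a • f) y := by
          filter_upwards [hF] with y h1
          simp [h1]
        rw [RingHom.id_apply, Sm.smul_apply, VF.resFun_apply h D _ x hFG,
          VF.resFun_apply h D _ x hF, D.map_smul, Sm.smul_apply] }
    (fun f g => by
        ext x
        obtain ⟨F, hF⟩ := Sm.exists_ext h f x
        obtain ⟨G, hG⟩ := Sm.exists_ext h g x
        have hFG : ∀ᶠ y in 𝓝 x, (F * G) (inclusion h y) = (f * g) y := by
          filter_upwards [hF, hG] with y h1 h2
          simp [h1, h2]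
        have hx := hF.self_of_nhds
        have hx' := hG.self_of_nhds
        simp only [LinearMap.coe_mk, AddHom.coe_mk, smul_eq_mul, Sm.add_apply, Sm.mul_apply]
        rw [VF.resFun_apply h D _ x hFG, VF.resFun_apply h D _ x hF,
          VF.resFun_apply h D _ x hG, D.leibniz]
        simp [hx, hx'])

lemma VF.res_rho {V W : Opens M} (h : W ≤ V) (D : VF m V) (F : Sm m V) :
    VF.res h D (rho h F) = rho h (D F) := by
  ext x
  exact VF.value_eq h D (rho h F) x (Filter.Eventually.of_forall fun _ => rfl)

/-- A vector field on `W ⊆ V` is determined by its values on restrictions from `V`. -/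
lemma VF.ext_rho {V W : Opens M} (h : W ≤ V) {D E : VF m W}
    (hDE : ∀ F : Sm m V, D (rho h F) = E (rho h F)) : D = E := by
  ext g x
  obtain ⟨F, hF⟩ := Sm.exists_ext h g x
  have hF' : ∀ᶠ y in 𝓝 x, g y = (rho h F) y := by
    filter_upwards [hF] with y hy
    exact hy.symm
  rw [VF.congr_nhds D hF', VF.congr_nhds E hF', hDE]

@[simp] lemma VF.res_refl {V : Opens M} (D : VF m V) : VF.res (le_refl V) D = D :=
  VF.ext_rho le_rfl fun F => by rw [VF.res_rho]; rfl

lemma VF.res_res {V W Z : Opens M} (h : W ≤ V) (h' : Z ≤ W) (D : VF m V) :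
    VF.res h' (VF.res h D) = VF.res (h'.trans h) D :=
  VF.ext_rho (h'.trans h) fun F => by
    rw [VF.res_rho, ← rho_rho h h', VF.res_rho, VF.res_rho, rho_rho]

lemma VF.res_add {V W : Opens M} (h : W ≤ V) (D E : VF m V) :
    VF.res h (D + E) = VF.res h D + VF.res h E :=
  VF.ext_rho h fun F => by simp [VF.res_rho]

lemma VF.res_smul {V W : Opens M} (h : W ≤ V) (f : Sm m V) (D : VF m V) :
    VF.res h (f • D) = rho h f • VF.res h D :=
  VF.ext_rho h fun F => by simp [VF.res_rho]

lemma VF.res_smul_const {V W : Opens M} (h : W ≤ V) (a : ℂ) (D : VF m V) :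
    VF.res h (a • D) = a • VF.res h D :=
  VF.ext_rho h fun F => by simp [VF.res_rho]

lemma VF.res_lie {V W : Opens M} (h : W ≤ V) (D E : VF m V) :
    VF.res h ⁅D, E⁆ = ⁅VF.res h D, VF.res h E⁆ :=
  VF.ext_rho h fun F => by simp [VF.res_rho, Derivation.commutator_apply]

end Smooth

section Trivial
variable (m : ℕ) {M : Type*} [TopologicalSpace M] [ChartedSpace (EuclideanSpace ℝ (Fin m)) M]
variable (g : Type*) [LieRing g] [LieAlgebra ℂ g]

/-- Sections `Γ(W × g) = C^∞(W) ⊗ g` of the trivial bundle in Lie algebras, with the pointwise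
bracket `[f ⊗ a, h ⊗ b] = f h ⊗ [a, b]`. -/
abbrev GSec (W : Opens M) : Type _ := Sm m W ⊗[ℂ] g

variable {m} {g}

/-- Restriction of sections of the trivial bundle. -/
def GSec.res {V W : Opens M} (h : W ≤ V) : GSec m g V →ₗ[ℂ] GSec m g W :=
  (rho h).toLinearMap.rTensor g

@[simp] lemma GSec.res_tmul {V W : Opens M} (h : W ≤ V) (f : Sm m V) (a : g) :
    GSec.res h (f ⊗ₜ[ℂ] a) = rho h f ⊗ₜ[ℂ] a := rfl

/-- The derivative `X · γ` of a section of the trivial bundle along a vector field. -/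
def VF.act {W : Opens M} (X : VF m W) : GSec m g W →ₗ[ℂ] GSec m g W :=
  X.toLinearMap.rTensor g

@[simp] lemma VF.act_tmul {W : Opens M} (X : VF m W) (f : Sm m W) (a : g) :
    X.act (f ⊗ₜ[ℂ] a) = X f ⊗ₜ[ℂ] a := rfl

lemma GSec.hom_ext {W : Opens M} {P : Type*} [AddCommGroup P] [Module ℂ P]
    {φ ψ : GSec m g W →ₗ[ℂ] P} (H : ∀ f a, φ (f ⊗ₜ a) = ψ (f ⊗ₜ a)) (x : GSec m g W) :
    φ x = ψ x := by
  have : φ = ψ := TensorProduct.ext' H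
  rw [this]

lemma VF.add_act {W : Opens M} (X Y : VF m W) (x : GSec m g W) :
    (X + Y).act x = X.act x + Y.act x :=
  GSec.hom_ext (φ := (X + Y).act) (ψ := X.act + Y.act)
    (fun f a => by simp [TensorProduct.add_tmul]) x

lemma VF.smul_act {W : Opens M} (f : Sm m W) (X : VF m W) (x : GSec m g W) :
    (f • X).act x = f • X.act x := by
  induction x using TensorProduct.induction_on with
  | zero => simp
  | tmul h a => simp [TensorProduct.smul_tmul']
  | add x y hx hy => simp [hx, hy]

lemma VF.smul_const_act {W : Opens M} (c : ℂ) (X : VF m W) (x : GSec m g W) :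
    (c • X).act x = c • X.act x :=
  GSec.hom_ext (φ := (c • X).act) (ψ := c • X.act)
    (fun f a => by simp [TensorProduct.smul_tmul']) x

lemma VF.lie_act {W : Opens M} (X Y : VF m W) (x : GSec m g W) :
    ⁅X, Y⁆.act x = X.act (Y.act x) - Y.act (X.act x) :=
  GSec.hom_ext (φ := ⁅X, Y⁆.act) (ψ := X.act ∘ₗ Y.act - Y.act ∘ₗ X.act)
    (fun f a => by simp [Derivation.commutator_apply, TensorProduct.sub_tmul]) x

lemma VF.act_smul {W : Opens M} (X : VF m W) (f : Sm m W) (x : GSec m g W) :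
    X.act (f • x) = f • X.act x + X f • x := by
  induction x using TensorProduct.induction_on with
  | zero => simp
  | tmul h a =>
    simp [TensorProduct.smul_tmul', TensorProduct.add_tmul, mul_comm]
  | add x y hx hy => simp only [smul_add, map_add, hx, hy]; abel

lemma VF.act_lie {W : Opens M} (X : VF m W) (x y : GSec m g W) :
    X.act ⁅x, y⁆ = ⁅X.act x, y⁆ + ⁅x, X.act y⁆ := by
  induction x using TensorProduct.induction_on with
  | zero => simp
  | tmul f a =>
    induction y using TensorProduct.induction_on with
    | zero => simp
    | tmul h b =>
      simp only [LieAlgebra.ExtendScalars.bracket_tmul, VF.act_tmul, Derivation.leibniz,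
        smul_eq_mul, TensorProduct.add_tmul]
      rw [add_comm, mul_comm h]
    | add y z hy hz => simp only [lie_add, map_add, hy, hz]; abel
  | add x z hx hz => simp only [add_lie, map_add, hx, hz]; abel

lemma GSec.res_lie {V W : Opens M} (h : W ≤ V) (x y : GSec m g V) :
    GSec.res h ⁅x, y⁆ = ⁅GSec.res h x, GSec.res h y⁆ := by
  induction x using TensorProduct.induction_on with
  | zero => simp
  | tmul f a =>
    induction y using TensorProduct.induction_on with
    | zero => simp
    | tmul k b => simp
    | add y z hy hz => simp only [lie_add, map_add, hy, hz]
  | add x z hx hz => simp only [add_lie, map_add, hx, hz]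

lemma GSec.res_smul {V W : Opens M} (h : W ≤ V) (f : Sm m V) (x : GSec m g V) :
    GSec.res h (f • x) = rho h f • GSec.res h x := by
  induction x using TensorProduct.induction_on with
  | zero => simp
  | tmul k a => simp [TensorProduct.smul_tmul']
  | add x y hx hy => simp [hx, hy]

lemma GSec.res_act [IsManifold (𝓡 m) ∞ M] [T2Space M] {V W : Opens M} (h : W ≤ V) (X : VF m V)
    (x : GSec m g V) : GSec.res h (X.act x) = (VF.res h X).act (GSec.res h x) :=
  GSec.hom_ext (φ := GSec.res h ∘ₗ X.act) (ψ := (VF.res h X).act ∘ₗ GSec.res h)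
    (fun f a => by simp [VF.res_rho]) x

lemma GSec.res_refl {V : Opens M} (x : GSec m g V) : GSec.res (le_refl V) x = x :=
  GSec.hom_ext (φ := GSec.res (le_refl V)) (ψ := LinearMap.id) (fun f a => by simp) x

lemma GSec.res_res {V W Z : Opens M} (h : W ≤ V) (h' : Z ≤ W) (x : GSec m g V) :
    GSec.res h' (GSec.res h x) = GSec.res (h'.trans h) x :=
  GSec.hom_ext (φ := GSec.res h' ∘ₗ GSec.res h) (ψ := GSec.res (h'.trans h))
    (fun f a => by simp [rho_rho]) x

variable (m) (g)

/-- Sections `X ⊕ γ` over `W` of the trivial Lie algebroid `TM ⊕ (M × g)`. -/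
@[ext] structure TSec (W : Opens M) where
  X : VF m W
  γ : GSec m g W

variable {m} {g}

namespace TSec
variable {W : Opens M}

/-- `X ⊕ γ` as a pair. -/
def equiv : TSec m g W ≃ VF m W × GSec m g W where
  toFun s := (s.X, s.γ)
  invFun p := ⟨p.1, p.2⟩

instance : AddCommGroup (TSec m g W) := equiv.addCommGroup
instance : Module (Sm m W) (TSec m g W) := equiv.module (Sm m W)
instance : Module ℂ (TSec m g W) := equiv.module ℂ

@[simp] lemma add_X (s t : TSec m g W) : (s + t).X = s.X + t.X := rfl
@[simp] lemma add_γ (s t : TSec m g W) : (s + t).γ = s.γ + t.γ := rfl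
@[simp] lemma zero_X : (0 : TSec m g W).X = 0 := rfl
@[simp] lemma zero_γ : (0 : TSec m g W).γ = 0 := rfl
@[simp] lemma smul_X (f : Sm m W) (s : TSec m g W) : (f • s).X = f • s.X := rfl
@[simp] lemma smul_γ (f : Sm m W) (s : TSec m g W) : (f • s).γ = f • s.γ := rfl
@[simp] lemma csmul_X (f : ℂ) (s : TSec m g W) : (f • s).X = f • s.X := rfl
@[simp] lemma csmul_γ (f : ℂ) (s : TSec m g W) : (f • s).γ = f • s.γ := rfl

/-- `[X ⊕ γ, Y ⊕ η] = [X, Y] ⊕ (X · η - Y · γ + [γ, η])`. -/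
instance : Bracket (TSec m g W) (TSec m g W) where
  bracket s t := ⟨⁅s.X, t.X⁆, s.X.act t.γ - t.X.act s.γ + ⁅s.γ, t.γ⁆⟩

@[simp] lemma lie_X (s t : TSec m g W) : ⁅s, t⁆.X = ⁅s.X, t.X⁆ := rfl
@[simp] lemma lie_γ (s t : TSec m g W) :
    ⁅s, t⁆.γ = s.X.act t.γ - t.X.act s.γ + ⁅s.γ, t.γ⁆ := rfl

instance : LieRing (TSec m g W) where
  add_lie s t u := by
    ext1
    · simp
    · simp only [lie_γ, add_X, add_γ, VF.add_act, map_add, add_lie]; abel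
  lie_add s t u := by
    ext1
    · simp
    · simp only [lie_γ, add_X, add_γ, VF.add_act, map_add, lie_add]; abel
  lie_self s := by
    ext1
    · simp
    · simp
  leibniz_lie s t u := by
    ext1
    · simp
    · simp only [lie_γ, lie_X, add_γ, VF.lie_act, map_add, map_sub, VF.act_lie, lie_add, lie_sub,
        add_lie, sub_lie]
      rw [leibniz_lie s.γ t.γ u.γ, ← lie_skew t.γ (u.X.act s.γ)]
      abel

instance : LieAlgebra ℂ (TSec m g W) where
  lie_smul c s t := by
    ext1
    · simp
    · simp only [lie_γ, csmul_X, csmul_γ, VF.smul_const_act, map_smul, lie_smul, smul_add, smul_sub]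

instance : LieRingModule (TSec m g W) (Sm m W) where
  bracket s f := s.X f
  add_lie _ _ _ := rfl
  lie_add s f h := s.X.map_add f h
  leibniz_lie s t f := by
    change s.X (t.X f) = ⁅s.X, t.X⁆ f + t.X (s.X f)
    rw [Derivation.commutator_apply]; abel

/-- The anchor of the trivial Lie algebroid is `X ⊕ γ ↦ X`. -/
@[simp] lemma lie_fun (s : TSec m g W) (f : Sm m W) : ⁅s, f⁆ = s.X f := rfl

instance : LieRinehartRing (Sm m W) (TSec m g W) where
  lie_smul_eq_mul' _ _ _ := rfl
  leibniz_mul_right' s f h := by simp; ring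
  leibniz_smul_right' s t f := by
    ext1
    · ext h : 1
      simp [Derivation.commutator_apply]
    · simp only [lie_γ, lie_fun, smul_X, smul_γ, add_γ, VF.smul_act, VF.act_smul, lie_smul,
        smul_add, smul_sub]
      abel

instance : LieRinehartAlgebra ℂ (Sm m W) (TSec m g W) where
  smul_assoc c f s := by
    ext1
    · simp
    · simp
  smul_lie _ _ _ := rfl
  lie_smul c s f := s.X.map_smul c f

end TSec

end Trivial

section Algebroid
universe u v w
variable (m : ℕ) (M : Type u) [TopologicalSpace M] [ChartedSpace (EuclideanSpace ℝ (Fin m)) M]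

/-- A presheaf of Lie–Rinehart algebras on the manifold `M`: for every open `W` a complex Lie
algebra and `C^∞(W)`-module `A(W)` acting on `C^∞(W)` by derivations (the anchor, written
`⁅X, f⁆ = ρ(X) · f`), subject to `[X, f Y] = f [X, Y] + (ρ(X) · f) Y`, with restriction maps
compatible with all the structure. -/
structure LRPresheaf where
  Sec : Opens M → Type v
  [lieRing : ∀ W, LieRing (Sec W)]
  [lieAlgebra : ∀ W, LieAlgebra ℂ (Sec W)]
  [module : ∀ W, Module (Sm m W) (Sec W)]
  [act : ∀ W, LieRingModule (Sec W) (Sm m W)]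
  [lieRinehartRing : ∀ W, LieRinehartRing (Sm m W) (Sec W)]
  [lieRinehart : ∀ W, LieRinehartAlgebra ℂ (Sm m W) (Sec W)]
  res : ∀ {V W : Opens M} (h : W ≤ V), LieRinehartAlgebra.Hom (rho (m := m) h) (Sec V) (Sec W)
  res_refl : ∀ {V : Opens M} (X : Sec V), res (le_refl V) X = X
  res_res : ∀ {V W Z : Opens M} (h : W ≤ V) (h' : Z ≤ W) (X : Sec V),
    res h' (res h X) = res (h'.trans h) X

attribute [instance] LRPresheaf.lieRing LRPresheaf.lieAlgebra LRPresheaf.module LRPresheaf.act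
  LRPresheaf.lieRinehartRing LRPresheaf.lieRinehart

variable {m M}

/-- A Lie algebroid over `M`, given by its sheaf of sections: a sheaf of Lie–Rinehart algebras
whose underlying sheaf of `C^∞`-modules is locally free of finite rank. -/
structure LRPresheaf.IsLieAlgebroid (A : LRPresheaf.{u, v} m M) : Prop where
  separated : ∀ (𝒰 : Set (Opens M)) (W : Opens M) (hle : ∀ V ∈ 𝒰, V ≤ W), W ≤ sSup 𝒰 →
    ∀ X Y : A.Sec W, (∀ V (hV : V ∈ 𝒰), A.res (hle V hV) X = A.res (hle V hV) Y) → X = Y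
  gluing : ∀ (𝒰 : Set (Opens M)) (W : Opens M) (hle : ∀ V ∈ 𝒰, V ≤ W), W ≤ sSup 𝒰 →
    ∀ s : ∀ V ∈ 𝒰, A.Sec V,
      (∀ V (hV : V ∈ 𝒰) V' (hV' : V' ∈ 𝒰),
        A.res (inf_le_left : V ⊓ V' ≤ V) (s V hV) = A.res (inf_le_right : V ⊓ V' ≤ V') (s V' hV')) →
      ∃ X : A.Sec W, ∀ V (hV : V ∈ 𝒰), A.res (hle V hV) X = s V hV
  locally_free : ∀ x : M, ∃ W : Opens M, x ∈ W ∧ ∃ (r : ℕ) (e : Fin r → A.Sec W),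
    ∀ (V : Opens M) (h : V ≤ W), LinearIndependent (Sm m V) (fun i => A.res h (e i)) ∧
      Submodule.span (Sm m V) (Set.range fun i => A.res h (e i)) = ⊤

/-- Transitivity: the anchor `A(M) → Γ(TM)` is surjective. -/
def LRPresheaf.IsTransitive (A : LRPresheaf.{u, v} m M) : Prop :=
  Function.Surjective (LieRinehartAlgebra.anchor ℂ (Sm m (⊤ : Opens M)) (A.Sec ⊤))

/-- The kernel `L` of the anchor. -/
def LRPresheaf.ker (A : LRPresheaf.{u, v} m M) (W : Opens M) : Submodule (Sm m W) (A.Sec W) where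
  carrier := {X | ∀ f : Sm m W, ⁅X, f⁆ = 0}
  zero_mem' f := by simp
  add_mem' {X Y} hX hY f := by rw [add_lie, hX, hY, add_zero]
  smul_mem' c X hX f := by simp [hX f]

lemma LRPresheaf.mem_ker {A : LRPresheaf.{u, v} m M} {W : Opens M} {X : A.Sec W} :
    X ∈ A.ker W ↔ ∀ f : Sm m W, ⁅X, f⁆ = 0 := Iff.rfl

variable (m M) in
/-- The trivial Lie algebroid `TLA(M, g)`, with sections `Γ(TW) ⊕ Γ(W × g)` over `W`. -/
def TLA [IsManifold (𝓡 m) ∞ M] [T2Space M] (g : Type w) [LieRing g] [LieAlgebra ℂ g] :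
    LRPresheaf m M where
  Sec W := TSec m g W
  res {V W} h :=
    { toFun := fun s => ⟨VF.res h s.X, GSec.res h s.γ⟩
      map_add' := fun s t => by ext1 <;> simp [VF.res_add]
      map_smul' := fun c s => by ext1 <;> simp [VF.res_smul_const]
      map_lie' := fun {s t} => by
        ext1
        · simp [VF.res_lie]
        · simp [GSec.res_act, GSec.res_lie]
      map_smul_apply' := fun f s => by
        ext1
        · exact VF.res_smul h f s.X
        · exact GSec.res_smul h f s.γ
      apply_lie' := fun f s => (VF.res_rho h s.X f).symm }
  res_refl X := by
    ext1
    · exact VF.res_refl _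
    · exact GSec.res_refl _
  res_res h h' X := by
    ext1
    · exact VF.res_res h h' X.X
    · exact GSec.res_res h h' X.γ

/-- The conditions which single out the `q`-forms on `A` over `U` with values in the kernel of the
anchor: a family, natural in the open subsets `W ⊆ U`, of alternating `C^∞(W)`-multilinear maps
`A(W)^q → L(W)`. -/
structure LRPresheaf.IsForm (A : LRPresheaf.{u, v} m M) (U : Opens M) {q : ℕ}
    (η : ∀ W : {W : Opens M // W ≤ U}, A.Sec W.1 [⋀^Fin q]→ₗ[ℂ] A.Sec W.1) : Prop where
  smul : ∀ W (X : Fin q → A.Sec W.1) (i : Fin q) (f : Sm m W.1) (Y : A.Sec W.1),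
    η W (Function.update X i (f • Y)) = f • η W (Function.update X i Y)
  mem_ker : ∀ W (X : Fin q → A.Sec W.1), η W X ∈ A.ker W.1
  res : ∀ (W Z : {W : Opens M // W ≤ U}) (h : Z.1 ≤ W.1) (X : Fin q → A.Sec W.1),
    A.res h (η W X) = η Z (fun i => A.res h (X i))

/-- `Ω^q(A_U, L_U)`: the `q`-forms on `A` over `U` with values in the kernel `L`. -/
def Form (A : LRPresheaf.{u, v} m M) (U : Opens M) (q : ℕ) :
    Submodule ℂ (∀ W : {W : Opens M // W ≤ U}, A.Sec W.1 [⋀^Fin q]→ₗ[ℂ] A.Sec W.1) where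
  carrier := {η | A.IsForm U η}
  zero_mem' :=
    { smul := fun W X i f Y => by simp
      mem_ker := fun W X => by simp
      res := fun W Z h X => by
        change A.res h 0 = 0
        exact (A.res h).map_zero }
  add_mem' {η ξ} hη hξ :=
    { smul := fun W X i f Y => by
        simp only [Pi.add_apply, AlternatingMap.add_apply, hη.smul, hξ.smul, smul_add]
      mem_ker := fun W X => by
        simp only [Pi.add_apply, AlternatingMap.add_apply]
        exact add_mem (hη.mem_ker W X) (hξ.mem_ker W X)
      res := fun W Z h X => by
        simp only [Pi.add_apply, AlternatingMap.add_apply]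
        rw [← hη.res, ← hξ.res]
        exact (A.res h).map_add _ _ }
  smul_mem' c η hη :=
    { smul := fun W X i f Y => by
        simp only [Pi.smul_apply, AlternatingMap.smul_apply, hη.smul, smul_comm c f]
      mem_ker := fun W X => by
        simp only [Pi.smul_apply, AlternatingMap.smul_apply]
        intro f
        rw [smul_lie, hη.mem_ker W X f, smul_zero]
      res := fun W Z h X => by
        simp only [Pi.smul_apply, AlternatingMap.smul_apply]
        rw [← hη.res]
        exact (A.res h).map_smul c _ }

end Algebroid

set_option linter.unusedSectionVars false

section CERinehart
variable {O K : Type*} [CommRing O] [Algebra ℂ O] [LieRing K] [LieAlgebra ℂ K] [Module O K]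
  [LieRingModule K O] [LieRinehartRing O K] [LieRinehartAlgebra ℂ O K] {q : ℕ}

lemma smul_lie_rinehart (f : O) (x y : K) : ⁅f • x, y⁆ = f • ⁅x, y⁆ - ⁅y, f⁆ • x := by
  rw [← lie_skew, LieRinehartRing.leibniz_smul_right, ← lie_skew x y, smul_neg]; abel

lemma ceD_mem_ker (η : K [⋀^Fin q]→ₗ[ℂ] K) (hk : ∀ X (f : O), ⁅η X, f⁆ = 0)
    (X : Fin (q + 1) → K) (f : O) : ⁅ceD η X, f⁆ = 0 := by
  rw [ceD_apply, sub_lie, sum_lie, sum_lie]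
  rw [Finset.sum_eq_zero, Finset.sum_eq_zero, sub_zero]
  · intro i _
    rw [sum_lie]
    refine Finset.sum_eq_zero fun k _ => ?_
    split_ifs
    · rw [zsmul_lie, hk, smul_zero]
    · exact zero_lie f
  · intro i _
    rw [zsmul_lie, lie_lie, hk, hk, lie_zero, sub_zero, smul_zero]

lemma lieDer_smul_vecCons (η : K [⋀^Fin (q + 1)]→ₗ[ℂ] K)
    (hs : ∀ (X : Fin (q + 1) → K) i (f : O) Y,
      η (Function.update X i (f • Y)) = f • η (Function.update X i Y))
    (x y : K) (f : O) (R : Fin q → K) :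
    lieDer x η (Matrix.vecCons (f • y) R) = f • lieDer x η (Matrix.vecCons y R) := by
  have hs0 : ∀ (y : K) (R : Fin q → K),
      η (Matrix.vecCons (f • y) R) = f • η (Matrix.vecCons y R) := by
    intro y R
    have h := hs (Matrix.vecCons y R) 0 f y
    simpa [Matrix.vecCons] using h
  have hu0 : ∀ (y z : K) (R : Fin q → K),
      Function.update (Matrix.vecCons y R) 0 z = Matrix.vecCons z R := by
    intro y z R; simp [Matrix.vecCons]
  have huS : ∀ (y z : K) (R : Fin q → K) (k : Fin q),
      Function.update (Matrix.vecCons y R) k.succ z = Matrix.vecCons y (Function.update R k z) := by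
    intro y z R k; simp [Matrix.vecCons, Fin.cons_update]
  rw [lieDer_apply, lieDer_apply, Fin.sum_univ_succ, Fin.sum_univ_succ]
  simp only [hu0, huS, hs0, Matrix.cons_val_zero, Matrix.cons_val_succ,
    LieRinehartRing.leibniz_smul_right]
  have hadd : η (Matrix.vecCons (f • ⁅x, y⁆ + ⁅x, f⁆ • y) R)
      = f • η (Matrix.vecCons ⁅x, y⁆ R) + ⁅x, f⁆ • η (Matrix.vecCons y R) := by
    rw [AlternatingMap.map_vecCons_add, hs0]
    congr 1
    have h := hs (Matrix.vecCons y R) 0 ⁅x, f⁆ y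
    simpa [Matrix.vecCons] using h
  rw [hadd, ← Finset.smul_sum, smul_sub, smul_add]
  abel

lemma lieDer_smul_left (η : K [⋀^Fin q]→ₗ[ℂ] K)
    (hs : ∀ (X : Fin q → K) i (f : O) Y,
      η (Function.update X i (f • Y)) = f • η (Function.update X i Y))
    (hk : ∀ X (f : O), ⁅η X, f⁆ = 0) (x : K) (f : O) (Y : Fin q → K) :
    lieDer (f • x) η Y = f • lieDer x η Y + ∑ k, ⁅Y k, f⁆ • η (Function.update Y k x) := by
  have h1 : ∀ k, η (Function.update Y k ⁅f • x, Y k⁆)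
      = f • η (Function.update Y k ⁅x, Y k⁆) - ⁅Y k, f⁆ • η (Function.update Y k x) := by
    intro k
    rw [smul_lie_rinehart, AlternatingMap.map_update_sub, hs, hs]
  rw [lieDer_apply, lieDer_apply]
  simp only [h1]
  rw [Finset.sum_sub_distrib, smul_lie_rinehart, hk, zero_smul, ← Finset.smul_sum, smul_sub]
  abel

lemma ceD_smul_vecCons (η : K [⋀^Fin q]→ₗ[ℂ] K)
    (hs : ∀ (X : Fin q → K) i (f : O) Y,
      η (Function.update X i (f • Y)) = f • η (Function.update X i Y))
    (hk : ∀ X (f : O), ⁅η X, f⁆ = 0) (x : K) (f : O) (Y : Fin q → K) :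
    ceD η (Matrix.vecCons (f • x) Y) = f • ceD η (Matrix.vecCons x Y) := by
  have : SMulCommClass ℂ O K := ⟨fun c f y => by
    rw [← algebraMap_smul O c y, ← algebraMap_smul O c (f • y), smul_smul, smul_smul, mul_comm]⟩
  refine smul_right_injective K (two_ne_zero (α := ℂ)) ?_
  change (2 : ℂ) • _ = (2 : ℂ) • f • _
  rw [smul_comm (2 : ℂ) f, two_smul_ceD_apply, two_smul_ceD_apply]
  have hrem0 : ∀ z : K, (0 : Fin (q + 1)).removeNth (Matrix.vecCons z Y) = Y := by
    intro z; simp [Matrix.vecCons]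
  have hz : ∀ (n : ℕ) (g : O) (y : K), (-1 : ℤ) ^ n • g • y = g • (-1 : ℤ) ^ n • y := by
    intro n g y; rw [smul_comm]
  cases q with
  | zero =>
    simp only [Fin.sum_univ_succ, Finset.univ_eq_empty, Finset.sum_empty, hrem0,
      Matrix.cons_val_zero, lieDer_smul_left η hs hk, smul_lie_rinehart f x, hk, zero_smul]
    simp
  | succ q =>
    have hremS : ∀ (z : K) (k : Fin (q + 1)),
        k.succ.removeNth (Matrix.vecCons z Y) = Matrix.vecCons z (k.removeNth Y) := by
      intro z k
      funext j
      refine Fin.cases ?_ (fun j => ?_) j <;> simp [Fin.removeNth, Matrix.vecCons]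
    have hs0 : ∀ (y : K) (R : Fin q → K),
        η (Matrix.vecCons (f • y) R) = f • η (Matrix.vecCons y R) := by
      intro y R
      have h := hs (Matrix.vecCons y R) 0 f y
      simpa [Matrix.vecCons] using h
    have hcor : ∀ k : Fin (q + 1), (-1 : ℤ) ^ ((k.succ : Fin (q + 2)) : ℕ) •
        ⁅Y k, f⁆ • η (Matrix.vecCons x (k.removeNth Y)) = - (⁅Y k, f⁆ • η (Function.update Y k x)) := by
      intro k
      rw [← Fin.insertNth_removeNth k x Y, AlternatingMap.map_insertNth, hz, ← smul_neg]
      congr 1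
      rw [Fin.val_succ, pow_succ, mul_neg_one, neg_smul]
    rw [Fin.sum_univ_succ (n := q + 1), Fin.sum_univ_succ (n := q + 1),
      Fin.sum_univ_succ (n := q + 1), Fin.sum_univ_succ (n := q + 1)]
    simp only [hrem0, hremS, Matrix.cons_val_zero, Matrix.cons_val_succ, hs0,
      lieDer_smul_left η hs hk, lieDer_smul_vecCons η hs, smul_lie_rinehart f x, hk, zero_smul,
      LieRinehartRing.leibniz_smul_right, smul_add, Finset.sum_add_distrib, hcor,
      Finset.sum_neg_distrib, hz, ← Finset.smul_sum]
    simp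
    abel

lemma ceD_smul (η : K [⋀^Fin q]→ₗ[ℂ] K)
    (hs : ∀ (X : Fin q → K) i (f : O) Y,
      η (Function.update X i (f • Y)) = f • η (Function.update X i Y))
    (hk : ∀ X (f : O), ⁅η X, f⁆ = 0) (X : Fin (q + 1) → K) (i : Fin (q + 1)) (f : O) (x : K) :
    ceD η (Function.update X i (f • x)) = f • ceD η (Function.update X i x) := by
  rw [← Fin.insertNth_removeNth i (f • x) X, ← Fin.insertNth_removeNth i x X,
    AlternatingMap.map_insertNth, AlternatingMap.map_insertNth, ceD_smul_vecCons η hs hk, smul_comm]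

end CERinehart

/-- The Chevalley–Eilenberg differential is natural for maps compatible with the brackets. -/
lemma ceD_natural {K K' : Type*} [LieRing K] [LieAlgebra ℂ K] [LieRing K'] [LieAlgebra ℂ K']
    {q : ℕ} (r s : K → K') (hs : ∀ x y, s (x + y) = s x + s y)
    (hr : ∀ x y, r ⁅x, y⁆ = ⁅r x, r y⁆) (hrs : ∀ x y, s ⁅x, y⁆ = ⁅r x, s y⁆)
    (η : K [⋀^Fin q]→ₗ[ℂ] K) (ξ : K' [⋀^Fin q]→ₗ[ℂ] K')
    (h : ∀ X, s (η X) = ξ (fun i => r (X i))) (X : Fin (q + 1) → K) :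
    s (ceD η X) = ceD ξ (fun i => r (X i)) := by
  let S : K →+ K' := AddMonoidHom.mk' s hs
  have hS : ∀ x, s x = S x := fun _ => rfl
  have hu : ∀ (Y : Fin q → K) (k : Fin q) (z : K),
      (fun i => r (Function.update Y k z i)) = Function.update (fun i => r (Y i)) k (r z) := by
    intro Y k z; funext i
    rcases eq_or_ne i k with rfl | hik
    · simp
    · simp [hik]
  rw [ceD_apply, ceD_apply, hS, map_sub, map_sum, map_sum]
  congr 1
  · refine Finset.sum_congr rfl fun i _ => ?_
    rw [map_zsmul, ← hS, hrs, h]; rfl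
  · refine Finset.sum_congr rfl fun i _ => ?_
    rw [map_sum]
    refine Finset.sum_congr rfl fun k _ => ?_
    split_ifs
    · rw [map_zsmul, ← hS, h, hu, hr]; rfl
    · exact map_zero S

section FormCalculus
universe u v w
variable {m : ℕ} {M : Type u} [TopologicalSpace M] [ChartedSpace (EuclideanSpace ℝ (Fin m)) M]

/-- The differential `d̂` of `Ω^•(A_U, L_U)`: on every `W ⊆ U` it is the Chevalley–Eilenberg
differential of the Lie algebra `A(W)` acting on the kernel `L(W)` by the adjoint representation. -/
def dForm (A : LRPresheaf.{u, v} m M) (U : Opens M) (q : ℕ) :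
    Form A U q →ₗ[ℂ] Form A U (q + 1) where
  toFun η := ⟨fun W => ceD (η.1 W),
    { smul := fun W X i f Y => ceD_smul (η.1 W) (η.2.smul W) (η.2.mem_ker W) X i f Y
      mem_ker := fun W X => ceD_mem_ker (η.1 W) (η.2.mem_ker W) X
      res := fun W Z h X => ceD_natural (A.res h) (A.res h) (A.res h).map_add
        (fun x y => (A.res h).toLieHom.map_lie x y) (fun x y => (A.res h).toLieHom.map_lie x y)
        (η.1 W) (η.1 Z) (η.2.res W Z h) X }⟩
  map_add' η ξ := by ext1; funext W; exact map_add _ _ _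
  map_smul' c η := by
    ext1; funext W
    exact map_smul (ceD (K := A.Sec W.1) (N := A.Sec W.1) (q := q)) c (η.1 W)

lemma dForm_apply {A : LRPresheaf.{u, v} m M} {U : Opens M} {q : ℕ} (η : Form A U q)
    (W : {W : Opens M // W ≤ U}) : (dForm A U q η).1 W = ceD (η.1 W) := rfl

/-- Restriction of forms to a smaller open subset. -/
def restrict (A : LRPresheaf.{u, v} m M) {U V : Opens M} (h : V ≤ U) (q : ℕ) :
    Form A U q →ₗ[ℂ] Form A V q where
  toFun η := ⟨fun W => η.1 ⟨W.1, W.2.trans h⟩,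
    { smul := fun W => η.2.smul ⟨W.1, W.2.trans h⟩
      mem_ker := fun W => η.2.mem_ker ⟨W.1, W.2.trans h⟩
      res := fun W Z => η.2.res ⟨W.1, W.2.trans h⟩ ⟨Z.1, Z.2.trans h⟩ }⟩
  map_add' _ _ := rfl
  map_smul' _ _ := rfl

/-- Isomorphisms `A_U ≅ B_U` of (presheaves of) Lie–Rinehart algebras over the open subset `U`. -/
structure LRIso (A : LRPresheaf.{u, v} m M) (B : LRPresheaf.{u, w} m M) (U : Opens M) where
  e : ∀ W, W ≤ U → A.Sec W ≃ₗ[Sm m W] B.Sec W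
  map_lie : ∀ W (h : W ≤ U) (X Y : A.Sec W), e W h ⁅X, Y⁆ = ⁅e W h X, e W h Y⁆
  anchor : ∀ W (h : W ≤ U) (X : A.Sec W) (f : Sm m W), ⁅e W h X, f⁆ = ⁅X, f⁆
  map_res : ∀ W (h : W ≤ U) Z (h' : Z ≤ W) (X : A.Sec W),
    e Z (h'.trans h) (A.res h' X) = B.res h' (e W h X)

namespace LRIso
variable {A : LRPresheaf.{u, v} m M} {B : LRPresheaf.{u, w} m M} {U : Opens M}

/-- The inverse isomorphism. -/
def symm (E : LRIso A B U) : LRIso B A U where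
  e W h := (E.e W h).symm
  map_lie W h X Y := by
    apply (E.e W h).injective
    rw [E.map_lie]; simp
  anchor W h X f := by
    rw [← E.anchor W h]; simp
  map_res W h Z h' X := by
    apply (E.e Z (h'.trans h)).injective
    rw [E.map_res W h Z h']; simp

/-- The composite isomorphism. -/
def trans {C : LRPresheaf m M} (E : LRIso A B U) (F : LRIso B C U) : LRIso A C U where
  e W h := (E.e W h).trans (F.e W h)
  map_lie W h X Y := by simp [E.map_lie, F.map_lie]
  anchor W h X f := by simp [E.anchor, F.anchor]
  map_res W h Z h' X := by
    change F.e Z _ (E.e Z _ (A.res h' X)) = C.res h' (F.e W h (E.e W h X))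
    rw [E.map_res W h Z h', F.map_res W h Z h']

/-- Restriction of an isomorphism to a smaller open subset. -/
def restrict {V : Opens M} (E : LRIso A B U) (h : V ≤ U) : LRIso A B V where
  e W hW := E.e W (hW.trans h)
  map_lie W hW := E.map_lie W (hW.trans h)
  anchor W hW := E.anchor W (hW.trans h)
  map_res W hW := E.map_res W (hW.trans h)

/-- `ω ↦ e⁻¹ ∘ ω ∘ e`. -/
def pull (E : LRIso A B U) (q : ℕ) : Form B U q →ₗ[ℂ] Form A U q where
  toFun η := ⟨fun W => (((E.e W.1 W.2).symm.restrictScalars ℂ).toLinearMap).compAlternatingMap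
      ((η.1 W).compLinearMap ((E.e W.1 W.2).restrictScalars ℂ).toLinearMap),
    { smul := fun W X i f Y => by
        have hu : ∀ z : A.Sec W.1, (fun j => E.e W.1 W.2 (Function.update X i z j))
            = Function.update (fun j => E.e W.1 W.2 (X j)) i (E.e W.1 W.2 z) := by
          intro z; funext j
          rcases eq_or_ne j i with rfl | hj
          · simp
          · simp [hj]
        change (E.e W.1 W.2).symm (η.1 W (fun j => E.e W.1 W.2 (Function.update X i (f • Y) j)))
          = f • (E.e W.1 W.2).symm (η.1 W (fun j => E.e W.1 W.2 (Function.update X i Y j)))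
        rw [hu, hu, map_smul, η.2.smul, map_smul]
      mem_ker := fun W X f => by
        change ⁅(E.e W.1 W.2).symm (η.1 W (fun j => E.e W.1 W.2 (X j))), f⁆ = 0
        rw [← E.anchor W.1 W.2, LinearEquiv.apply_symm_apply]
        exact η.2.mem_ker W _ f
      res := fun W Z h X => by
        change A.res h ((E.symm.e W.1 W.2) (η.1 W (fun j => E.e W.1 W.2 (X j))))
          = E.symm.e Z.1 Z.2 (η.1 Z (fun j => E.e Z.1 Z.2 (A.res h (X j))))
        rw [← E.symm.map_res W.1 W.2 Z.1 h, η.2.res W Z h]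
        congr 2
        funext j
        exact (E.map_res W.1 W.2 Z.1 h (X j)).symm }⟩
  map_add' η ξ := by ext1; funext W; ext X; exact map_add (E.e W.1 W.2).symm _ _
  map_smul' c η := by
    ext1; funext W; ext X
    exact map_smul ((E.e W.1 W.2).symm.restrictScalars ℂ) c _

lemma pull_apply (E : LRIso A B U) {q : ℕ} (η : Form B U q) (W : {W : Opens M // W ≤ U})
    (X : Fin q → A.Sec W.1) :
    (E.pull q η).1 W X = (E.e W.1 W.2).symm (η.1 W (fun i => E.e W.1 W.2 (X i))) := rfl

lemma pull_d (E : LRIso A B U) {q : ℕ} (η : Form B U q) :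
    E.pull (q + 1) (dForm B U q η) = dForm A U q (E.pull q η) := by
  ext1; funext W; ext X
  apply (E.e W.1 W.2).injective
  rw [pull_apply, LinearEquiv.apply_symm_apply, dForm_apply, dForm_apply]
  refine (ceD_natural (E.e W.1 W.2) (E.e W.1 W.2) (map_add _) (E.map_lie W.1 W.2)
    (E.map_lie W.1 W.2) ((E.pull q η).1 W) (η.1 W) ?_ X).symm
  intro X
  rw [pull_apply, LinearEquiv.apply_symm_apply]

end LRIso

variable [IsManifold (𝓡 m) ∞ M] [T2Space M]

/-- A local trivialization `(U, Ψ, ∇⁰)` of `A` over the open subset `U`: an isomorphism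
`Ψ : U × g ≅ L_U` of bundles in Lie algebras and a flat connection `∇⁰ : TU → A_U` (both given by
their actions on sections over the open subsets of `U`) such that `[∇⁰_X, Ψ γ] = Ψ (X · γ)`. -/
structure LocalTriv (A : LRPresheaf.{u, v} m M) (g : Type w) [LieRing g] [LieAlgebra ℂ g]
    (U : Opens M) where
  Ψ : ∀ W, W ≤ U → GSec m g W ≃ₗ[Sm m W] A.ker W
  Ψ_lie : ∀ W (h : W ≤ U) (γ ξ : GSec m g W),
    (Ψ W h ⁅γ, ξ⁆ : A.Sec W) = ⁅(Ψ W h γ : A.Sec W), (Ψ W h ξ : A.Sec W)⁆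
  Ψ_res : ∀ W (h : W ≤ U) Z (h' : Z ≤ W) (γ : GSec m g W),
    (Ψ Z (h'.trans h) (GSec.res h' γ) : A.Sec Z) = A.res h' (Ψ W h γ : A.Sec W)
  nabla : ∀ W, W ≤ U → VF m W →ₗ[Sm m W] A.Sec W
  nabla_lie : ∀ W (h : W ≤ U) (X Y : VF m W), nabla W h ⁅X, Y⁆ = ⁅nabla W h X, nabla W h Y⁆
  nabla_anchor : ∀ W (h : W ≤ U) (X : VF m W) (f : Sm m W), ⁅nabla W h X, f⁆ = X f
  nabla_res : ∀ W (h : W ≤ U) Z (h' : Z ≤ W) (X : VF m W),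
    nabla Z (h'.trans h) (VF.res h' X) = A.res h' (nabla W h X)
  nabla_Ψ : ∀ W (h : W ≤ U) (X : VF m W) (γ : GSec m g W),
    ⁅nabla W h X, (Ψ W h γ : A.Sec W)⁆ = (Ψ W h (X.act γ) : A.Sec W)

namespace LocalTriv
variable {A : LRPresheaf.{u, v} m M} {g : Type w} [LieRing g] [LieAlgebra ℂ g] {U : Opens M}

/-- The map `X ⊕ γ ↦ ∇⁰_X + Ψ γ`. -/
def Slin (T : LocalTriv A g U) (W : Opens M) (h : W ≤ U) : TSec m g W →ₗ[Sm m W] A.Sec W where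
  toFun s := T.nabla W h s.X + T.Ψ W h s.γ
  map_add' s t := by simp only [TSec.add_X, TSec.add_γ, map_add, Submodule.coe_add]; abel
  map_smul' f s := by
    simp only [TSec.smul_X, TSec.smul_γ, map_smul, Submodule.coe_smul, RingHom.id_apply, smul_add]

lemma Slin_apply (T : LocalTriv A g U) (W : Opens M) (h : W ≤ U) (s : TSec m g W) :
    T.Slin W h s = T.nabla W h s.X + T.Ψ W h s.γ := rfl

lemma Slin_anchor (T : LocalTriv A g U) (W : Opens M) (h : W ≤ U) (s : TSec m g W) (f : Sm m W) :
    ⁅T.Slin W h s, f⁆ = s.X f := by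
  rw [Slin_apply, add_lie, T.nabla_anchor, (T.Ψ W h s.γ).2 f, add_zero]

lemma Slin_bijective (T : LocalTriv A g U) (W : Opens M) (h : W ≤ U) :
    Function.Bijective (T.Slin W h) := by
  constructor
  · rw [← LinearMap.ker_eq_bot, LinearMap.ker_eq_bot']
    intro s hs
    have hX : s.X = 0 := by
      ext1 f
      rw [← T.Slin_anchor W h s f, hs, zero_lie]; rfl
    rw [Slin_apply, hX, map_zero, zero_add] at hs
    have hγ : s.γ = 0 := (T.Ψ W h).map_eq_zero_iff.1 (Subtype.ext hs)
    ext1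
    · exact hX
    · exact hγ
  · intro Y
    let D : VF m W := LieRinehartAlgebra.anchor ℂ (Sm m W) (A.Sec W) Y
    have hk : Y - T.nabla W h D ∈ A.ker W := by
      intro f
      rw [sub_lie, T.nabla_anchor]
      exact sub_self _
    refine ⟨⟨D, (T.Ψ W h).symm ⟨_, hk⟩⟩, ?_⟩
    rw [Slin_apply, LinearEquiv.apply_symm_apply]
    exact add_sub_cancel _ _

/-- The isomorphism of Lie algebroids `S : TLA(U, g) ≅ A_U`, `S (X ⊕ γ) = ∇⁰_X + Ψ γ`. -/
def S (T : LocalTriv A g U) : LRIso (TLA m M g) A U where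
  e W h := LinearEquiv.ofBijective (T.Slin W h) (T.Slin_bijective W h)
  map_lie W h (s t : TSec m g W) := by
    change T.Slin W h ⁅s, t⁆ = ⁅T.Slin W h s, T.Slin W h t⁆
    simp only [Slin_apply, TSec.lie_X, TSec.lie_γ, map_add, map_sub, T.nabla_lie, add_lie, lie_add,
      Submodule.coe_add, Submodule.coe_sub, T.Ψ_lie, T.nabla_Ψ]
    rw [← lie_skew (T.Ψ W h s.γ : A.Sec W) (T.nabla W h t.X), T.nabla_Ψ]
    abel
  anchor W h s f := T.Slin_anchor W h s f
  map_res W h Z h' (s : TSec m g W) := by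
    change T.Slin Z (h'.trans h) ⟨VF.res h' s.X, GSec.res h' s.γ⟩ = A.res h' (T.Slin W h s)
    rw [Slin_apply, Slin_apply]
    have : A.res h' (T.nabla W h s.X + (T.Ψ W h s.γ : A.Sec W))
        = A.res h' (T.nabla W h s.X) + A.res h' (T.Ψ W h s.γ : A.Sec W) := (A.res h').map_add _ _
    rw [this, ← T.nabla_res, ← T.Ψ_res]

/-- The local expression `ω_loc = Ψ⁻¹ ∘ ω ∘ S` on `U` of a global form `ω ∈ Ω^q(A, L)`. -/
def loc (T : LocalTriv A g U) (q : ℕ) : Form A (⊤ : Opens M) q →ₗ[ℂ] Form (TLA m M g) U q :=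
  T.S.pull q ∘ₗ restrict A le_top q

/-- The map `α̂_U^V : ω ↦ α ∘ ω ∘ s` on `Ω^q_TLA(V, g)` attached to trivializations over `U` and
over `V ⊆ U`, where `s = S_U⁻¹ ∘ S_V` and `α = Ψ_V⁻¹ ∘ Ψ_U` is the restriction of `s⁻¹` to the
kernel. -/
def alphaHat {V : Opens M} (TU : LocalTriv A g U) (TV : LocalTriv A g V) (h : V ≤ U) (q : ℕ) :
    Form (TLA m M g) V q →ₗ[ℂ] Form (TLA m M g) V q :=
  (TV.S.trans (TU.S.restrict h).symm).pull q

/-- The restriction map `i_U^V(ω) = α̂_U^V(ω|_V)` of the presheaf `Ω^q_TLA(-, g)`. -/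
def resMap {V : Opens M} (TU : LocalTriv A g U) (TV : LocalTriv A g V) (h : V ≤ U) (q : ℕ) :
    Form (TLA m M g) U q →ₗ[ℂ] Form (TLA m M g) V q :=
  alphaHat TU TV h q ∘ₗ restrict (TLA m M g) h q

lemma resMap_d {V : Opens M} (TU : LocalTriv A g U) (TV : LocalTriv A g V) (h : V ≤ U) (q : ℕ)
    (η : Form (TLA m M g) U q) :
    resMap TU TV h (q + 1) (dForm _ U q η) = dForm _ V q (resMap TU TV h q η) :=
  (LRIso.pull_d _ (restrict (TLA m M g) h q η))

end LocalTriv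

end FormCalculus

section Cohomology

/-- The coboundaries of a sequence `X⁰ → X¹ → ⋯`. -/
def cobd {X : ℕ → Type*} [∀ n, AddCommGroup (X n)] [∀ n, Module ℂ (X n)]
    (d : ∀ n, X n →ₗ[ℂ] X (n + 1)) : ∀ n, Submodule ℂ (X n)
  | 0 => ⊥
  | n + 1 => LinearMap.range (d n)

/-- The cohomology `ker d / im d` of a cochain complex `X⁰ → X¹ → ⋯` in degree `n`. -/
def Coh {X : ℕ → Type*} [∀ n, AddCommGroup (X n)] [∀ n, Module ℂ (X n)]
    (d : ∀ n, X n →ₗ[ℂ] X (n + 1)) (n : ℕ) : Type _ :=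
  LinearMap.ker (d n) ⧸ (cobd d n).submoduleOf (LinearMap.ker (d n))

instance {X : ℕ → Type*} [∀ n, AddCommGroup (X n)] [∀ n, Module ℂ (X n)]
    (d : ∀ n, X n →ₗ[ℂ] X (n + 1)) (n : ℕ) : AddCommGroup (Coh d n) :=
  inferInstanceAs (AddCommGroup (LinearMap.ker (d n) ⧸ (cobd d n).submoduleOf _))

instance {X : ℕ → Type*} [∀ n, AddCommGroup (X n)] [∀ n, Module ℂ (X n)]
    (d : ∀ n, X n →ₗ[ℂ] X (n + 1)) (n : ℕ) : Module ℂ (Coh d n) :=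
  inferInstanceAs (Module ℂ (LinearMap.ker (d n) ⧸ (cobd d n).submoduleOf _))

/-- The class of a cocycle. -/
def Coh.mk {X : ℕ → Type*} [∀ n, AddCommGroup (X n)] [∀ n, Module ℂ (X n)]
    (d : ∀ n, X n →ₗ[ℂ] X (n + 1)) {n : ℕ} (x : X n) (hx : d n x = 0) : Coh d n :=
  Submodule.Quotient.mk ⟨x, LinearMap.mem_ker.2 hx⟩

/-- The map induced in cohomology by a morphism of complexes. -/
def Coh.map {X Y : ℕ → Type*} [∀ n, AddCommGroup (X n)] [∀ n, Module ℂ (X n)]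
    [∀ n, AddCommGroup (Y n)] [∀ n, Module ℂ (Y n)]
    (d : ∀ n, X n →ₗ[ℂ] X (n + 1)) (d' : ∀ n, Y n →ₗ[ℂ] Y (n + 1))
    (f : ∀ n, X n →ₗ[ℂ] Y n) (hf : ∀ n x, f (n + 1) (d n x) = d' n (f n x)) (n : ℕ) :
    Coh d n →ₗ[ℂ] Coh d' n :=
  Submodule.mapQ _ _
    ((f n).restrict (p := LinearMap.ker (d n)) (q := LinearMap.ker (d' n)) fun x hx => by
      rw [LinearMap.mem_ker] at hx ⊢
      rw [← hf, hx, map_zero]) (by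
    rintro ⟨x, hx⟩ h
    cases n with
    | zero =>
      have h0 : x = 0 := h
      change f 0 x = 0
      rw [h0, map_zero]
    | succ n =>
      obtain ⟨y, hy⟩ : ∃ y, d n y = x := h
      exact ⟨f n y, by rw [← hf, hy]; rfl⟩)

end Cohomology

section Bicomplex
variable {C : ℕ → ℕ → Type*} [∀ p q, AddCommGroup (C p q)] [∀ p q, Module ℂ (C p q)]

/-- The horizontal part of the total differential, on families with one component in every
`C^{p,q}`. -/
def horD (δ : ∀ p q, C p q →ₗ[ℂ] C (p + 1) q) : ∀ p q, (∀ p q, C p q) →ₗ[ℂ] C p q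
  | 0, _ => 0
  | p + 1, q => δ p q ∘ₗ LinearMap.proj q ∘ₗ LinearMap.proj (φ := fun p => ∀ q, C p q) p

/-- The vertical part of the total differential. -/
def verD (d : ∀ p q, C p q →ₗ[ℂ] C p (q + 1)) : ∀ p q, (∀ p q, C p q) →ₗ[ℂ] C p q
  | _, 0 => 0
  | p, q + 1 => (-1 : ℂ) ^ p • (d p q ∘ₗ LinearMap.proj q ∘ₗ
      LinearMap.proj (φ := fun p => ∀ q, C p q) p)

variable (C) in
/-- The part `⊕_{p + q = n} C^{p,q}` of total degree `n`. -/
def Tot (n : ℤ) : Submodule ℂ (∀ p q, C p q) where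
  carrier := {c | ∀ p q : ℕ, (p : ℤ) + q ≠ n → c p q = 0}
  zero_mem' _ _ _ := rfl
  add_mem' ha hb p q h := by simp only [Pi.add_apply, ha p q h, hb p q h, add_zero]
  smul_mem' c a ha p q h := by simp only [Pi.smul_apply, ha p q h, smul_zero]

variable (C) in
/-- The filtration `F^p = ∏_{k ≥ p} C^{k,•}`. -/
def Fil (p : ℤ) : Submodule ℂ (∀ p q, C p q) where
  carrier := {c | ∀ k q : ℕ, (k : ℤ) < p → c k q = 0}
  zero_mem' _ _ _ := rfl
  add_mem' ha hb p q h := by simp only [Pi.add_apply, ha p q h, hb p q h, add_zero]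
  smul_mem' c a ha p q h := by simp only [Pi.smul_apply, ha p q h, smul_zero]

/-- The element with the single component `c` in bidegree `(p, q)`. -/
def single (p q : ℕ) (c : C p q) : ∀ p q, C p q := Pi.single p (Pi.single q c)

variable (δ : ∀ p q, C p q →ₗ[ℂ] C (p + 1) q) (d : ∀ p q, C p q →ₗ[ℂ] C p (q + 1))

/-- The total differential `D = δ + (-1)^p d`. -/
def totD : (∀ p q, C p q) →ₗ[ℂ] (∀ p q, C p q) :=
  LinearMap.pi fun p => LinearMap.pi fun q => horD δ p q + verD d p q

/-- The cocycles of degree `n` of the total complex. -/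
def totZ (n : ℤ) : Submodule ℂ (∀ p q, C p q) := Tot C n ⊓ LinearMap.ker (totD δ d)

/-- The cohomology of the total complex in degree `n`. -/
def totH (n : ℤ) : Type _ :=
  totZ δ d n ⧸ ((Tot C (n - 1)).map (totD δ d)).submoduleOf (totZ δ d n)

instance (n : ℤ) : AddCommGroup (totH δ d n) :=
  inferInstanceAs (AddCommGroup (totZ δ d n ⧸ Submodule.submoduleOf _ _))

instance (n : ℤ) : Module ℂ (totH δ d n) :=
  inferInstanceAs (Module ℂ (totZ δ d n ⧸ Submodule.submoduleOf _ _))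

/-- The class of a cocycle of the total complex. -/
def totH.mk {n : ℤ} (c : ∀ p q, C p q) (hc : c ∈ totZ δ d n) : totH δ d n :=
  Submodule.Quotient.mk ⟨c, hc⟩

/-- `Z_r^{p,q} = {c ∈ F^p Tot^{p+q} | D c ∈ F^{p+r}}`. -/
def pageZ (r p q : ℤ) : Submodule ℂ (∀ p q, C p q) :=
  Tot C (p + q) ⊓ Fil C p ⊓ (Fil C (p + r)).comap (totD δ d)

/-- `Z_{r-1}^{p+1,q-1} + D Z_{r-1}^{p-r+1,q+r-2}`. -/
def pageB (r p q : ℤ) : Submodule ℂ (∀ p q, C p q) :=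
  pageZ δ d (r - 1) (p + 1) (q - 1) ⊔
    (pageZ δ d (r - 1) (p - r + 1) (q + r - 2)).map (totD δ d)

/-- The term `E_r^{p,q} = Z_r^{p,q} / (Z_{r-1}^{p+1,q-1} + D Z_{r-1}^{p-r+1,q+r-2})` of the
spectral sequence of the total complex filtered by `F^p`. -/
def page (r p q : ℤ) : Type _ :=
  pageZ δ d r p q ⧸ (pageB δ d r p q).submoduleOf (pageZ δ d r p q)

instance (r p q : ℤ) : AddCommGroup (page δ d r p q) :=
  inferInstanceAs (AddCommGroup (pageZ δ d r p q ⧸ Submodule.submoduleOf _ _))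

instance (r p q : ℤ) : Module ℂ (page δ d r p q) :=
  inferInstanceAs (Module ℂ (pageZ δ d r p q ⧸ Submodule.submoduleOf _ _))

/-- The class in `E_r^{p,q}` of an element of `Z_r^{p,q}`. -/
def page.mk {r p q : ℤ} (c : ∀ p q, C p q) (hc : c ∈ pageZ δ d r p q) : page δ d r p q :=
  Submodule.Quotient.mk ⟨c, hc⟩

/-- The terms `E_r` form a spectral sequence: for every `r` there are differentials
`d_r : E_r^{p,q} → E_r^{p+r,q-r+1}`, `d_r [c] = [D c]`, with `d_r d_r = 0`, and `E_{r+1}` is the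
cohomology `ker d_r / im d_r` through the map `[c] ↦ [c]`. -/
def HasPages : Prop :=
  ∃ dE : ∀ (r : ℕ) (p q p' q' : ℤ), page δ d r p q →ₗ[ℂ] page δ d r p' q',
      (∀ (r : ℕ) (p q p' q' : ℤ), p' = p + r → q' = q - r + 1 → ∀ c (hc : c ∈ pageZ δ d r p q),
        ∃ h : totD δ d c ∈ pageZ δ d r p' q', dE r p q p' q' (page.mk δ d c hc) = page.mk δ d _ h) ∧
      (∀ (r : ℕ) (p q : ℤ),
        LinearMap.range (dE r (p - r) (q + r - 1) p q) ≤
          LinearMap.ker (dE r p q (p + r) (q - r + 1)) ∧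
        ∃ φ : LinearMap.ker (dE r p q (p + r) (q - r + 1)) →ₗ[ℂ] page δ d (r + 1 : ℕ) p q,
          Function.Surjective φ ∧
          LinearMap.ker φ = (LinearMap.range (dE r (p - r) (q + r - 1) p q)).submoduleOf
            (LinearMap.ker (dE r p q (p + r) (q - r + 1))) ∧
          ∀ c (hc : c ∈ pageZ δ d (r + 1 : ℕ) p q), ∃ (h : c ∈ pageZ δ d r p q)
            (h' : page.mk δ d c h ∈ LinearMap.ker (dE r p q (p + r) (q - r + 1))),
            φ ⟨_, h'⟩ = page.mk δ d c hc)

end Bicomplex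

section Cech
universe u v w x
variable {m : ℕ} {M : Type u} [TopologicalSpace M] [ChartedSpace (EuclideanSpace ℝ (Fin m)) M]
variable {ι : Type x} [LinearOrder ι]

/-- The `p`-simplices of the nerve of a family of open subsets: sequences `i₀ < ⋯ < i_p` with
`U_{i₀ ⋯ i_p} ≠ ∅`. -/
structure Simplex (U : ι → Opens M) (p : ℕ) where
  idx : Fin (p + 1) ↪o ι
  nonempty : (⋂ k, (U (idx k) : Set M)).Nonempty

namespace Simplex
variable {U : ι → Opens M} {p : ℕ}

/-- The intersection `U_{i₀ ⋯ i_p}`. -/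
def inter (σ : Simplex U p) : Opens M :=
  ⟨⋂ k, (U (σ.idx k) : Set M), isOpen_iInter_of_finite fun k => (U (σ.idx k)).isOpen⟩

/-- Omission of the index `i_k`. -/
def face (σ : Simplex U (p + 1)) (k : Fin (p + 2)) : Simplex U p where
  idx := (Fin.succAboveOrderEmb k).trans σ.idx
  nonempty := σ.nonempty.mono fun _ hy =>
    mem_iInter.2 fun j => mem_iInter.1 hy (Fin.succAboveOrderEmb k j)

lemma inter_le (σ : Simplex U (p + 1)) (k : Fin (p + 2)) : σ.inter ≤ (σ.face k).inter :=
  fun _ hy => mem_iInter.2 fun j => mem_iInter.1 hy (Fin.succAboveOrderEmb k j)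

end Simplex

variable (m) in
/-- A good cover of a manifold of dimension `m`: an open cover all of whose nonempty finite
intersections are diffeomorphic to `ℝ^m`. -/
structure IsGoodCover (U : ι → Opens M) : Prop where
  cover : ⨆ i, U i = ⊤
  diffeo : ∀ (p : ℕ) (σ : Simplex U p),
    Nonempty (σ.inter ≃ₘ^∞⟮𝓡 m, 𝓡 m⟯ EuclideanSpace ℝ (Fin m))

variable [IsManifold (𝓡 m) ∞ M] [T2Space M]
variable {A : LRPresheaf.{u, v} m M} {g : Type w} [LieRing g] [LieAlgebra ℂ g] {U : ι → Opens M}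

variable (m g U) in
/-- `C^{p,q} = ∏_{i₀ < ⋯ < i_p} Ω^q_TLA(U_{i₀ ⋯ i_p}, g)`. -/
def CechC (p q : ℕ) : Type _ := ∀ σ : Simplex U p, Form (TLA m M g) σ.inter q

instance (p q : ℕ) : AddCommGroup (CechC m g U p q) :=
  inferInstanceAs (AddCommGroup (∀ σ : Simplex U p, Form (TLA m M g) σ.inter q))

instance (p q : ℕ) : Module ℂ (CechC m g U p q) :=
  inferInstanceAs (Module ℂ (∀ σ : Simplex U p, Form (TLA m M g) σ.inter q))

variable (m g U) in
/-- The differential `d_TLA : C^{p,q} → C^{p,q+1}`. -/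
def cechd (p q : ℕ) : CechC m g U p q →ₗ[ℂ] CechC m g U p (q + 1) :=
  (LinearMap.pi fun σ => dForm (TLA m M g) σ.inter q ∘ₗ LinearMap.proj σ :
    (∀ σ : Simplex U p, Form (TLA m M g) σ.inter q) →ₗ[ℂ]
      (∀ σ : Simplex U p, Form (TLA m M g) σ.inter (q + 1)))

variable (T : ∀ (p : ℕ) (σ : Simplex U p), LocalTriv A g σ.inter)

/-- The Čech differential `δ : C^{p,q} → C^{p+1,q}`,
`(δω)_{i₀ ⋯ i_{p+1}} = ∑_k (-1)^{k+1} i(ω_{i₀ ⋯ î_k ⋯ i_{p+1}})`. -/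
def cechδ (p q : ℕ) : CechC m g U p q →ₗ[ℂ] CechC m g U (p + 1) q :=
  (LinearMap.pi fun σ => ∑ k : Fin (p + 2), (-1 : ℂ) ^ ((k : ℕ) + 1) •
    ((T p (σ.face k)).resMap (T (p + 1) σ) (σ.inter_le k) q ∘ₗ LinearMap.proj (σ.face k)) :
    (∀ σ : Simplex U p, Form (TLA m M g) σ.inter q) →ₗ[ℂ]
      (∀ σ : Simplex U (p + 1), Form (TLA m M g) σ.inter q))

/-- The augmentation `Ω^q(A, L) = C^{-1,q} → C^{0,q}`: the local trivializations of a form. -/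
def aug (q : ℕ) : Form A (⊤ : Opens M) q →ₗ[ℂ] CechC m g U 0 q :=
  (LinearMap.pi fun σ => (T 0 σ).loc q :
    Form A (⊤ : Opens M) q →ₗ[ℂ] (∀ σ : Simplex U 0, Form (TLA m M g) σ.inter q))

variable (m g U) in
/-- `C^p(𝒰, ℋ^q)` for the presheaf `ℋ^q(V) = H^q(Ω_TLA(V, g))`. -/
def CechH (q p : ℕ) : Type _ := ∀ σ : Simplex U p, Coh (dForm (TLA m M g) σ.inter) q

instance (q p : ℕ) : AddCommGroup (CechH m g U q p) :=
  inferInstanceAs (AddCommGroup (∀ σ : Simplex U p, Coh (dForm (TLA m M g) σ.inter) q))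

instance (q p : ℕ) : Module ℂ (CechH m g U q p) :=
  inferInstanceAs (Module ℂ (∀ σ : Simplex U p, Coh (dForm (TLA m M g) σ.inter) q))

/-- The family of the cohomology classes of a family of closed forms. -/
def CechH.mk {q p : ℕ} (c : CechC m g U p q) (hc : cechd m g U p q c = 0) : CechH m g U q p :=
  fun σ => Coh.mk (dForm (TLA m M g) σ.inter) (c σ) (congrFun hc σ)

/-- The Čech differential of `C^•(𝒰, ℋ^q)`; the restriction maps of `ℋ^q` are those induced in
cohomology by the restriction maps `i_U^V`. -/
def cechδH (q p : ℕ) : CechH m g U q p →ₗ[ℂ] CechH m g U q (p + 1) :=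
  (LinearMap.pi fun σ => ∑ k : Fin (p + 2), (-1 : ℂ) ^ ((k : ℕ) + 1) •
    (Coh.map (dForm (TLA m M g) (σ.face k).inter) (dForm (TLA m M g) σ.inter)
      (fun q => (T p (σ.face k)).resMap (T (p + 1) σ) (σ.inter_le k) q)
      (fun q => (T p (σ.face k)).resMap_d (T (p + 1) σ) (σ.inter_le k) q) q
      ∘ₗ LinearMap.proj (σ.face k)) :
    (∀ σ : Simplex U p, Coh (dForm (TLA m M g) σ.inter) q) →ₗ[ℂ]
      (∀ σ : Simplex U (p + 1), Coh (dForm (TLA m M g) σ.inter) q))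

end Cech

end TransLie

end

open TransLie

set_option linter.unusedSectionVars false

noncomputable section

namespace TransLie

/-! ### Cartan calculus for Chevalley–Eilenberg cochains -/

section Cartan
variable {K N : Type*} [LieRing K] [LieAlgebra ℂ K] [AddCommGroup N] [Module ℂ N]
  [LieRingModule K N] [LieModule ℂ K N] {q : ℕ}

/-! The theorem combines three independent facts: the rows of the bicomplex are the Čech complex of
a fine sheaf, the columns satisfy a Poincaré lemma relative to `g`, and everything else is formal
homological algebra of a double complex.

Rows. The restriction maps `i_U^V` are conjugations by `S_U⁻¹ ∘ S_V`. If a family of forms on `A`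
itself is written in the chosen trivializations (`localize`), the factors `S_U` cancel and `i_U^V`
becomes plain restriction (`LocalTriv.resMap_pull`, `cechδ_localize`). Hence, whatever
trivializations are chosen on the intersections, each row is isomorphic to the Čech complex of the
sheaf of `L`-valued forms on `A`. That sheaf admits partitions of unity: with `H_i` the insertion of
the index `i`, which satisfies `δ H_i + H_i δ = 1` wherever `U_i` contains the open set under
consideration (`finD_finH_add`), the operator `∑ ρ_i H_i` inverts `δ` on cocycles
(`exists_formδ_eq`). The start of the row is the sheaf axiom (`exists_restrict_eq`,
`restrict_injective`).

Columns. On an open set diffeomorphic to `ℝ^m` the partial derivatives commute, so the sections with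
constant coefficients form the Lie algebra `ℂ^m × g`, and forms on the trivial Lie algebroid are
exactly the cochains of `ℂ^m × g` with values in `C^∞ ⊗ g` (`Frame.formEquiv`). The vectors of `ℂ^m`
are central and act by partial derivatives, which have antiderivatives as right inverses.
Eliminating one direction at a time by Cartan's formula (`exists_basic_cocycle`,
`exists_basic_primitive`) shows that cohomology can be computed with basic cochains, namely those
which ignore `ℂ^m` and have values killed by all partial derivatives. By Hadamard's lemma such
values are constant, so basic cochains are the cochains of `g` (`Frame.exists_coh_equiv`).

Formal part. Exact augmented rows identify the cohomology of the augmentation with that of the total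
complex by a staircase argument (`exists_totH_equiv`). The spectral sequence is the one of a
filtered complex (`hasPages`), and its first two pages are read off from the component of bidegree
`(p, q)` (`exists_page_one_equiv`, `exists_page_two_equiv`).

The relations between the differentials follow from `d² = 0`, itself a consequence of Cartan's
formula (`ceD_ceD`), and from naturality of the Chevalley–Eilenberg differential. -/

lemma update_cons_succ {n : ℕ} {α : Type*} (x : α) (Y : Fin n → α) (k : Fin n) (z : α) :
    Function.update (Matrix.vecCons x Y) k.succ z = Matrix.vecCons x (Function.update Y k z) := by
  simp [Matrix.vecCons, Fin.cons_update]

lemma update_cons_zero {n : ℕ} {α : Type*} (x : α) (Y : Fin n → α) (z : α) :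
    Function.update (Matrix.vecCons x Y) 0 z = Matrix.vecCons z Y := by
  simp [Matrix.vecCons]

lemma removeNth_zero_vecCons {n : ℕ} {α : Type*} (x : α) (Y : Fin n → α) :
    (0 : Fin (n + 1)).removeNth (Matrix.vecCons x Y) = Y := by
  simp [Matrix.vecCons]

lemma removeNth_succ_vecCons {n : ℕ} {α : Type*} (x : α) (Y : Fin (n + 1) → α) (k : Fin (n + 1)) :
    k.succ.removeNth (Matrix.vecCons x Y) = Matrix.vecCons x (k.removeNth Y) := by
  funext j
  refine Fin.cases ?_ (fun j => ?_) j <;> simp [Fin.removeNth, Matrix.vecCons]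

/-- Cartan's formula `i_x d + d i_x = L_x`. -/
lemma curryLeft_ceD (η : K [⋀^Fin (q + 1)]→ₗ[ℂ] N) (x : K) :
    (ceD η).curryLeft x = lieDer x η - ceD (η.curryLeft x) := by
  ext Y
  simp only [AlternatingMap.curryLeft_apply_apply, AlternatingMap.sub_apply]
  rw [ceD_apply, ceD_apply, lieDer_apply, Fin.sum_univ_succ,
    Fin.sum_univ_succ (f := fun i : Fin (q + 2) => ∑ k : Fin (q + 1), _)]
  simp only [removeNth_zero_vecCons, removeNth_succ_vecCons, Matrix.cons_val_zero,
    Matrix.cons_val_succ, Fin.val_zero, pow_zero, one_smul, Fin.zero_le, if_true,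
    AlternatingMap.curryLeft_apply_apply]
  -- Placing `x` in front moves every other argument by one position, whence the minus sign. The
  -- slot `k = 0` is occupied by `x` itself; it never satisfies `i.succ ≤ k` and drops out.
  have h1 : ∀ i : Fin (q + 1), (∑ k : Fin (q + 1), if i.succ ≤ k.castSucc then
      (-1 : ℤ) ^ (i.succ : ℕ) • η (Function.update (Matrix.vecCons x (i.removeNth Y)) k
        ⁅Y i, Y k⁆) else 0) = - ∑ k : Fin q, if i ≤ k.castSucc then
      (-1 : ℤ) ^ (i : ℕ) • η (Matrix.vecCons x (Function.update (i.removeNth Y) k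
        ⁅Y i, Y k.succ⁆)) else 0 := by
    intro i
    rw [Fin.sum_univ_succ, ← Finset.sum_neg_distrib]
    rw [if_neg (by simp), zero_add]
    refine Finset.sum_congr rfl fun k _ => ?_
    have : (i.succ ≤ k.succ.castSucc) ↔ i ≤ k.castSucc := by simp [Fin.le_def]
    simp only [this, update_cons_succ]
    split_ifs
    · rw [Fin.val_succ, pow_succ, mul_neg_one, neg_smul]
    · simp
  simp only [h1]
  simp only [Fin.val_succ, pow_succ, mul_neg_one, neg_smul, Finset.sum_neg_distrib]
  abel

lemma lieDer_sub (x : K) (η ξ : K [⋀^Fin q]→ₗ[ℂ] N) :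
    lieDer x (η - ξ) = lieDer x η - lieDer x ξ := by
  ext Y; simp [lieDer_apply, Finset.sum_sub_distrib]; abel

/-- In `L_x L_y - L_y L_x` the terms modifying two different arguments are symmetric in `x` and `y`
and cancel. The terms modifying one argument twice combine by the Jacobi identity, and those acting
on the value combine by the module axiom. -/
lemma lieDer_lie (x y : K) (η : K [⋀^Fin q]→ₗ[ℂ] N) :
    lieDer ⁅x, y⁆ η = lieDer x (lieDer y η) - lieDer y (lieDer x η) := by
  ext Y
  have hu : ∀ (a b : K), ∑ k, ∑ l, η (Function.update (Function.update Y k ⁅a, Y k⁆) l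
        ⁅b, Function.update Y k ⁅a, Y k⁆ l⁆)
      = ∑ k, η (Function.update Y k ⁅b, ⁅a, Y k⁆⁆) + ∑ k, ∑ l, (if l = k then 0 else
          η (Function.update (Function.update Y k ⁅a, Y k⁆) l ⁅b, Y l⁆)) := by
    intro a b
    rw [← Finset.sum_add_distrib]
    refine Finset.sum_congr rfl fun k _ => ?_
    rw [← Finset.add_sum_erase _ _ (Finset.mem_univ k),
      ← Finset.add_sum_erase Finset.univ (fun l => if l = k then 0 else
        η (Function.update (Function.update Y k ⁅a, Y k⁆) l ⁅b, Y l⁆)) (Finset.mem_univ k)]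
    simp only [Function.update_idem, Function.update_self, if_true, zero_add]
    congr 1
    refine Finset.sum_congr rfl fun l hl => ?_
    rw [if_neg (Finset.ne_of_mem_erase hl), Function.update_of_ne (Finset.ne_of_mem_erase hl)]
  have hsym : ∑ k, ∑ l, (if l = k then 0 else
          η (Function.update (Function.update Y k ⁅x, Y k⁆) l ⁅y, Y l⁆))
      = ∑ k, ∑ l, (if l = k then 0 else
          η (Function.update (Function.update Y k ⁅y, Y k⁆) l ⁅x, Y l⁆)) := by
    rw [Finset.sum_comm]
    refine Finset.sum_congr rfl fun k _ => Finset.sum_congr rfl fun l _ => ?_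
    rcases eq_or_ne l k with rfl | h
    · simp
    · rw [if_neg h, if_neg h.symm, Function.update_comm h]
  simp only [AlternatingMap.sub_apply, lieDer_apply, lie_sub, lie_sum, Finset.sum_sub_distrib]
  rw [hu x y, hu y x, hsym]
  have h1 : ∀ k, η (Function.update Y k ⁅⁅x, y⁆, Y k⁆) = η (Function.update Y k ⁅x, ⁅y, Y k⁆⁆)
      - η (Function.update Y k ⁅y, ⁅x, Y k⁆⁆) := by
    intro k; rw [lie_lie, AlternatingMap.map_update_sub]
  simp only [h1, Finset.sum_sub_distrib]
  rw [lie_lie]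
  abel

lemma curryLeft_lieDer (x y : K) (η : K [⋀^Fin (q + 1)]→ₗ[ℂ] N) :
    (lieDer x η).curryLeft y = lieDer x (η.curryLeft y) - η.curryLeft ⁅x, y⁆ := by
  ext Y
  simp only [AlternatingMap.curryLeft_apply_apply, AlternatingMap.sub_apply, lieDer_apply]
  rw [Fin.sum_univ_succ]
  simp only [update_cons_zero, update_cons_succ, Matrix.cons_val_zero, Matrix.cons_val_succ]
  abel

/-- This is what allows identities between cochains to be proved by induction on the degree:
contract both sides and use Cartan's formula. -/
lemma eq_of_curryLeft_eq {η ξ : K [⋀^Fin (q + 1)]→ₗ[ℂ] N}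
    (h : ∀ x, η.curryLeft x = ξ.curryLeft x) : η = ξ := by
  ext Y
  have := congrArg (fun f => f (Matrix.vecTail Y)) (h (Matrix.vecHead Y))
  simpa only [AlternatingMap.curryLeft_apply_apply, Matrix.cons_head_tail] using this

lemma ceD_zero_apply (η : K [⋀^Fin 0]→ₗ[ℂ] N) (Y : Fin 1 → K) :
    ceD η Y = ⁅Y 0, η ![]⁆ := by
  rw [ceD_apply]
  simp
  congr 2
  exact Subsingleton.elim _ _

/-- Cartan's formula in degree zero, where the term `d i_x` does not exist; it starts the inductions
below. -/
lemma curryLeft_ceD_zero (η : K [⋀^Fin 0]→ₗ[ℂ] N) (x : K) :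
    (ceD η).curryLeft x = lieDer x η := by
  ext Y
  rw [AlternatingMap.curryLeft_apply_apply, ceD_zero_apply, lieDer_apply]
  simp
  congr 2
  exact Subsingleton.elim _ _

/-- Lie derivatives commute with the Chevalley–Eilenberg differential. -/
lemma lieDer_ceD (x : K) (η : K [⋀^Fin q]→ₗ[ℂ] N) : lieDer x (ceD η) = ceD (lieDer x η) := by
  induction q generalizing x with
  | zero =>
    refine eq_of_curryLeft_eq fun y => ?_
    rw [curryLeft_lieDer, curryLeft_ceD_zero, curryLeft_ceD_zero, curryLeft_ceD_zero, lieDer_lie]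
    abel
  | succ q ih =>
    refine eq_of_curryLeft_eq fun y => ?_
    rw [curryLeft_lieDer, curryLeft_ceD, curryLeft_ceD, curryLeft_ceD, lieDer_sub, ih,
      curryLeft_lieDer, lieDer_lie, map_sub]
    abel

/-- The Chevalley–Eilenberg differential has square zero. -/
lemma ceD_ceD (η : K [⋀^Fin q]→ₗ[ℂ] N) : ceD (ceD η) = 0 := by
  induction q with
  | zero =>
    refine eq_of_curryLeft_eq fun x => ?_
    rw [curryLeft_ceD, curryLeft_ceD_zero, lieDer_ceD, sub_self]
    rfl
  | succ q ih =>
    refine eq_of_curryLeft_eq fun x => ?_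
    rw [curryLeft_ceD, curryLeft_ceD, map_sub, ih, lieDer_ceD, sub_zero, sub_self]
    rfl

end Cartan

/-! ### Elimination of central directions with antiderivatives -/

section Reduction
variable {K N : Type*} [LieRing K] [LieAlgebra ℂ K] [AddCommGroup N] [Module ℂ N]
  [LieRingModule K N] [LieModule ℂ K N] {q m : ℕ}

/-- Cochains which are annihilated by contraction with `x`. -/
def Horiz (x : K) : ∀ {q : ℕ}, (K [⋀^Fin q]→ₗ[ℂ] N) → Prop
  | 0, _ => True
  | _ + 1, η => η.curryLeft x = 0

lemma Horiz.sub {x : K} {η ξ : K [⋀^Fin q]→ₗ[ℂ] N} (h : Horiz x η) (h' : Horiz x ξ) :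
    Horiz x (η - ξ) := by
  cases q with
  | zero => trivial
  | succ q =>
    change (η - ξ).curryLeft x = 0
    have : (η - ξ).curryLeft x = η.curryLeft x - ξ.curryLeft x := by ext; simp
    rw [this, show η.curryLeft x = 0 from h, show ξ.curryLeft x = 0 from h', sub_zero]

/-- Basic cochains with respect to the elements `e j`, `k ≤ j`: they are annihilated by
contraction with these elements and take values in their invariants. -/
def BasicFrom (e : Fin m → K) (k : ℕ) (η : K [⋀^Fin q]→ₗ[ℂ] N) : Prop :=
  ∀ j : Fin m, k ≤ j → Horiz (e j) η ∧ ∀ Y, ⁅e j, η Y⁆ = 0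

/-- All brackets with `x` vanish, so `L_x` only acts on values. Vanishing of `L_x η` is then the
invariance condition in `BasicFrom`. -/
lemma lieDer_central {x : K} (hx : ∀ y : K, ⁅x, y⁆ = 0) (η : K [⋀^Fin q]→ₗ[ℂ] N) (Y : Fin q → K) :
    lieDer x η Y = ⁅x, η Y⁆ := by
  rw [lieDer_apply, Finset.sum_eq_zero, sub_zero]
  intro k _
  rw [hx]
  exact η.map_update_zero Y k

lemma BasicFrom.sub {e : Fin m → K} {k : ℕ} {η ξ : K [⋀^Fin q]→ₗ[ℂ] N}
    (h : BasicFrom e k η) (h' : BasicFrom e k ξ) : BasicFrom e k (η - ξ) := fun j hj =>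
  ⟨(h j hj).1.sub (h' j hj).1, fun Y => by
    rw [AlternatingMap.sub_apply, lie_sub, (h j hj).2, (h' j hj).2, sub_zero]⟩

/-- For basic cochains `L_{e_j} η = 0`, and Cartan's formula together with `L d = d L` passes both
conditions to `dη`. -/
lemma BasicFrom.ceD {e : Fin m → K} (he : ∀ (j : Fin m) (y : K), ⁅e j, y⁆ = 0) {k : ℕ} {η : K [⋀^Fin q]→ₗ[ℂ] N}
    (h : BasicFrom e k η) : BasicFrom e k (ceD η) := by
  intro j hj
  have h0 : lieDer (e j) η = 0 := by
    ext Y; rw [lieDer_central (he j), (h j hj).2]; rfl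
  constructor
  · change (TransLie.ceD η).curryLeft (e j) = 0
    cases q with
    | zero => rw [curryLeft_ceD_zero, h0]
    | succ q =>
      rw [curryLeft_ceD, h0, show η.curryLeft (e j) = 0 from (h j hj).1, map_zero, sub_zero]
  · intro Y
    rw [← lieDer_central (he j), lieDer_ceD, h0, map_zero]; rfl

/-- Composition of a contraction with an antiderivative. -/
def antider (J : N →ₗ[ℂ] N) (x : K) (η : K [⋀^Fin (q + 1)]→ₗ[ℂ] N) : K [⋀^Fin q]→ₗ[ℂ] N :=
  J.compAlternatingMap (η.curryLeft x)

variable {e : Fin m → K} {J : Fin m → N →ₗ[ℂ] N}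

/-- Contractions with `e k` and `e j` anticommute, and `J k` preserves the `e j`-invariants for `j >
k`. This is why the directions are treated in decreasing order: antidifferentiating along `e k` does
not spoil those already handled. -/
lemma antider_basic (hJ' : ∀ j k : Fin m, k < j → ∀ n : N, ⁅e j, n⁆ = 0 → ⁅e j, J k n⁆ = 0)
    (k : Fin m) {η : K [⋀^Fin (q + 1)]→ₗ[ℂ] N} (h : BasicFrom e (k + 1) η) :
    BasicFrom e (k + 1) (antider (J k) (e k) η) := by
  intro j hj
  constructor
  · cases q with
    | zero => trivial
    | succ q =>
      change (antider (J k) (e k) η).curryLeft (e j) = 0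
      ext Y
      have h1 : η.curryLeft (e j) = 0 := (h j hj).1
      have h2 : η (Matrix.vecCons (e k) (Matrix.vecCons (e j) Y)) = 0 := by
        have := η.map_swap (Matrix.vecCons (e k) (Matrix.vecCons (e j) Y))
          (i := 0) (j := 1) (by simp)
        have h3 : (Matrix.vecCons (e k) (Matrix.vecCons (e j) Y)) ∘ (Equiv.swap 0 1)
            = Matrix.vecCons (e j) (Matrix.vecCons (e k) Y) := by
          funext i
          refine Fin.cases ?_ (fun i => Fin.cases ?_ (fun i => ?_) i) i
          · simp
          · simp
          · rw [Function.comp, Equiv.swap_apply_of_ne_of_ne (Fin.succ_ne_zero _)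
              (by rw [← Fin.succ_zero_eq_one, Ne, Fin.succ_inj]; exact Fin.succ_ne_zero _)]
            simp
        rw [h3] at this
        have h4 : η (Matrix.vecCons (e j) (Matrix.vecCons (e k) Y)) = 0 := by
          rw [← AlternatingMap.curryLeft_apply_apply, h1]; rfl
        rw [h4] at this
        exact neg_eq_zero.1 this.symm
      change J k (η (Matrix.vecCons (e k) (Matrix.vecCons (e j) Y))) = 0
      rw [h2, map_zero]
  · intro Y
    exact hJ' j k (by rw [Fin.lt_def]; omega) _ ((h j hj).2 _)

lemma curryLeft_antider (x : K) (I : N →ₗ[ℂ] N) (η : K [⋀^Fin (q + 1)]→ₗ[ℂ] N) :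
    Horiz x (antider I x η) := by
  cases q with
  | zero => trivial
  | succ q =>
    change (antider I x η).curryLeft x = 0
    ext Y
    change I (η (Matrix.vecCons x (Matrix.vecCons x Y))) = 0
    rw [η.map_eq_zero_of_eq _ (i := 0) (j := 1) (by simp) (by simp), map_zero]

/-- For `β = J_k ∘ i_{e_k} η` the contraction `i_{e_k} β` vanishes by alternation, so Cartan's
formula leaves `i_{e_k} dβ = e_k · β`, and `e_k` undoes `J_k`. -/
lemma curryLeft_ceD_antider (he : ∀ (j : Fin m) (y : K), ⁅e j, y⁆ = 0) (hJ : ∀ (k : Fin m) (n : N), ⁅e k, J k n⁆ = n)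
    (k : Fin m) (η : K [⋀^Fin (q + 1)]→ₗ[ℂ] N) :
    (ceD (antider (J k) (e k) η)).curryLeft (e k) = η.curryLeft (e k) := by
  have h1 : lieDer (e k) (antider (J k) (e k) η) = η.curryLeft (e k) := by
    ext Y
    rw [lieDer_central (he k)]
    exact hJ k _
  cases q with
  | zero => rw [curryLeft_ceD_zero, h1]
  | succ q =>
    rw [curryLeft_ceD, h1, show (antider (J k) (e k) η).curryLeft (e k) = 0 from
      curryLeft_antider (e k) (J k) η, map_zero, sub_zero]

/-- One step of the reduction: subtracting a coboundary makes a cochain horizontal in one more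
direction. -/
lemma exists_horiz (he : ∀ (j : Fin m) (y : K), ⁅e j, y⁆ = 0) (hJ : ∀ (k : Fin m) (n : N), ⁅e k, J k n⁆ = n)
    (hJ' : ∀ j k : Fin m, k < j → ∀ n : N, ⁅e j, n⁆ = 0 → ⁅e j, J k n⁆ = 0)
    (k : Fin m) {η : K [⋀^Fin (q + 1)]→ₗ[ℂ] N} (h : BasicFrom e (k + 1) η) :
    ∃ β : K [⋀^Fin q]→ₗ[ℂ] N, BasicFrom e (k + 1) β ∧ BasicFrom e (k + 1) (η - ceD β) ∧
      (η - ceD β).curryLeft (e k) = 0 := by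
  refine ⟨antider (J k) (e k) η, antider_basic hJ' k h, h.sub ((antider_basic hJ' k h).ceD he), ?_⟩
  have : ∀ ξ : K [⋀^Fin (q + 1)]→ₗ[ℂ] N, (η - ξ).curryLeft (e k)
      = η.curryLeft (e k) - ξ.curryLeft (e k) := fun ξ => by ext; simp
  rw [this, curryLeft_ceD_antider he hJ, sub_self]

/-- Invariance comes for free: if `i_{e_k}` kills both `η` and `dη`, then `L_{e_k} η = 0`, which for
central `e_k` says that the values are invariant. -/
lemma BasicFrom.of_succ (he : ∀ (j : Fin m) (y : K), ⁅e j, y⁆ = 0) (k : Fin m) {η : K [⋀^Fin q]→ₗ[ℂ] N}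
    (h : BasicFrom e (k + 1) η) (h1 : Horiz (e k) η) (h2 : (TransLie.ceD η).curryLeft (e k) = 0) :
    BasicFrom e k η := by
  intro j hj
  rcases hj.eq_or_lt with hj | hj
  · obtain rfl : k = j := Fin.ext hj
    refine ⟨h1, fun Y => ?_⟩
    rw [← lieDer_central (he k)]
    cases q with
    | zero => rw [← curryLeft_ceD_zero, h2]; rfl
    | succ q =>
      have := curryLeft_ceD η (e k)
      rw [h2, show η.curryLeft (e k) = 0 from h1, map_zero, sub_zero] at this
      rw [← this]; rfl
  · exact h j hj

/-- Every cocycle is cohomologous to a basic one. -/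
lemma exists_basic_cocycle (he : ∀ (j : Fin m) (y : K), ⁅e j, y⁆ = 0) (hJ : ∀ (k : Fin m) (n : N), ⁅e k, J k n⁆ = n)
    (hJ' : ∀ j k : Fin m, k < j → ∀ n : N, ⁅e j, n⁆ = 0 → ⁅e j, J k n⁆ = 0)
    {η : K [⋀^Fin (q + 1)]→ₗ[ℂ] N} (hη : ceD η = 0) :
    ∃ β : K [⋀^Fin q]→ₗ[ℂ] N, BasicFrom e 0 (η - ceD β) := by
  -- After `k` rounds the last `k` directions have been cleaned. `BasicFrom e m` is an empty
  -- condition, so the induction starts with no correction at all.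
  suffices H : ∀ k : ℕ, k ≤ m → ∃ β : K [⋀^Fin q]→ₗ[ℂ] N, BasicFrom e (m - k) (η - ceD β) by
    obtain ⟨β, hβ⟩ := H m le_rfl
    exact ⟨β, by rwa [Nat.sub_self] at hβ⟩
  intro k
  induction k with
  | zero => exact fun _ => ⟨0, fun j hj => by have := j.2; omega⟩
  | succ k ih =>
    intro hk
    obtain ⟨β, hβ⟩ := ih (by omega)
    let l : Fin m := ⟨m - (k + 1), by omega⟩
    have hl : m - k = (l : ℕ) + 1 := by simp only [l]; omega
    rw [hl] at hβ
    obtain ⟨γ, -, h1, h2⟩ := exists_horiz he hJ hJ' l hβ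
    refine ⟨β + γ, ?_⟩
    have h3 : η - ceD (β + γ) = η - ceD β - ceD γ := by rw [map_add]; abel
    rw [h3]
    refine BasicFrom.of_succ he l h1 h2 ?_
    -- The corrected cochain is still a cocycle, which supplies the contraction hypothesis of
    -- `BasicFrom.of_succ`.
    rw [map_sub, map_sub, hη, ceD_ceD, ceD_ceD]
    simp

lemma exists_basic_cocycle_zero (he : ∀ (j : Fin m) (y : K), ⁅e j, y⁆ = 0)
    {η : K [⋀^Fin 0]→ₗ[ℂ] N} (hη : ceD η = 0) : BasicFrom e 0 η := fun j _ =>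
  ⟨trivial, fun Y => by rw [← lieDer_central (he j), ← curryLeft_ceD_zero, hη]; rfl⟩

/-- A basic coboundary is the coboundary of a basic cochain. -/
lemma exists_basic_primitive (he : ∀ (j : Fin m) (y : K), ⁅e j, y⁆ = 0) (hJ : ∀ (k : Fin m) (n : N), ⁅e k, J k n⁆ = n)
    (hJ' : ∀ j k : Fin m, k < j → ∀ n : N, ⁅e j, n⁆ = 0 → ⁅e j, J k n⁆ = 0)
    {β : K [⋀^Fin q]→ₗ[ℂ] N} (h : BasicFrom e 0 (ceD β)) :
    ∃ β' : K [⋀^Fin q]→ₗ[ℂ] N, BasicFrom e 0 β' ∧ ceD β' = ceD β := by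
  suffices H : ∀ k : ℕ, k ≤ m →
      ∃ β' : K [⋀^Fin q]→ₗ[ℂ] N, BasicFrom e (m - k) β' ∧ ceD β' = ceD β by
    obtain ⟨β', hβ⟩ := H m le_rfl
    exact ⟨β', by rwa [Nat.sub_self] at hβ⟩
  intro k
  induction k with
  | zero => exact fun _ => ⟨β, fun j hj => by have := j.2; omega, rfl⟩
  | succ k ih =>
    intro hk
    obtain ⟨β', hβ', hd⟩ := ih (by omega)
    let l : Fin m := ⟨m - (k + 1), by omega⟩
    have hl : m - k = (l : ℕ) + 1 := by simp only [l]; omega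
    rw [hl] at hβ'
    -- The differential is horizontal from the start, and corrections by exact terms do not change
    -- it; so only `β'` itself has to be made horizontal.
    have h0 : (ceD β).curryLeft (e l) = 0 := (h l (Nat.zero_le _)).1
    cases q with
    | zero => exact ⟨β', hβ'.of_succ he l trivial (by rw [hd, h0]), hd⟩
    | succ q =>
      obtain ⟨γ, -, h1, h2⟩ := exists_horiz he hJ hJ' l hβ'
      have h3 : ceD (β' - ceD γ) = ceD β := by rw [map_sub, ceD_ceD, sub_zero, hd]
      exact ⟨β' - ceD γ, h1.of_succ he l h2 (by rw [h3, h0]), h3⟩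

end Reduction

/-! ### Quotients and cohomology classes -/

section Quot
variable {E H : Type*} [AddCommGroup E] [Module ℂ E] [AddCommGroup H] [Module ℂ H]

/-- The equivalence is recorded together with its value on classes, because every isomorphism of the
theorem is asserted with an explicit formula. -/
lemma exists_quot_equiv {S : Submodule ℂ E} (f : E →ₗ[ℂ] H) (hf : Function.Surjective f)
    (hS : LinearMap.ker f = S) : ∃ θ : (E ⧸ S) ≃ₗ[ℂ] H, ∀ x, θ (Submodule.Quotient.mk x) = f x := by
  subst hS
  exact ⟨f.quotKerEquivOfSurjective hf, fun x => rfl⟩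

end Quot

section Cohomology
variable {X : ℕ → Type*} [∀ n, AddCommGroup (X n)] [∀ n, Module ℂ (X n)]
    (d : ∀ n, X n →ₗ[ℂ] X (n + 1))

lemma Coh.mk_surjective {n : ℕ} (y : Coh d n) : ∃ (x : X n) (hx : d n x = 0), y = Coh.mk d x hx := by
  obtain ⟨⟨x, hx⟩, rfl⟩ := Submodule.Quotient.mk_surjective _ y
  exact ⟨x, hx, rfl⟩

lemma Coh.mk_eq_zero_iff {n : ℕ} {x : X n} {hx : d n x = 0} : Coh.mk d x hx = 0 ↔ x ∈ cobd d n :=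
  Submodule.Quotient.mk_eq_zero _

lemma Coh.mk_eq_iff {n : ℕ} {x y : X n} {hx : d n x = 0} {hy : d n y = 0} :
    Coh.mk d x hx = Coh.mk d y hy ↔ x - y ∈ cobd d n :=
  Submodule.Quotient.eq _

/-- The class map on cocycles. -/
def Coh.mkL (n : ℕ) : LinearMap.ker (d n) →ₗ[ℂ] Coh d n := Submodule.mkQ _

lemma Coh.mkL_apply (n : ℕ) (x : LinearMap.ker (d n)) : Coh.mkL d n x = Coh.mk d x.1 x.2 := rfl

/-- A linear map on cocycles which is surjective with kernel the coboundaries induces an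
isomorphism from cohomology. -/
lemma Coh.exists_equiv {H : Type*} [AddCommGroup H] [Module ℂ H] {n : ℕ}
    (f : LinearMap.ker (d n) →ₗ[ℂ] H) (hf : Function.Surjective f)
    (hker : ∀ x : LinearMap.ker (d n), f x = 0 ↔ x.1 ∈ cobd d n) :
    ∃ θ : Coh d n ≃ₗ[ℂ] H, ∀ x (hx : d n x = 0), θ (Coh.mk d x hx) = f ⟨x, hx⟩ := by
  obtain ⟨θ, hθ⟩ := exists_quot_equiv (S := (cobd d n).submoduleOf (LinearMap.ker (d n))) f hf
    (by ext x; exact hker x)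
  exact ⟨θ, fun x hx => hθ _⟩

end Cohomology

/-! ### The total complex and the spectral sequence of its filtration -/

section Bicomplex
variable {C : ℕ → ℕ → Type*} [∀ p q, AddCommGroup (C p q)] [∀ p q, Module ℂ (C p q)]
variable (δ : ∀ p q, C p q →ₗ[ℂ] C (p + 1) q) (d : ∀ p q, C p q →ₗ[ℂ] C p (q + 1))

lemma totD_apply (c : ∀ p q, C p q) (p q : ℕ) : totD δ d c p q = horD δ p q c + verD d p q c := rfl

lemma horD_zero (c : ∀ p q, C p q) (q : ℕ) : horD δ 0 q c = 0 := rfl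
lemma horD_succ (c : ∀ p q, C p q) (p q : ℕ) : horD δ (p + 1) q c = δ p q (c p q) := rfl
lemma verD_zero (c : ∀ p q, C p q) (p : ℕ) : verD d p 0 c = 0 := by cases p <;> rfl
lemma verD_succ (c : ∀ p q, C p q) (p q : ℕ) :
    verD d p (q + 1) c = (-1 : ℂ) ^ p • d p q (c p q) := by cases p <;> rfl

lemma totD_mem_Tot {n : ℤ} {c : ∀ p q, C p q} (hc : c ∈ Tot C n) : totD δ d c ∈ Tot C (n + 1) := by
  intro p q h
  rw [totD_apply]
  have h1 : horD δ p q c = 0 := by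
    cases p with
    | zero => rfl
    | succ p => rw [horD_succ, hc p q (by push_cast at h; omega), map_zero]
  have h2 : verD d p q c = 0 := by
    cases q with
    | zero => exact verD_zero d c p
    | succ q => rw [verD_succ, hc p q (by push_cast at h; omega), map_zero, smul_zero]
  rw [h1, h2, add_zero]

lemma totD_mem_Fil {r : ℤ} {c : ∀ p q, C p q} (hc : c ∈ Fil C r) : totD δ d c ∈ Fil C r := by
  intro p q h
  rw [totD_apply]
  have h1 : horD δ p q c = 0 := by
    cases p with
    | zero => rfl
    | succ p => rw [horD_succ, hc p q (by push_cast at h; omega), map_zero]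
  have h2 : verD d p q c = 0 := by
    cases q with
    | zero => exact verD_zero d c p
    | succ q => rw [verD_succ, hc p q h, map_zero, smul_zero]
  rw [h1, h2, add_zero]

lemma Fil_anti {r s : ℤ} (h : r ≤ s) : Fil C s ≤ Fil C r := fun _ hc k q hk => hc k q (by omega)

/-- The squares of `δ` and `d` commute, and the sign `(-1)^p` makes them anticommute. The first row
and first column are separate cases since the horizontal or vertical part is absent there. -/
lemma totD_totD (hδ : ∀ p q c, δ (p + 1) q (δ p q c) = 0) (hd : ∀ p q c, d p (q + 1) (d p q c) = 0)
    (hδd : ∀ p q c, δ p (q + 1) (d p q c) = d (p + 1) q (δ p q c)) (c : ∀ p q, C p q) :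
    totD δ d (totD δ d c) = 0 := by
  funext p q
  rw [totD_apply]
  have key : ∀ p q, δ p (q + 1) (verD d p (q + 1) c) =
      - ((-1 : ℂ) ^ (p + 1) • d (p + 1) q (horD δ (p + 1) q c)) := by
    intro p q
    rw [verD_succ, horD_succ, map_smul, hδd, pow_succ]
    simp
  rcases p with _ | p <;> rcases q with _ | q
  · rw [horD_zero, verD_zero, add_zero]; rfl
  · rw [horD_zero, verD_succ, totD_apply, horD_zero, zero_add, zero_add]
    rcases q with _ | q
    · rw [verD_zero, map_zero, smul_zero]; rfl
    · rw [verD_succ, map_smul, hd, smul_zero, smul_zero]; rfl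
  · rw [horD_succ, verD_zero, totD_apply, verD_zero, add_zero, add_zero]
    rcases p with _ | p
    · rw [horD_zero, map_zero]; rfl
    · rw [horD_succ, hδ]; rfl
  · rw [horD_succ, verD_succ, totD_apply, totD_apply, map_add, map_add, key, smul_add]
    have h1 : δ p (q + 1) (horD δ p (q + 1) c) = 0 := by
      rcases p with _ | p
      · rw [horD_zero, map_zero]
      · rw [horD_succ, hδ]
    have h2 : d (p + 1) q (verD d (p + 1) q c) = 0 := by
      rcases q with _ | q
      · rw [verD_zero, map_zero]
      · rw [verD_succ, map_smul, hd, smul_zero]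
    rw [h1, h2]
    simp

lemma single_same (p q : ℕ) (x : C p q) : single p q x p q = x := by simp [single]

lemma single_of_ne {p q p' q' : ℕ} (h : p' ≠ p ∨ q' ≠ q) (x : C p q) :
    single p q x p' q' = 0 := by
  rcases eq_or_ne p' p with rfl | h1
  · rcases eq_or_ne q' q with rfl | h2
    · simp at h
    · simp [single, Pi.single_eq_of_ne h2]
  · simp [single, Pi.single_eq_of_ne h1]

lemma single_mem_Tot (p q : ℕ) (x : C p q) : single p q x ∈ Tot C (p + q) := fun p' q' h =>
  single_of_ne (by omega) x

lemma single_mem_Fil (p q : ℕ) (x : C p q) : single p q x ∈ Fil C p := fun p' q' h =>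
  single_of_ne (by omega) x

section Pages
variable {δ d}

lemma mem_pageZ {r p q : ℤ} {c : ∀ p q, C p q} : c ∈ pageZ δ d r p q ↔
    c ∈ Tot C (p + q) ∧ c ∈ Fil C p ∧ totD δ d c ∈ Fil C (p + r) := by
  simp [pageZ, and_assoc]

lemma mem_pageB {r p q : ℤ} {c : ∀ p q, C p q} : c ∈ pageB δ d r p q ↔
    ∃ z ∈ pageZ δ d (r - 1) (p + 1) (q - 1), ∃ w ∈ pageZ δ d (r - 1) (p - r + 1) (q + r - 2),
      c = z + totD δ d w := by
  simp only [pageB, Submodule.mem_sup, Submodule.mem_map]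
  constructor
  · rintro ⟨z, hz, _, ⟨w, hw, rfl⟩, rfl⟩; exact ⟨z, hz, w, hw, rfl⟩
  · rintro ⟨z, hz, w, hw, rfl⟩; exact ⟨z, hz, _, ⟨w, hw, rfl⟩, rfl⟩

lemma page.mk_surjective {r p q : ℤ} (y : page δ d r p q) :
    ∃ c, ∃ hc : c ∈ pageZ δ d r p q, y = page.mk δ d c hc := by
  obtain ⟨⟨x, hx⟩, rfl⟩ := Submodule.Quotient.mk_surjective _ y
  exact ⟨x, hx, rfl⟩

lemma page.mk_eq_zero_iff {r p q : ℤ} {c : ∀ p q, C p q} {hc : c ∈ pageZ δ d r p q} :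
    page.mk δ d c hc = 0 ↔ c ∈ pageB δ d r p q :=
  Submodule.Quotient.mk_eq_zero _

lemma page.mk_eq_iff {r p q : ℤ} {c c' : ∀ p q, C p q} {hc : c ∈ pageZ δ d r p q}
    {hc' : c' ∈ pageZ δ d r p q} :
    page.mk δ d c hc = page.mk δ d c' hc' ↔ c - c' ∈ pageB δ d r p q :=
  Submodule.Quotient.eq _

lemma page.exists_equiv {r p q : ℤ} {H : Type*} [AddCommGroup H] [Module ℂ H]
    (f : pageZ δ d r p q →ₗ[ℂ] H) (hf : Function.Surjective f)
    (hker : ∀ c : pageZ δ d r p q, f c = 0 ↔ c.1 ∈ pageB δ d r p q) :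
    ∃ θ : page δ d r p q ≃ₗ[ℂ] H, ∀ c (hc : c ∈ pageZ δ d r p q),
      θ (page.mk δ d c hc) = f ⟨c, hc⟩ := by
  obtain ⟨θ, hθ⟩ := exists_quot_equiv (S := (pageB δ d r p q).submoduleOf (pageZ δ d r p q)) f hf
    (by ext x; exact hker x)
  exact ⟨θ, fun x hx => hθ _⟩

variable (hD : ∀ c : ∀ p q, C p q, totD δ d (totD δ d c) = 0)
include hD

lemma totD_mem_pageZ {r p q p' q' : ℤ} (hp : p' = p + r) (hq : q' = q - r + 1) {c : ∀ p q, C p q}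
    (hc : c ∈ pageZ δ d r p q) : totD δ d c ∈ pageZ δ d r p' q' := by
  subst hp hq
  rw [mem_pageZ] at hc ⊢
  refine ⟨?_, hc.2.2, ?_⟩
  · have := totD_mem_Tot δ d hc.1
    rwa [show p + r + (q - r + 1) = p + q + 1 by ring]
  · rw [hD]; exact zero_mem _

/-- In `D (z + D w) = D z` the term `w` disappears, and `z` is an admissible second summand for the
target bidegree. -/
lemma totD_mem_pageB {r p q p' q' : ℤ} (hp : p' = p + r) (hq : q' = q - r + 1) {c : ∀ p q, C p q}
    (hc : c ∈ pageB δ d r p q) : totD δ d c ∈ pageB δ d r p' q' := by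
  subst hp hq
  rw [mem_pageB] at hc ⊢
  obtain ⟨z, hz, w, -, rfl⟩ := hc
  refine ⟨0, zero_mem _, z, ?_, ?_⟩
  · rwa [show p + r - r + 1 = p + 1 by ring, show q - r + 1 + r - 2 = q - 1 by ring]
  · rw [map_add, hD]; simp

lemma pageB_le_comap {r p q p' q' : ℤ} (hp : p' = p + r) (hq : q' = q - r + 1) :
    (pageB δ d r p q).submoduleOf (pageZ δ d r p q) ≤
      ((pageB δ d r p' q').submoduleOf (pageZ δ d r p' q')).comap
        ((totD δ d).restrict fun _ hc => totD_mem_pageZ hD hp hq hc) :=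
  fun _ hc => totD_mem_pageB hD hp hq hc

open Classical in
/-- The differential of a page; it is zero unless the target has the right bidegree. -/
def pageD (r p q p' q' : ℤ) : page δ d r p q →ₗ[ℂ] page δ d r p' q' :=
  if h : p' = p + r ∧ q' = q - r + 1 then Submodule.mapQ _ _ _ (pageB_le_comap hD h.1 h.2) else 0

lemma pageD_mk {r p q p' q' : ℤ} (hp : p' = p + r) (hq : q' = q - r + 1) {c : ∀ p q, C p q}
    (hc : c ∈ pageZ δ d r p q) :
    pageD hD r p q p' q' (page.mk δ d c hc) = page.mk δ d _ (totD_mem_pageZ hD hp hq hc) := by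
  have h : pageD hD r p q p' q' = Submodule.mapQ _ _ _ (pageB_le_comap hD hp hq) :=
    dif_pos ⟨hp, hq⟩
  rw [h]
  rfl

lemma pageZ_succ_le {r p q : ℤ} : pageZ δ d (r + 1) p q ≤ pageZ δ d r p q := fun c hc => by
  rw [mem_pageZ] at hc ⊢
  exact ⟨hc.1, hc.2.1, Fil_anti (by omega) hc.2.2⟩

/-- `D c` lies one filtration step deeper than the target requires, hence in the first summand of
the denominator. -/
lemma mk_mem_ker_pageD {r p q p' q' : ℤ} (hp : p' = p + r) (hq : q' = q - r + 1)
    {c : ∀ p q, C p q} (hc : c ∈ pageZ δ d (r + 1) p q) :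
    page.mk δ d c (pageZ_succ_le hD hc) ∈ LinearMap.ker (pageD hD r p q p' q') := by
  rw [LinearMap.mem_ker, pageD_mk hD hp hq, page.mk_eq_zero_iff, mem_pageB]
  refine ⟨_, ?_, 0, zero_mem _, by rw [map_zero, add_zero]⟩
  subst hp hq
  rw [mem_pageZ] at hc ⊢
  refine ⟨?_, Fil_anti (by omega) hc.2.2, by rw [hD]; exact zero_mem _⟩
  have := totD_mem_Tot δ d hc.1
  rwa [show p + r + 1 + (q - r + 1 - 1) = p + q + 1 by ring]

/-- The terms associated with the filtration by the first degree form a spectral sequence. -/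
lemma hasPages : HasPages δ d := by
  refine ⟨fun r => pageD hD r, fun r p q p' q' hp hq c hc =>
    ⟨totD_mem_pageZ hD hp hq hc, pageD_mk hD hp hq hc⟩, fun r p q => ⟨?_, ?_⟩⟩
  · rintro _ ⟨y, rfl⟩
    obtain ⟨c, hc, rfl⟩ := page.mk_surjective y
    rw [LinearMap.mem_ker, pageD_mk hD (by ring) (by ring), pageD_mk hD rfl rfl,
      page.mk_eq_zero_iff, hD]
    exact zero_mem _
  · set p' : ℤ := p + r with hp
    set q' : ℤ := q - r + 1 with hq
    -- The map `[c] ↦ [c]` of the statement goes from `ker d_r` to `E_{r+1}`; it is obtained by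
    -- inverting the class map `Z_{r+1} → ker d_r`, which is surjective with kernel inside the
    -- denominator of `E_{r+1}`.
    let ψ : pageZ δ d (r + 1) p q →ₗ[ℂ] LinearMap.ker (pageD hD r p q p' q') :=
      { toFun := fun c => ⟨page.mk δ d c.1 (pageZ_succ_le hD c.2), mk_mem_ker_pageD hD hp hq c.2⟩
        map_add' := fun _ _ => rfl
        map_smul' := fun _ _ => rfl }
    have hsurj : Function.Surjective ψ := by
      rintro ⟨y, hy⟩
      obtain ⟨c, hc, rfl⟩ := page.mk_surjective y
      rw [LinearMap.mem_ker, pageD_mk hD hp hq, page.mk_eq_zero_iff, mem_pageB] at hy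
      obtain ⟨z, hz, w, hw, hzw⟩ := hy
      rw [show p' - r + 1 = p + 1 by omega, show q' + r - 2 = q - 1 by omega] at hw
      have hw' := hw
      rw [mem_pageZ] at hw hz
      have hc' := hc
      rw [mem_pageZ] at hc
      -- `D c = z + D w` with `z` in `F^{p+r+1}`, so subtracting `w` improves `c` to an element of
      -- `Z_{r+1}`. The class in `E_r` is unchanged because `w` belongs to `Z_{r-1}^{p+1,q-1}`.
      have hm : c - w ∈ pageZ δ d (r + 1) p q := by
        rw [mem_pageZ]
        refine ⟨sub_mem hc.1 ?_, sub_mem hc.2.1 (Fil_anti (by omega) hw.2.1), ?_⟩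
        · have := hw.1; rwa [show p + 1 + (q - 1) = p + q by ring] at this
        · rw [map_sub, hzw, add_sub_cancel_right]
          exact Fil_anti (by omega) hz.2.1
      refine ⟨⟨c - w, hm⟩, Subtype.ext ?_⟩
      change page.mk δ d (c - w) _ = page.mk δ d c hc'
      rw [page.mk_eq_iff, mem_pageB]
      exact ⟨-w, neg_mem hw', 0, zero_mem _, by rw [map_zero]; abel⟩
    have hker : LinearMap.ker ψ ≤
        (pageB δ d (r + 1 : ℕ) p q).submoduleOf (pageZ δ d (r + 1 : ℕ) p q) := by
      rintro ⟨c, hc⟩ h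
      have h1 : page.mk δ d c (pageZ_succ_le hD hc) = 0 := congrArg Subtype.val h
      rw [page.mk_eq_zero_iff, mem_pageB] at h1
      obtain ⟨z, hz, w, hw, rfl⟩ := h1
      change z + totD δ d w ∈ pageB δ d (r + 1 : ℕ) p q
      rw [mem_pageB]
      refine ⟨z, ?_, w, ?_, rfl⟩
      · rw [mem_pageZ] at hz hc ⊢
        refine ⟨hz.1, hz.2.1, ?_⟩
        -- `D z = D c` shows that `z`, known to be in `Z_{r-1}`, is in fact in `Z_r`.
        have := hc.2.2
        rw [map_add, hD, add_zero] at this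
        exact Fil_anti (by push_cast; omega) this
      · rw [mem_pageZ] at hw ⊢
        push_cast
        refine ⟨?_, Fil_anti (by omega) hw.2.1, Fil_anti (by omega) hw.2.2⟩
        have := hw.1
        rwa [show p - r + 1 + (q + r - 2) = p - (r + 1) + 1 + (q + (r + 1) - 2) by ring] at this
    let e := ψ.quotKerEquivOfSurjective hsurj
    let φ : LinearMap.ker (pageD hD r p q p' q') →ₗ[ℂ] page δ d (r + 1 : ℕ) p q :=
      Submodule.mapQ (LinearMap.ker ψ) _ LinearMap.id hker ∘ₗ e.symm.toLinearMap
    have hφ : ∀ c : pageZ δ d (r + 1) p q, φ (ψ c) = page.mk δ d (r := (r + 1 : ℕ)) c.1 c.2 := by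
      intro c
      have : e.symm (ψ c) = Submodule.Quotient.mk c := by
        rw [LinearEquiv.symm_apply_eq]; rfl
      change Submodule.mapQ _ _ LinearMap.id hker (e.symm (ψ c)) = _
      rw [this]; rfl
    refine ⟨φ, ?_, ?_, fun c hc => ⟨pageZ_succ_le hD hc, mk_mem_ker_pageD hD hp hq hc, hφ ⟨c, hc⟩⟩⟩
    · intro y
      obtain ⟨c, hc, rfl⟩ := page.mk_surjective y
      exact ⟨_, hφ ⟨c, hc⟩⟩
    · ext x
      obtain ⟨⟨c, hc⟩, rfl⟩ := hsurj x
      rw [LinearMap.mem_ker, hφ, page.mk_eq_zero_iff]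
      change c ∈ _ ↔ page.mk δ d c (pageZ_succ_le hD hc) ∈ LinearMap.range _
      rw [mem_pageB]
      constructor
      · rintro ⟨z, hz, w, hw, rfl⟩
        push_cast at hw hz
        have hw' : w ∈ pageZ δ d r (p - r) (q + r - 1) := by
          rw [mem_pageZ] at hw ⊢
          refine ⟨?_, Fil_anti (by omega) hw.2.1, Fil_anti (by omega) hw.2.2⟩
          have := hw.1
          rwa [show p - (r + 1) + 1 + (q + (r + 1) - 2) = p - r + (q + r - 1) by ring] at this
        refine ⟨page.mk δ d w hw', ?_⟩
        rw [pageD_mk hD (by ring) (by ring), page.mk_eq_iff, mem_pageB]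
        refine ⟨-z, neg_mem ?_, 0, zero_mem _, by rw [map_zero]; abel⟩
        rw [mem_pageZ] at hz ⊢
        exact ⟨hz.1, hz.2.1, Fil_anti (by omega) hz.2.2⟩
      · rintro ⟨y, hy⟩
        obtain ⟨w, hw, rfl⟩ := page.mk_surjective y
        rw [pageD_mk hD (by ring) (by ring), page.mk_eq_iff, mem_pageB] at hy
        obtain ⟨z, hz, v, hv, h⟩ := hy
        -- From `[c] = d_r [w]` one has `D w - c = z + D v`. The element `w - v` is the source of
        -- the boundary, and `D z = - D c` again raises `z` from `Z_{r-1}` to `Z_r`.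
        have h' : c = -z + totD δ d (w - v) := by
          rw [map_sub, neg_add_eq_sub, ← sub_eq_zero]
          have := sub_eq_zero.2 h
          rw [← neg_eq_zero, ← this]; abel
        refine ⟨-z, neg_mem ?_, w - v, ?_, h'⟩
        · have hDz : totD δ d z = - totD δ d c := by
            rw [h', map_add, hD, map_neg, add_zero, neg_neg]
          rw [mem_pageZ] at hz hc ⊢
          refine ⟨hz.1, hz.2.1, ?_⟩
          rw [hDz]
          exact neg_mem (Fil_anti (by push_cast; omega) hc.2.2)
        · rw [mem_pageZ] at hw hv ⊢
          push_cast
          refine ⟨sub_mem ?_ ?_, sub_mem (Fil_anti (by omega) hw.2.1) (Fil_anti (by omega) hv.2.1),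
            ?_⟩
          · have := hw.1
            rwa [show p - (r + 1) + 1 + (q + (r + 1) - 2) = p - r + (q + r - 1) by ring]
          · have := hv.1
            rwa [show p - (r + 1) + 1 + (q + (r + 1) - 2) = p - r + 1 + (q + r - 2) by ring]
          · rw [map_sub]
            exact sub_mem (Fil_anti (by omega) hw.2.2) (Fil_anti (by omega) hv.2.2)

end Pages

end Bicomplex

/-! ### The first two pages, and augmented double complexes -/

section Bicomplex
variable {C : ℕ → ℕ → Type*} [∀ p q, AddCommGroup (C p q)] [∀ p q, Module ℂ (C p q)]
variable {δ : ∀ p q, C p q →ₗ[ℂ] C (p + 1) q} {d : ∀ p q, C p q →ₗ[ℂ] C p (q + 1)}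

lemma neg_one_pow_smul_eq_zero_iff {V : Type*} [AddCommGroup V] [Module ℂ V] {n : ℕ} {x : V} :
    (-1 : ℂ) ^ n • x = 0 ↔ x = 0 := by
  simp

/-- On the leading column of an element of `F^p` there is nothing to the left, so `D` acts there by
`± d` alone. -/
lemma totD_apply_of_mem_Fil {p : ℕ} {c : ∀ p q, C p q} (hc : c ∈ Fil C p) (q : ℕ) :
    totD δ d c p q = verD d p q c := by
  rw [totD_apply]
  rcases p with _ | p
  · rw [horD_zero, zero_add]
  · rw [horD_succ, hc p q (by push_cast; omega), map_zero, zero_add]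

/-- In a fixed total degree the column `p` has a single component; killing it moves the element to
the next filtration step. -/
lemma mem_Fil_succ {p q : ℕ} {c : ∀ p q, C p q} (h1 : c ∈ Tot C (p + q)) (h2 : c ∈ Fil C p)
    (h3 : c p q = 0) : c ∈ Fil C (p + 1) := by
  intro k l hk
  rcases eq_or_ne k p with rfl | hk'
  · rcases eq_or_ne l q with rfl | hl
    · exact h3
    · exact h1 k l (by omega)
  · exact h2 k l (by omega)

/-- Any vertical coboundary in bidegree `(p, q)` can be removed by a total boundary without leaving
`F^p`. The witness carries the sign `(-1)^p` to cancel the one in `D`. -/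
lemma exists_totD_eq {p q : ℕ} {y : C p q} (hy : y ∈ cobd (d p) q) :
    ∃ w : ∀ p q, C p q, w ∈ Tot C (p + q - 1) ∧ w ∈ Fil C p ∧ totD δ d w p q = y := by
  rcases q with _ | q
  · have hy0 : y = 0 := hy
    exact ⟨0, zero_mem _, zero_mem _, by rw [map_zero, hy0]; rfl⟩
  · obtain ⟨b, rfl⟩ : ∃ b, d p q b = y := hy
    refine ⟨single p q ((-1 : ℂ) ^ p • b), ?_, single_mem_Fil _ _ _, ?_⟩
    · have := single_mem_Tot p q ((-1 : ℂ) ^ p • b)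
      rwa [show (p : ℤ) + ((q + 1 : ℕ) : ℤ) - 1 = p + q by push_cast; ring]
    · rw [totD_apply_of_mem_Fil (single_mem_Fil _ _ _), verD_succ, single_same, map_smul, smul_smul,
        ← pow_add, Even.neg_one_pow ⟨p, rfl⟩, one_smul]

lemma totD_single_mem_Fil {p q : ℕ} {x : C p q} (hx : d p q x = 0) :
    totD δ d (single p q x) ∈ Fil C (p + 1) := by
  have h := totD_mem_Tot δ d (single_mem_Tot p q x)
  rw [show (p : ℤ) + q + 1 = p + (q + 1 : ℕ) by push_cast; ring] at h
  refine mem_Fil_succ h (totD_mem_Fil δ d (single_mem_Fil p q x)) ?_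
  rw [totD_apply_of_mem_Fil (single_mem_Fil _ _ _), verD_succ, single_same, hx, smul_zero]

lemma totD_single_apply {p q : ℕ} (x : C p q) : totD δ d (single p q x) (p + 1) q = δ p q x := by
  rw [totD_apply, horD_succ, single_same]
  rcases q with _ | q
  · rw [verD_zero, add_zero]
  · rw [verD_succ, single_of_ne (Or.inl (by omega)), map_zero, smul_zero, add_zero]

section Pages
variable {H : ℕ → ℕ → Type*} [∀ q p, AddCommGroup (H q p)] [∀ q p, Module ℂ (H q p)]
  (π : ∀ p q, LinearMap.ker (d p q) →ₗ[ℂ] H q p) (hπ : ∀ p q, Function.Surjective (π p q))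
  (hπ' : ∀ p q (x : LinearMap.ker (d p q)), π p q x = 0 ↔ x.1 ∈ cobd (d p) q)

lemma vert_eq_zero_of_mem_pageZ {r : ℤ} (hr : 1 ≤ r) {p q : ℕ} {c : ∀ p q, C p q}
    (hc : c ∈ pageZ δ d r p q) : d p q (c p q) = 0 := by
  rw [mem_pageZ] at hc
  have := hc.2.2 p (q + 1) (by omega)
  rwa [totD_apply_of_mem_Fil hc.2.1, verD_succ, neg_one_pow_smul_eq_zero_iff] at this

/-- The component of bidegree `(p, q)` of an element of `Z_r^{p,q}`, `r ≥ 1`. -/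
def compL {r : ℤ} (hr : 1 ≤ r) (p q : ℕ) : pageZ δ d r p q →ₗ[ℂ] LinearMap.ker (d p q) where
  toFun c := ⟨c.1 p q, vert_eq_zero_of_mem_pageZ hr c.2⟩
  map_add' _ _ := rfl
  map_smul' _ _ := rfl

include hπ hπ'

/-- The first page consists of the vertical cohomology. -/
lemma exists_page_one_equiv (p q : ℕ) : ∃ θ : page δ d 1 p q ≃ₗ[ℂ] H q p,
    ∀ c (hc : c ∈ pageZ δ d 1 p q), ∃ h : d p q (c p q) = 0,
      θ (page.mk δ d c hc) = π p q ⟨c p q, h⟩ := by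
  refine (page.exists_equiv (π p q ∘ₗ compL (δ := δ) (d := d) le_rfl p q) ?_ ?_).elim fun θ hθ =>
    ⟨θ, fun c hc => ⟨vert_eq_zero_of_mem_pageZ le_rfl hc, hθ c hc⟩⟩
  · intro y
    obtain ⟨⟨x, hx⟩, rfl⟩ := hπ p q y
    refine ⟨⟨single p q x, mem_pageZ.2 ⟨single_mem_Tot p q x, single_mem_Fil p q x,
      totD_single_mem_Fil hx⟩⟩, ?_⟩
    change π p q ⟨single p q x p q, _⟩ = _
    congr 2
    exact single_same p q x
  · rintro ⟨c, hc⟩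
    rw [LinearMap.comp_apply, hπ', mem_pageB]
    change c p q ∈ _ ↔ _
    rw [mem_pageZ] at hc
    constructor
    · intro h
      obtain ⟨w, hw1, hw2, hw3⟩ := exists_totD_eq (δ := δ) h
      -- The leading component of `c - D w` vanishes, so it lies in `F^{p+1}`; the remaining
      -- condition in `Z_0` is automatic because `D` preserves the filtration.
      refine ⟨c - totD δ d w, ?_, w, ?_, by abel⟩
      · have h2 := totD_mem_Tot δ d hw1
        rw [sub_add_cancel] at h2
        have : c - totD δ d w ∈ Fil C (p + 1) :=
          mem_Fil_succ (sub_mem hc.1 h2) (sub_mem hc.2.1 (totD_mem_Fil δ d hw2)) (by simp [hw3])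
        rw [mem_pageZ]
        refine ⟨?_, this, by simpa using totD_mem_Fil δ d this⟩
        rw [show (p : ℤ) + 1 + (q - 1) = p + q by ring]
        exact sub_mem hc.1 h2
      · rw [mem_pageZ]
        refine ⟨by rwa [show (p : ℤ) - 1 + 1 + (q + 1 - 2) = p + q - 1 by ring], ?_, ?_⟩
        · rwa [sub_add_cancel]
        · simpa using totD_mem_Fil δ d hw2
    · rintro ⟨z, hz, w, hw, rfl⟩
      rw [mem_pageZ] at hz hw
      have hw2 : w ∈ Fil C p := by simpa using hw.2.1
      have : (z + totD δ d w) p q = verD d p q w := by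
        rw [← totD_apply_of_mem_Fil (δ := δ) hw2, Pi.add_apply, Pi.add_apply,
          hz.2.1 p q (by omega), zero_add]
      rw [this]
      rcases q with _ | q
      · rw [verD_zero]; exact zero_mem _
      · rw [verD_succ]; exact Submodule.smul_mem _ _ ⟨_, rfl⟩

variable (δH : ∀ q p, H q p →ₗ[ℂ] H q (p + 1))
  (hδH : ∀ p q x (hx : d p q x = 0) (h' : d (p + 1) q (δ p q x) = 0),
    δH q p (π p q ⟨x, hx⟩) = π (p + 1) q ⟨δ p q x, h'⟩)
  (hD : ∀ c : ∀ p q, C p q, totD δ d (totD δ d c) = 0)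
  (hδd : ∀ p q c, δ p (q + 1) (d p q c) = d (p + 1) q (δ p q c))
include hδH hD hδd

omit hD in
-- Since `D c` lies in `F^{p+2}`, its component in bidegree `(p+1, q)` vanishes: `δ c_{p,q}` is, up
-- to sign, the vertical differential of the next component of `c`.
lemma hor_class_eq_zero {p q : ℕ} {c : ∀ p q, C p q} (hc : c ∈ pageZ δ d 2 p q) :
    δH q p (π p q (compL (by norm_num) p q ⟨c, hc⟩)) = 0 := by
  have h0 := vert_eq_zero_of_mem_pageZ (by norm_num) hc
  have h1 : d (p + 1) q (δ p q (c p q)) = 0 := by rw [← hδd, h0, map_zero]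
  change δH q p (π p q ⟨c p q, h0⟩) = 0
  rw [hδH p q _ h0 h1, hπ']
  rw [mem_pageZ] at hc
  have h2 := hc.2.2 (p + 1) q (by push_cast; omega)
  rw [totD_apply, horD_succ, add_eq_zero_iff_eq_neg] at h2
  change δ p q (c p q) ∈ _
  rw [h2]
  rcases q with _ | q
  · rw [verD_zero, neg_zero]; exact zero_mem _
  · rw [verD_succ]; exact neg_mem (Submodule.smul_mem _ _ ⟨_, rfl⟩)

/-- The second page is the horizontal cohomology of the vertical cohomology. -/
lemma exists_page_two_equiv (p q : ℕ) : ∃ θ : page δ d 2 p q ≃ₗ[ℂ] Coh (δH q) p,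
    ∀ c (hc : c ∈ pageZ δ d 2 p q), ∃ (h : d p q (c p q) = 0)
      (h' : δH q p (π p q ⟨c p q, h⟩) = 0),
      θ (page.mk δ d c hc) = Coh.mk (δH q) (π p q ⟨c p q, h⟩) h' := by
  have h12 : (1 : ℤ) ≤ 2 := by norm_num
  let f : pageZ δ d 2 p q →ₗ[ℂ] LinearMap.ker (δH q p) :=
    (π p q ∘ₗ compL h12 p q).codRestrict _ fun c => hor_class_eq_zero π hπ hπ' δH hδH hδd c.2
  refine (page.exists_equiv (Coh.mkL (δH q) p ∘ₗ f) ?_ ?_).elim fun θ hθ =>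
    ⟨θ, fun c hc => ⟨vert_eq_zero_of_mem_pageZ h12 hc,
      hor_class_eq_zero π hπ hπ' δH hδH hδd hc, hθ c hc⟩⟩
  · intro y
    obtain ⟨y, hy, rfl⟩ := Coh.mk_surjective _ y
    obtain ⟨⟨x, hx⟩, rfl⟩ := hπ p q y
    have hx0 : d p q x = 0 := hx
    have h1 : d (p + 1) q (δ p q x) = 0 := by rw [← hδd, hx0, map_zero]
    rw [hδH p q x hx0 h1, hπ'] at hy
    -- The horizontal differential of `x` is only a vertical coboundary, not zero. The element `w`,
    -- supported in columns `≥ p + 1`, corrects it: `D (x - w)` vanishes in the columns `p` and `p +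
    -- 1`.
    obtain ⟨w, hw1, hw2, hw3⟩ := exists_totD_eq (δ := δ) hy
    have hc : single p q x - w ∈ pageZ δ d 2 p q := by
      have ht : single p q x - w ∈ Tot C (p + q) := by
        refine sub_mem (single_mem_Tot p q x) ?_
        rwa [show ((p + 1 : ℕ) : ℤ) + q - 1 = p + q by push_cast; ring] at hw1
      refine mem_pageZ.2 ⟨ht, sub_mem (single_mem_Fil p q x)
        (Fil_anti (by push_cast; omega) hw2), ?_⟩
      rw [show (p : ℤ) + 2 = (p + 1 : ℕ) + 1 by push_cast; ring]
      refine mem_Fil_succ (q := q) ?_ ?_ ?_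
      · rw [show ((p + 1 : ℕ) : ℤ) + q = p + q + 1 by push_cast; ring]
        exact totD_mem_Tot δ d ht
      · rw [map_sub]
        exact sub_mem (by simpa using totD_single_mem_Fil hx0) (totD_mem_Fil δ d hw2)
      · rw [map_sub, Pi.sub_apply, Pi.sub_apply, totD_single_apply, hw3, sub_self]
    refine ⟨⟨_, hc⟩, ?_⟩
    have : f ⟨_, hc⟩ = ⟨π p q ⟨x, hx⟩, by
        rw [LinearMap.mem_ker, hδH p q x hx0 h1, hπ']; exact hy⟩ := by
      refine Subtype.ext ?_
      change π p q ⟨(single p q x - w) p q, _⟩ = _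
      congr 2
      rw [Pi.sub_apply, Pi.sub_apply, single_same, hw2 p q (by push_cast; omega), sub_zero]
    rw [LinearMap.comp_apply, this]
    rfl
  · rintro ⟨c, hc⟩
    have h0 := vert_eq_zero_of_mem_pageZ h12 hc
    rw [LinearMap.comp_apply, mem_pageB]
    change Coh.mk (δH q) (π p q ⟨c p q, h0⟩) (hor_class_eq_zero π hπ hπ' δH hδH hδd hc) = 0 ↔ _
    refine Iff.trans (Coh.mk_eq_zero_iff (δH q)) ?_
    rw [mem_pageZ] at hc
    constructor
    · intro h
      -- `v` realizes the horizontal coboundary: zero if `p = 0`, otherwise a vertically closed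
      -- element of column `p - 1`. What is left of the leading component of `c` is a vertical
      -- coboundary, removed by `u` below.
      obtain ⟨v, hv1, hv2, hv3, hv4⟩ : ∃ v : ∀ p q, C p q, v ∈ Tot C (p + q - 1) ∧
          v ∈ Fil C (p - 1) ∧ totD δ d v ∈ Fil C p ∧
          c p q - totD δ d v p q ∈ cobd (d p) q := by
        rcases p with _ | p
        · refine ⟨0, zero_mem _, zero_mem _, by rw [map_zero]; exact zero_mem _, ?_⟩
          have h' : π 0 q ⟨c 0 q, h0⟩ = 0 := h
          rw [hπ'] at h'
          simpa using h'
        · obtain ⟨y, hy⟩ : ∃ y, δH q p y = π (p + 1) q ⟨c (p + 1) q, h0⟩ := h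
          obtain ⟨⟨x, hx⟩, rfl⟩ := hπ p q y
          have hx0 : d p q x = 0 := hx
          have h1 : d (p + 1) q (δ p q x) = 0 := by rw [← hδd, hx0, map_zero]
          refine ⟨single p q x, ?_, ?_, ?_, ?_⟩
          · rw [show ((p + 1 : ℕ) : ℤ) + q - 1 = p + q by push_cast; ring]
            exact single_mem_Tot p q x
          · rw [show ((p + 1 : ℕ) : ℤ) - 1 = p by push_cast; ring]
            exact single_mem_Fil p q x
          · simpa using totD_single_mem_Fil hx0
          · rw [hδH p q x hx0 h1, eq_comm, ← sub_eq_zero, ← map_sub, hπ'] at hy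
            rw [totD_single_apply]
            exact hy
      obtain ⟨u, hu1, hu2, hu3⟩ := exists_totD_eq (δ := δ) hv4
      have hw1 : u + v ∈ Tot C (p + q - 1) := add_mem hu1 hv1
      have hDw : totD δ d (u + v) ∈ Fil C p := by
        rw [map_add]; exact add_mem (totD_mem_Fil δ d hu2) hv3
      have ht : c - totD δ d (u + v) ∈ Tot C (p + q) := by
        refine sub_mem hc.1 ?_
        have := totD_mem_Tot δ d hw1
        rwa [sub_add_cancel] at this
      refine ⟨c - totD δ d (u + v), ?_, u + v, ?_, by abel⟩
      · rw [mem_pageZ]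
        refine ⟨by rwa [show (p : ℤ) + 1 + (q - 1) = p + q by ring], ?_, ?_⟩
        · refine mem_Fil_succ ht (sub_mem hc.2.1 hDw) ?_
          rw [map_add]
          simp [hu3]
        · rw [map_sub, hD, sub_zero]
          exact Fil_anti (by omega) hc.2.2
      · rw [mem_pageZ]
        refine ⟨by rwa [show (p : ℤ) - 2 + 1 + (q + 2 - 2) = p + q - 1 by ring], ?_, ?_⟩
        · exact add_mem (Fil_anti (by omega) hu2) (Fil_anti (by omega) hv2)
        · exact Fil_anti (by omega) hDw
    · rintro ⟨z, hz, w, hw, hzw⟩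
      rw [mem_pageZ] at hz hw
      have h1 : c p q = horD δ p q w + verD d p q w := by
        have hzw' : c = z + totD δ d w := hzw
        rw [hzw', Pi.add_apply, Pi.add_apply, hz.2.1 p q (by omega), zero_add, totD_apply]
      rcases p with _ | p
      · change π 0 q _ = 0
        rw [hπ']
        change c 0 q ∈ _
        rw [h1, horD_zero, zero_add]
        rcases q with _ | q
        · rw [verD_zero]; exact zero_mem _
        · rw [verD_succ]; exact Submodule.smul_mem _ _ ⟨_, rfl⟩
      · have hw2 : w ∈ Fil C p := Fil_anti (by push_cast; omega) hw.2.1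
        have hdw : d p q (w p q) = 0 := by
          have := hw.2.2 p (q + 1) (by push_cast; omega)
          rwa [totD_apply_of_mem_Fil hw2, verD_succ, neg_one_pow_smul_eq_zero_iff] at this
        have h2 : d (p + 1) q (δ p q (w p q)) = 0 := by rw [← hδd, hdw, map_zero]
        refine ⟨π p q ⟨w p q, hdw⟩, ?_⟩
        rw [hδH p q _ hdw h2, eq_comm, ← sub_eq_zero, ← map_sub, hπ']
        change c (p + 1) q - δ p q (w p q) ∈ _
        rw [h1, horD_succ, add_sub_cancel_left]
        rcases q with _ | q
        · rw [verD_zero]; exact zero_mem _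
        · rw [verD_succ]; exact Submodule.smul_mem _ _ ⟨_, rfl⟩

end Pages

/-! ### The staircase argument for exact augmented rows -/

section Augmented
variable {X : ℕ → Type*} [∀ n, AddCommGroup (X n)] [∀ n, Module ℂ (X n)]
  {dX : ∀ n, X n →ₗ[ℂ] X (n + 1)} {ε : ∀ q, X q →ₗ[ℂ] C 0 q}
  (hD : ∀ c : ∀ p q, C p q, totD δ d (totD δ d c) = 0)
  (hε : ∀ q x, ε (q + 1) (dX q x) = d 0 q (ε q x))
  (hinj : ∀ q, Function.Injective (ε q))
  (h0 : ∀ q, LinearMap.range (ε q) = LinearMap.ker (δ 0 q))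
  (hex : ∀ p q, LinearMap.range (δ p q) = LinearMap.ker (δ (p + 1) q))

include hD hex in
/-- An element whose total differential lies in the column `p = 0` is, up to a boundary,
concentrated in this column. -/
lemma exists_concentrated {n : ℤ} {c : ∀ p q, C p q} (hc : c ∈ Tot C n)
    (hDc : ∀ p q, totD δ d c (p + 1) q = 0) :
    ∃ a ∈ Tot C (n - 1), ∀ p q, (c - totD δ d a) (p + 1) q = 0 := by
  -- Induction on the index `N` of the last nonzero column. In degree `n` all columns beyond `n`
  -- vanish, so the bound `n.toNat` is available at the start.
  suffices H : ∀ N : ℕ, ∀ c ∈ Tot C n, (∀ p q, totD δ d c (p + 1) q = 0) →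
      (∀ p q, N < p → c p q = 0) →
      ∃ a ∈ Tot C (n - 1), ∀ p q, (c - totD δ d a) (p + 1) q = 0 from
    H n.toNat c hc hDc fun p q hp => hc p q (by omega)
  intro N
  induction N with
  | zero => exact fun c _ _ h => ⟨0, zero_mem _, fun p q => by
      rw [map_zero, sub_zero]; exact h _ _ (Nat.succ_pos p)⟩
  | succ N ih =>
    intro c hc hDc hN
    by_cases hn : (n : ℤ) < N + 1
    · exact ih c hc hDc fun p q hp => hc p q (by omega)
    obtain ⟨q, hq⟩ : ∃ q : ℕ, n = ((N + 1 : ℕ) : ℤ) + q := ⟨(n - (N + 1)).toNat, by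
      push_cast; omega⟩
    -- Column `N + 2` of `c` is zero, so in bidegree `(N + 2, q)` the vanishing total differential
    -- reduces to `δ c_{N+1,q} = 0`. Row exactness then gives `b`, and subtracting `D b` clears the
    -- last column.
    have h1 : δ (N + 1) q (c (N + 1) q) = 0 := by
      have := hDc (N + 1) q
      rw [totD_apply, horD_succ] at this
      rcases q with _ | q
      · rwa [verD_zero, add_zero] at this
      · rwa [verD_succ, hN _ _ (Nat.lt_succ_self _), map_zero, smul_zero, add_zero] at this
    obtain ⟨b, hb⟩ : c (N + 1) q ∈ LinearMap.range (δ N q) := by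
      rw [hex]; exact h1
    have hbt : single N q b ∈ Tot C (n - 1) := by
      rw [hq, show ((N + 1 : ℕ) : ℤ) + q - 1 = N + q by push_cast; ring]
      exact single_mem_Tot N q b
    have hDb : totD δ d (single N q b) ∈ Tot C n := by
      have := totD_mem_Tot δ d hbt
      rwa [sub_add_cancel] at this
    suffices h0 : ∀ p l, N < p → (c - totD δ d (single N q b)) p l = 0 by
      obtain ⟨a, ha, h⟩ := ih (c - totD δ d (single N q b)) (sub_mem hc hDb)
        (fun p q => by rw [map_sub, hD, sub_zero]; exact hDc p q) h0
      refine ⟨single N q b + a, add_mem hbt ha, fun p q => ?_⟩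
      rw [← h p q, map_add, sub_sub]
    · intro p l hp
      by_cases ht : (p : ℤ) + l = n
      · rcases eq_or_ne p (N + 1) with rfl | hp'
        · obtain rfl : l = q := by omega
          rw [Pi.sub_apply, Pi.sub_apply, totD_single_apply, hb, sub_self]
        · rw [Pi.sub_apply, Pi.sub_apply, hN p l (by omega), zero_sub, neg_eq_zero, totD_apply]
          obtain ⟨p, rfl⟩ : ∃ p', p = p' + 1 := ⟨p - 1, by omega⟩
          rw [horD_succ, single_of_ne (Or.inl (by omega)), map_zero, zero_add]
          rcases l with _ | l
          · rw [verD_zero]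
          · rw [verD_succ, single_of_ne (Or.inl (by omega)), map_zero, smul_zero]
      · exact sub_mem hc hDb p l ht

include hε h0 in
lemma totD_single_aug {n : ℕ} (x : X n) :
    totD δ d (single 0 n (ε n x)) = single 0 (n + 1) (ε (n + 1) (dX n x)) := by
  have hx : δ 0 n (ε n x) = 0 := by
    have : ε n x ∈ LinearMap.ker (δ 0 n) := by rw [← h0]; exact ⟨x, rfl⟩
    exact this
  funext p q
  rw [totD_apply]
  rcases p with _ | p
  · rw [horD_zero, zero_add]
    rcases q with _ | q
    · rw [verD_zero, single_of_ne (Or.inr (by omega))]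
    · rw [verD_succ, pow_zero, one_smul]
      rcases eq_or_ne q n with rfl | hq
      · rw [single_same, single_same, hε]
      · rw [single_of_ne (Or.inr hq), single_of_ne (Or.inr (by omega)), map_zero]
  · rw [horD_succ, single_of_ne (p := 0) (q := n + 1) (Or.inl (by omega))]
    have h2 : verD d (p + 1) q (single 0 n (ε n x)) = 0 := by
      rcases q with _ | q
      · rw [verD_zero]
      · rw [verD_succ, single_of_ne (Or.inl (by omega)), map_zero, smul_zero]
    rw [h2, add_zero]
    rcases p with _ | p
    · rcases eq_or_ne q n with rfl | hq
      · rw [single_same, hx]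
      · rw [single_of_ne (Or.inr hq), map_zero]
    · rw [single_of_ne (Or.inl (by omega)), map_zero]

lemma single_add (p q : ℕ) (x y : C p q) : single p q (x + y) = single p q x + single p q y := by
  simp [single, Pi.single_add]

lemma single_smul (p q : ℕ) (a : ℂ) (x : C p q) : single p q (a • x) = a • single p q x := by
  simp [single, Pi.single_smul]

lemma single_zero (p q : ℕ) : single p q (0 : C p q) = 0 := by simp [single]

lemma eq_single_zero {n : ℕ} {c : ∀ p q, C p q} (hc : c ∈ Tot C n)
    (h : ∀ p q, c (p + 1) q = 0) : c = single 0 n (c 0 n) := by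
  funext p q
  rcases p with _ | p
  · rcases eq_or_ne q n with rfl | hq
    · rw [single_same]
    · rw [single_of_ne (Or.inr hq), hc 0 q (by push_cast; omega)]
  · rw [single_of_ne (Or.inl (by omega)), h]

/-- The class map on the cocycles of the total complex. -/
def totH.mkL (n : ℤ) : totZ δ d n →ₗ[ℂ] totH δ d n := Submodule.mkQ _

lemma totH.mk_surjective {n : ℤ} (y : totH δ d n) :
    ∃ (c : ∀ p q, C p q) (hc : c ∈ totZ δ d n), y = totH.mk δ d c hc := by
  obtain ⟨⟨x, hx⟩, rfl⟩ := Submodule.Quotient.mk_surjective _ y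
  exact ⟨x, hx, rfl⟩

lemma totH.mk_eq_iff {n : ℤ} {c c' : ∀ p q, C p q} {hc : c ∈ totZ δ d n} {hc' : c' ∈ totZ δ d n} :
    totH.mk δ d c hc = totH.mk δ d c' hc' ↔ c - c' ∈ (Tot C (n - 1)).map (totD δ d) :=
  Submodule.Quotient.eq _

lemma totH.mk_eq_zero_iff {n : ℤ} {c : ∀ p q, C p q} {hc : c ∈ totZ δ d n} :
    totH.mk δ d c hc = 0 ↔ c ∈ (Tot C (n - 1)).map (totD δ d) :=
  Submodule.Quotient.mk_eq_zero _

include hε hinj h0 hD hex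

omit hinj in
-- Once concentrated in column zero, the remaining component is killed by `δ` because `D c` vanishes
-- in column one; so it comes from the augmentation. The hypothesis on `D c` covers both uses:
-- cocycles, for surjectivity, and primitives of augmented cocycles, for injectivity.
lemma exists_aug_eq {n : ℕ} {c : ∀ p q, C p q} (hc : c ∈ Tot C n)
    (hDc : ∀ p q, totD δ d c (p + 1) q = 0) :
    ∃ a ∈ Tot C ((n : ℤ) - 1), ∃ x : X n, c = single 0 n (ε n x) + totD δ d a := by
  obtain ⟨a, ha, h⟩ := exists_concentrated hD hex hc hDc
  have h1 : c - totD δ d a ∈ Tot C n := by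
    have := totD_mem_Tot δ d ha
    rw [sub_add_cancel] at this
    exact sub_mem hc this
  have h2 := eq_single_zero h1 h
  have h3 : δ 0 n ((c - totD δ d a) 0 n) = 0 := by
    have h4 : totD δ d (c - totD δ d a) 1 n = 0 := by rw [map_sub, hD, sub_zero]; exact hDc 0 n
    rwa [h2, totD_single_apply] at h4
  obtain ⟨x, hx⟩ : (c - totD δ d a) 0 n ∈ LinearMap.range (ε n) := by rw [h0]; exact h3
  exact ⟨a, ha, x, by rw [hx, ← h2]; abel⟩

/-- If the augmented rows are exact, then the augmentation induces an isomorphism onto the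
cohomology of the total complex. -/
lemma exists_totH_equiv (n : ℕ) : ∃ Φ : Coh dX n ≃ₗ[ℂ] totH δ d n,
    ∀ (x : X n) (hx : dX n x = 0), ∃ h : single 0 n (ε n x) ∈ totZ δ d n,
      Φ (Coh.mk dX x hx) = totH.mk δ d _ h := by
  have hmem : ∀ x : LinearMap.ker (dX n), single 0 n (ε n x.1) ∈ totZ δ d n := fun x => by
    refine ⟨by simpa using single_mem_Tot 0 n (ε n x.1), ?_⟩
    rw [SetLike.mem_coe, LinearMap.mem_ker, totD_single_aug hε h0, LinearMap.mem_ker.1 x.2, map_zero,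
      single_zero]
  let f : LinearMap.ker (dX n) →ₗ[ℂ] totZ δ d n :=
    { toFun := fun x => ⟨_, hmem x⟩
      map_add' := fun x y => Subtype.ext (by
        change single 0 n (ε n (x.1 + y.1)) = _
        rw [map_add, single_add]; rfl)
      map_smul' := fun a x => Subtype.ext (by
        change single 0 n (ε n (a • x.1)) = _
        rw [map_smul, single_smul]; rfl) }
  refine (Coh.exists_equiv dX (totH.mkL n ∘ₗ f) ?_ ?_).elim fun Φ hΦ => ⟨Φ, fun x hx => ⟨hmem ⟨x, hx⟩, hΦ x hx⟩⟩
  · intro y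
    obtain ⟨c, ⟨hc1, hc2⟩, rfl⟩ := totH.mk_surjective y
    have hc2' : totD δ d c = 0 := hc2
    obtain ⟨a, ha, x, rfl⟩ := exists_aug_eq hD hε h0 hex hc1 fun p q => by rw [hc2']; rfl
    have hx : dX n x = 0 := by
      rw [map_add, hD, add_zero, totD_single_aug hε h0] at hc2'
      have := congrFun (congrFun hc2' 0) (n + 1)
      rw [single_same] at this
      exact hinj _ (by rw [map_zero]; exact this)
    refine ⟨⟨x, hx⟩, ?_⟩
    refine totH.mk_eq_iff.2 ?_
    change single 0 n (ε n x) - (single 0 n (ε n x) + totD δ d a) ∈ _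
    exact ⟨-a, neg_mem ha, by rw [map_neg]; abel⟩
  · rintro ⟨x, hx⟩
    refine Iff.trans totH.mk_eq_zero_iff ?_
    change single 0 n (ε n x) ∈ (Tot C ((n : ℤ) - 1)).map (totD δ d) ↔ x ∈ cobd dX n
    -- In degree `0` there are no primitives on either side: the part of total degree `-1` is zero.
    rcases n with _ | n
    · constructor
      · rintro ⟨b, hb, h⟩
        have hb0 : b = 0 := by
          funext p q
          exact hb p q (by push_cast; omega)
        rw [hb0, map_zero] at h
        have := congrFun (congrFun h 0) 0
        rw [single_same] at this
        exact hinj _ (by rw [map_zero]; exact this.symm)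
      · intro h
        have hx0 : x = 0 := h
        exact ⟨0, zero_mem _, by rw [hx0, map_zero, map_zero, single_zero]⟩
    · rw [show ((n + 1 : ℕ) : ℤ) - 1 = n by push_cast; ring]
      constructor
      · rintro ⟨b, hb, h⟩
        -- The primitive itself is brought into the augmentation: `b = ε y + D a`, hence `ε (d y) =
        -- ε x`, and `y` is a primitive of `x` by injectivity of `ε`.
        obtain ⟨a, ha, y, rfl⟩ := exists_aug_eq hD hε h0 hex hb fun p q => by
          rw [h, single_of_ne (Or.inl (by omega))]
        rw [map_add, hD, add_zero, totD_single_aug hε h0] at h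
        have := congrFun (congrFun h 0) (n + 1)
        rw [single_same, single_same] at this
        exact ⟨y, hinj _ this⟩
      · rintro ⟨y, rfl⟩
        exact ⟨_, by simpa using single_mem_Tot 0 n (ε n y), totD_single_aug hε h0 y⟩

end Augmented

end Bicomplex

/-! ### Čech combinatorics on finite sets of indices -/

section FinsetCech
variable {ι N : Type*} [LinearOrder ι] [AddCommGroup N] [Module ℂ N]

/-- The sign of the position of `i` with respect to the elements of `S`. -/
def posSign (S : Finset ι) (i : ι) : ℂ := (-1) ^ (S.filter (· < i)).card

/-- The Čech differential of a function on finite sets of indices. -/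
def finD (v : Finset ι → N) (S : Finset ι) : N := -∑ s ∈ S, posSign S s • v (S.erase s)

/-- The contraction of the Čech differential given by insertion of the index `i`. -/
def finH (i : ι) (v : Finset ι → N) (S : Finset ι) : N :=
  if i ∈ S then 0 else -(posSign S i • v (insert i S))

lemma posSign_mul_self (S : Finset ι) (i : ι) : posSign S i * posSign S i = 1 := by
  rw [posSign, ← pow_add, Even.neg_one_pow ⟨_, rfl⟩]

/-- Erasing `s` shifts the position of `t` exactly when `s < t`; all the sign cancellations below
rest on this. -/
lemma posSign_erase {S : Finset ι} {s : ι} (hs : s ∈ S) (t : ι) :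
    posSign (S.erase s) t = (if s < t then -1 else 1) * posSign S t := by
  rw [posSign, posSign, Finset.filter_erase]
  split_ifs with h
  · have hm : s ∈ S.filter (· < t) := Finset.mem_filter.2 ⟨hs, h⟩
    rw [← Finset.card_erase_add_one hm, pow_succ]
    ring
  · rw [Finset.erase_eq_of_notMem (by simp [h]), one_mul]

lemma posSign_insert {S : Finset ι} {s : ι} (hs : s ∉ S) (t : ι) :
    posSign (insert s S) t = (if s < t then -1 else 1) * posSign S t := by
  have := posSign_erase (Finset.mem_insert_self s S) t
  rw [Finset.erase_insert hs] at this
  rw [this, ← mul_assoc]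
  split_ifs <;> simp

/-- Erasing `s` then `t` and erasing `t` then `s` give the same set with opposite signs. -/
lemma finD_finD (v : Finset ι → N) (S : Finset ι) : finD (finD v) S = 0 := by
  simp only [finD, smul_neg, Finset.sum_neg_distrib, neg_neg, Finset.smul_sum]
  rw [Finset.sum_sigma']
  refine Finset.sum_involution (fun a _ => ⟨a.2, a.1⟩) ?_ ?_ ?_ ?_
  · rintro ⟨s, t⟩ h
    simp only [Finset.mem_sigma, Finset.mem_erase] at h
    obtain ⟨hs, hts, ht⟩ := h
    simp only
    rw [Finset.erase_right_comm, smul_smul, smul_smul, ← add_smul, posSign_erase hs,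
      posSign_erase ht]
    rcases lt_or_gt_of_ne hts with h | h
    · rw [if_neg h.not_gt, if_pos h]
      convert zero_smul ℂ _ using 2; ring
    · rw [if_pos h, if_neg h.not_gt]
      convert zero_smul ℂ _ using 2; ring
  · rintro ⟨s, t⟩ h -
    simp only [Finset.mem_sigma, Finset.mem_erase] at h
    intro h'
    exact h.2.1 (congrArg Sigma.fst h')
  · rintro ⟨s, t⟩ h
    simp only [Finset.mem_sigma, Finset.mem_erase] at h ⊢
    exact ⟨h.2.2, h.2.1.symm, h.1⟩
  · rintro ⟨s, t⟩ h
    rfl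

/-- If `i ∈ S`, only the term erasing `i` survives and reinsertion gives back `v S`. If `i ∉ S`, the
term of `finD` erasing `i` from `insert i S` gives `v S`, and the others cancel against `finD (finH
i v)`. Working with functions on all finite sets keeps the identity free of conditions on the cover.
-/
lemma finD_finH_add (i : ι) (v : Finset ι → N) (S : Finset ι) :
    finD (finH i v) S + finH i (finD v) S = v S := by
  by_cases hi : i ∈ S
  · rw [finH, if_pos hi, add_zero, finD, Finset.sum_eq_single_of_mem i hi]
    · rw [finH, if_neg (Finset.notMem_erase i S), Finset.insert_erase hi, smul_neg, neg_neg,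
        smul_smul, posSign_erase hi, if_neg (lt_irrefl i), one_mul, posSign_mul_self, one_smul]
    · intro s _ hsi
      rw [finH, if_pos (Finset.mem_erase.2 ⟨hsi.symm, hi⟩), smul_zero]
  · rw [finH, if_neg hi, finD, finD, Finset.sum_insert hi, smul_neg, neg_neg, smul_add,
      Finset.erase_insert hi, posSign_insert hi, if_neg (lt_irrefl i), one_mul, smul_smul,
      posSign_mul_self, one_smul, add_left_comm, add_eq_left, neg_add_eq_zero, Finset.smul_sum]
    refine Finset.sum_congr rfl fun s hs => ?_
    have hsi : s ≠ i := fun h => hi (h ▸ hs)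
    rw [finH, if_neg (fun h => hi (Finset.mem_of_mem_erase h)), Finset.erase_insert_of_ne hsi.symm,
      posSign_insert hi, posSign_erase hs, smul_neg, smul_smul, smul_smul, ← neg_smul]
    congr 1
    rcases lt_or_gt_of_ne hsi with h | h
    · rw [if_neg h.not_gt, if_pos h]; ring
    · rw [if_pos h, if_neg h.not_gt]; ring

end FinsetCech

/-! ### Simplices as finite sets of vertices -/

namespace Simplex
variable {m : ℕ} {M : Type*} [TopologicalSpace M] {ι : Type*} [LinearOrder ι]
  {U : ι → Opens M} {p : ℕ}

/-- The set of vertices of a simplex. -/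
def verts (σ : Simplex U p) : Finset ι := Finset.univ.map σ.idx.toEmbedding

lemma mem_verts {σ : Simplex U p} {i : ι} : i ∈ σ.verts ↔ ∃ k, σ.idx k = i := by
  simp [verts]

lemma card_verts (σ : Simplex U p) : σ.verts.card = p + 1 := by simp [verts]

lemma verts_injective : Function.Injective (verts : Simplex U p → Finset ι) := by
  intro σ τ h
  have h1 := Finset.orderEmbOfFin_unique' σ.card_verts (f := σ.idx)
    (fun k => mem_verts.2 ⟨k, rfl⟩)
  have h2 := Finset.orderEmbOfFin_unique' σ.card_verts (f := τ.idx)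
    (fun k => h ▸ mem_verts.2 ⟨k, rfl⟩)
  cases σ; cases τ
  congr
  exact h1.trans h2.symm

lemma mem_inter {σ : Simplex U p} {x : M} : x ∈ σ.inter ↔ ∀ i ∈ σ.verts, x ∈ U i := by
  change x ∈ (⋂ k, (U (σ.idx k) : Set M)) ↔ _
  simp [mem_verts]

/-- The point `x` witnesses that the intersection is nonempty, which is part of the notion of
simplex here. -/
lemma exists_of_finset {S : Finset ι} (hS : S.card = p + 1) {x : M} (hx : ∀ i ∈ S, x ∈ U i) :
    ∃ σ : Simplex U p, σ.verts = S := by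
  refine ⟨⟨S.orderEmbOfFin hS, x, mem_iInter.2 fun k => hx _ (S.orderEmbOfFin_mem hS k)⟩, ?_⟩
  ext i
  rw [mem_verts]
  change i ∈ Set.range (S.orderEmbOfFin hS) ↔ _
  rw [Finset.range_orderEmbOfFin]
  rfl

lemma verts_face (σ : Simplex U (p + 1)) (k : Fin (p + 2)) :
    (σ.face k).verts = σ.verts.erase (σ.idx k) := by
  ext i
  rw [Finset.mem_erase, mem_verts, mem_verts]
  constructor
  · rintro ⟨l, rfl⟩
    refine ⟨fun h => Fin.succAbove_ne k l (σ.idx.injective h), _, rfl⟩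
  · rintro ⟨h, l, rfl⟩
    obtain ⟨j, rfl⟩ := Fin.exists_succAbove_eq (x := l) (y := k) fun h' => h (h' ▸ rfl)
    exact ⟨j, rfl⟩

lemma posSign_verts (σ : Simplex U p) (k : Fin (p + 1)) :
    posSign σ.verts (σ.idx k) = (-1) ^ (k : ℕ) := by
  rw [posSign]
  congr 1
  have : σ.verts.filter (· < σ.idx k) = (Finset.univ.filter (· < k)).map σ.idx.toEmbedding := by
    ext i
    simp only [Finset.mem_filter, mem_verts, Finset.mem_map, Finset.mem_univ, true_and]
    constructor
    · rintro ⟨⟨l, rfl⟩, h⟩; exact ⟨l, σ.idx.lt_iff_lt.1 h, rfl⟩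
    · rintro ⟨l, h, rfl⟩; exact ⟨⟨l, rfl⟩, σ.idx.lt_iff_lt.2 h⟩
  rw [this, Finset.card_map]
  have : Finset.univ.filter (· < k) = Finset.Iio k := by ext; simp
  rw [this, Fin.card_Iio]

lemma sum_verts {N : Type*} [AddCommMonoid N] (σ : Simplex U p) (f : ι → N) :
    ∑ i ∈ σ.verts, f i = ∑ k, f (σ.idx k) := by
  simp [verts]

/-- The vertex `i_k` has `k` predecessors, so its sign is `(-1)^k`; the global minus sign of `finD`
turns it into the sign `(-1)^{k+1}` of the Čech differential. -/
lemma finD_verts {N : Type*} [AddCommGroup N] [Module ℂ N] (σ : Simplex U (p + 1))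
    (v : Finset ι → N) :
    finD v σ.verts = ∑ k : Fin (p + 2), (-1 : ℂ) ^ ((k : ℕ) + 1) • v (σ.face k).verts := by
  rw [finD, sum_verts, ← Finset.sum_neg_distrib]
  refine Finset.sum_congr rfl fun k _ => ?_
  rw [posSign_verts, verts_face, ← neg_smul, pow_succ, mul_neg_one]

end Simplex

/-! ### Gluing sections and forms -/

section Sheaf
universe u v
variable {m : ℕ} {M : Type u} [TopologicalSpace M] [ChartedSpace (EuclideanSpace ℝ (Fin m)) M]
  {A : LRPresheaf.{u, v} m M}

namespace LRPresheaf

lemma res_smul {V W : Opens M} (h : W ≤ V) (f : Sm m V) (X : A.Sec V) :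
    A.res h (f • X) = rho h f • A.res h X := (A.res h).map_smul_apply f X

lemma res_add {V W : Opens M} (h : W ≤ V) (X Y : A.Sec V) :
    A.res h (X + Y) = A.res h X + A.res h Y := (A.res h).map_add X Y

lemma res_csmul {V W : Opens M} (h : W ≤ V) (a : ℂ) (X : A.Sec V) :
    A.res h (a • X) = a • A.res h X := (A.res h).map_smul a X

lemma res_zero {V W : Opens M} (h : W ≤ V) : A.res h (0 : A.Sec V) = 0 := (A.res h).map_zero

/-- Over the empty set `1 = 0` in the ring of functions. Empty open sets are not excluded from the
definition of a form, so they need this separate treatment. -/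
lemma subsingleton_of_isEmpty {W : Opens M} (h : IsEmpty W) : Subsingleton (A.Sec W) := by
  have : (1 : Sm m W) = 0 := Sm.ext fun x => h.elim x
  exact ⟨fun X Y => by
    rw [← one_smul (Sm m W) X, ← one_smul (Sm m W) Y, this, zero_smul, zero_smul]⟩

namespace IsLieAlgebroid
variable (hA : A.IsLieAlgebroid)
include hA

lemma ext_of_cover {J : Type*} {V : Opens M} (W : J → Opens M) (hle : ∀ j, W j ≤ V)
    (hV : V ≤ ⨆ j, W j) {X Y : A.Sec V} (h : ∀ j, A.res (hle j) X = A.res (hle j) Y) : X = Y := by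
  refine hA.separated (range W) V (by rintro _ ⟨j, rfl⟩; exact hle j) hV X Y ?_
  rintro _ ⟨j, rfl⟩
  exact h j

lemma exists_glue {J : Type*} {V : Opens M} (W : J → Opens M) (hle : ∀ j, W j ≤ V)
    (hV : V ≤ ⨆ j, W j) (s : ∀ j, A.Sec (W j))
    (hs : ∀ j k, A.res (inf_le_left : W j ⊓ W k ≤ W j) (s j)
      = A.res (inf_le_right : W j ⊓ W k ≤ W k) (s k)) :
    ∃ X : A.Sec V, ∀ j, A.res (hle j) X = s j := by
  have hs' : ∀ j k (Z : Opens M) (h1 : Z ≤ W j) (h2 : Z ≤ W k),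
      A.res h1 (s j) = A.res h2 (s k) := by
    intro j k Z h1 h2
    have := congrArg (A.res (le_inf h1 h2)) (hs j k)
    rwa [A.res_res, A.res_res] at this
  obtain ⟨X, hX⟩ := hA.gluing (range W) V (by rintro _ ⟨j, rfl⟩; exact hle j) hV
    -- The gluing axiom speaks of sets of open subsets, so an index must be chosen for each member;
    -- agreement on overlaps makes the choice irrelevant, even when two indices give the same
    -- subset.
    (fun Z hZ => A.res hZ.choose_spec.ge (s hZ.choose))
    (fun Z hZ Z' hZ' => by rw [A.res_res, A.res_res]; exact hs' _ _ _ _ _)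
  refine ⟨X, fun j => ?_⟩
  rw [hX (W j) ⟨j, rfl⟩, ← A.res_refl (s j)]
  exact hs' _ _ _ _ _

end IsLieAlgebroid

end LRPresheaf

namespace Form
variable {V : Opens M} {q : ℕ}

/-- The alternating map on the sections onOpen `W` given by a form. -/
def onOpen (η : Form A V q) {W : Opens M} (h : W ≤ V) : A.Sec W [⋀^Fin q]→ₗ[ℂ] A.Sec W := η.1 ⟨W, h⟩

lemma res_update {W Z : Opens M} (h : Z ≤ W) (X : Fin q → A.Sec W) (i : Fin q) (Y : A.Sec W) :
    (fun k => A.res h (Function.update X i Y k))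
      = Function.update (fun k => A.res h (X k)) i (A.res h Y) := by
  funext k
  rcases eq_or_ne k i with rfl | hk
  · simp
  · simp [hk]

lemma ext_of_cover (hA : A.IsLieAlgebroid) {J : Type*} (W : J → Opens M)
    (hV : V ≤ ⨆ j, W j) {η ξ : Form A V q}
    (h : ∀ j (Z : Opens M) (hZ : Z ≤ V), Z ≤ W j → η.1 ⟨Z, hZ⟩ = ξ.1 ⟨Z, hZ⟩) : η = ξ := by
  ext1; funext Z; ext X
  have hZ : Z.1 ≤ ⨆ j, Z.1 ⊓ W j := by
    rw [← inf_iSup_eq]; exact le_inf le_rfl (Z.2.trans hV)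
  refine hA.ext_of_cover (fun j => Z.1 ⊓ W j) (fun j => inf_le_left) hZ fun j => ?_
  rw [η.2.res Z ⟨Z.1 ⊓ W j, inf_le_left.trans Z.2⟩, ξ.2.res Z ⟨Z.1 ⊓ W j, inf_le_left.trans Z.2⟩,
    h j _ _ inf_le_right]

/-- Forms can be glued. -/
lemma exists_glue (hA : A.IsLieAlgebroid) {J : Type*} (W : J → Opens M) (hV : V ≤ ⨆ j, W j)
    (η : ∀ j, Form A (W j) q)
    (hη : ∀ j k (Z : Opens M) (hj : Z ≤ W j) (hk : Z ≤ W k), (η j).1 ⟨Z, hj⟩ = (η k).1 ⟨Z, hk⟩) :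
    ∃ ξ : Form A V q, ∀ j (Z : Opens M) (hZ : Z ≤ V) (hj : Z ≤ W j),
      ξ.1 ⟨Z, hZ⟩ = (η j).1 ⟨Z, hj⟩ := by
  have hcov : ∀ Z : {Z : Opens M // Z ≤ V}, Z.1 ≤ ⨆ j, Z.1 ⊓ W j := fun Z => by
    rw [← inf_iSup_eq]; exact le_inf le_rfl (Z.2.trans hV)
  -- The value on sections over `Z` is defined by gluing the values over the pieces `Z ⊓ W j`; every
  -- required identity is then checked on these pieces by `huniq`.
  have hex : ∀ (Z : {Z : Opens M // Z ≤ V}) (X : Fin q → A.Sec Z.1), ∃ Y : A.Sec Z.1,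
      ∀ j, A.res (inf_le_left : Z.1 ⊓ W j ≤ Z.1) Y
        = (η j).1 ⟨Z.1 ⊓ W j, inf_le_right⟩ (fun k => A.res inf_le_left (X k)) := by
    intro Z X
    refine hA.exists_glue (fun j => Z.1 ⊓ W j) (fun j => inf_le_left) (hcov Z) _ fun j k => ?_
    have hjk : Z.1 ⊓ W j ⊓ (Z.1 ⊓ W k) ≤ W j := inf_le_left.trans inf_le_right
    have hkj : Z.1 ⊓ W j ⊓ (Z.1 ⊓ W k) ≤ W k := inf_le_right.trans inf_le_right
    rw [(η j).2.res ⟨Z.1 ⊓ W j, inf_le_right⟩ ⟨Z.1 ⊓ W j ⊓ (Z.1 ⊓ W k), hjk⟩ inf_le_left,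
      (η k).2.res ⟨Z.1 ⊓ W k, inf_le_right⟩ ⟨Z.1 ⊓ W j ⊓ (Z.1 ⊓ W k), hkj⟩ inf_le_right,
      hη j k _ hjk hkj]
    simp only [A.res_res]
  choose ψ hψ using hex
  have huniq : ∀ (Z : {Z : Opens M // Z ≤ V}) (Y Y' : A.Sec Z.1),
      (∀ j, A.res (inf_le_left : Z.1 ⊓ W j ≤ Z.1) Y = A.res inf_le_left Y') → Y = Y' :=
    fun Z Y Y' h => hA.ext_of_cover (fun j => Z.1 ⊓ W j) (fun j => inf_le_left) (hcov Z) h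
  let ξ : ∀ Z : {Z : Opens M // Z ≤ V}, A.Sec Z.1 [⋀^Fin q]→ₗ[ℂ] A.Sec Z.1 := fun Z =>
    { toFun := ψ Z
      map_update_add' := by
        intro inst X i a b
        obtain rfl := Subsingleton.elim inst (instDecidableEqFin q)
        refine huniq Z _ _ fun j => ?_
        rw [LRPresheaf.res_add, hψ, hψ, hψ, res_update, res_update, res_update, LRPresheaf.res_add,
          AlternatingMap.map_update_add]
      map_update_smul' := by
        intro inst X i a b
        obtain rfl := Subsingleton.elim inst (instDecidableEqFin q)
        refine huniq Z _ _ fun j => ?_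
        rw [LRPresheaf.res_csmul, hψ, hψ, res_update, res_update, LRPresheaf.res_csmul,
          AlternatingMap.map_update_smul]
      map_eq_zero_of_eq' := by
        intro X i k hik hne
        refine huniq Z _ _ fun j => ?_
        rw [hψ, LRPresheaf.res_zero]
        exact AlternatingMap.map_eq_zero_of_eq _ _ (by simp only [hik]) hne }
  refine ⟨⟨ξ, ?_, ?_, ?_⟩, ?_⟩
  · intro Z X i f Y
    refine huniq Z _ _ fun j => ?_
    rw [LRPresheaf.res_smul]
    change A.res _ (ψ Z _) = rho _ f • A.res _ (ψ Z _)
    rw [hψ, hψ, res_update, res_update, LRPresheaf.res_smul, (η j).2.smul]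
  · intro Z X f
    ext x
    obtain ⟨j, hj⟩ : ∃ j, (x : M) ∈ Z.1 ⊓ W j := by
      have := hcov Z x.2
      simpa only [Opens.mem_iSup] using this
    have h1 := (A.res (inf_le_left : Z.1 ⊓ W j ≤ Z.1)).apply_lie f (ψ Z X)
    have h2 : ⁅A.res (inf_le_left : Z.1 ⊓ W j ≤ Z.1) (ψ Z X), rho (inf_le_left : Z.1 ⊓ W j ≤ Z.1) f⁆
        = 0 := by
      rw [hψ]
      exact (η j).2.mem_ker ⟨_, inf_le_right⟩ _ _
    rw [h2] at h1
    exact congrArg (fun g : Sm m (Z.1 ⊓ W j) => g ⟨x, hj⟩) h1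
  · intro Z Z' h X
    refine huniq Z' _ _ fun j => ?_
    change A.res _ (A.res _ (ψ Z _)) = A.res _ (ψ Z' _)
    have hle : Z'.1 ⊓ W j ≤ Z.1 ⊓ W j := inf_le_inf_right _ h
    rw [hψ, A.res_res, ← A.res_res (inf_le_left : Z.1 ⊓ W j ≤ Z.1) hle, hψ,
      (η j).2.res ⟨Z.1 ⊓ W j, inf_le_right⟩ ⟨Z'.1 ⊓ W j, inf_le_right⟩ hle]
    simp only [A.res_res]
  · intro j Z hZ hj
    ext X
    change ψ ⟨Z, hZ⟩ X = _
    have hle : Z ≤ Z ⊓ W j := le_inf le_rfl hj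
    have h := congrArg (A.res hle) (hψ ⟨Z, hZ⟩ X j)
    rw [A.res_res, (η j).2.res ⟨Z ⊓ W j, inf_le_right⟩ ⟨Z, hj⟩ hle] at h
    simp only [A.res_res, A.res_refl] at h
    exact h

/-- The product of a function and a form. -/
def fsmul (f : Sm m V) (η : Form A V q) : Form A V q :=
  ⟨fun W =>
    { toFun := fun X => rho W.2 f • η.1 W X
      map_update_add' := by
        intro inst X i a b
        rw [AlternatingMap.map_update_add, smul_add]
      map_update_smul' := by
        intro inst X i a b
        rw [AlternatingMap.map_update_smul, smul_comm]
      map_eq_zero_of_eq' := by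
        intro X i k hik hne
        rw [AlternatingMap.map_eq_zero_of_eq _ _ hik hne, smul_zero] },
  { smul := fun W X i g Y => by
      change rho W.2 f • η.1 W _ = g • rho W.2 f • η.1 W _
      rw [η.2.smul, smul_comm]
    mem_ker := fun W X => Submodule.smul_mem _ _ (η.2.mem_ker W X)
    res := fun W Z h X => by
      change A.res h (rho W.2 f • η.1 W X) = rho Z.2 f • η.1 Z _
      rw [LRPresheaf.res_smul, η.2.res W Z h]; rfl }⟩

lemma sum_val {J : Type*} (s : Finset J) (η : J → Form A V q) (W : {W : Opens M // W ≤ V})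
    (X : Fin q → A.Sec W.1) : (∑ j ∈ s, η j).1 W X = ∑ j ∈ s, (η j).1 W X := by
  induction s using Finset.cons_induction with
  | empty => rfl
  | cons a s ha ih =>
    rw [Finset.sum_cons, Finset.sum_cons, ← ih]
    rfl

/-- The sum `∑ ρ_i η_i` for a locally finite family of functions `ρ_i` and forms `η_i` onOpen
`V ∩ U_i`. -/
lemma exists_locally_finite_sum (hA : A.IsLieAlgebroid) {ι : Type*} {U : ι → Opens M}
    (ρ : ι → Sm m (⊤ : Opens M))
    (hρ : ∀ x : M, ∃ (W : Opens M) (F : Finset ι), x ∈ W ∧ (∀ i ∈ F, W ≤ U i) ∧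
      ∀ i ∉ F, rho (le_top : W ≤ ⊤) (ρ i) = 0)
    (η : ∀ i, Form A (V ⊓ U i) q) :
    ∃ ξ : Form A V q, ∀ (W : Opens M) (F : Finset ι) (hW : W ≤ V) (hF : ∀ i ∈ F, W ≤ U i),
      (∀ i ∉ F, rho (le_top : W ≤ ⊤) (ρ i) = 0) → ∀ X : Fin q → A.Sec W,
      onOpen ξ hW X = ∑ i ∈ F.attach, rho (le_top : W ≤ ⊤) (ρ i) •
        onOpen (η i) (le_inf hW (hF i i.2)) X := by
  classical
  -- The sum is glued from pieces indexed by pairs `(W, F)` where `F` contains every index whose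
  -- `ρ_i` is not zero on `W`, and `W ≤ U i` for `i ∈ F`. On such a piece the sum is finite and each
  -- `η_i` is defined, so no extension by zero is needed.
  let J := {WF : Opens M × Finset ι // WF.1 ≤ V ∧ (∀ i ∈ WF.2, WF.1 ≤ U i) ∧
    ∀ i ∉ WF.2, rho (le_top : WF.1 ≤ ⊤) (ρ i) = 0}
  have hzero : ∀ (Z : Opens M) (F G : Finset ι) (hZV : Z ≤ V) (hF : ∀ i ∈ F, Z ≤ U i)
      (hG : ∀ i ∈ G, Z ≤ U i) (hG' : ∀ i ∉ G, rho (le_top : Z ≤ ⊤) (ρ i) = 0) (hGF : G ⊆ F)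
      (X : Fin q → A.Sec Z),
      ∑ i ∈ F.attach, rho (le_top : Z ≤ ⊤) (ρ i) •
          onOpen (η i) (le_inf hZV (hF i i.2)) X
        = ∑ i ∈ G.attach, rho (le_top : Z ≤ ⊤) (ρ i) •
          onOpen (η i) (le_inf hZV (hG i i.2)) X := by
    intro Z F G hZV hF hG hG' hGF X
    symm
    refine Finset.sum_of_injOn (fun i => ⟨i.1, hGF i.2⟩) ?_ ?_ ?_ ?_
    · intro i _ j _ h
      exact Subtype.ext (congrArg (fun x => x.1) h)
    · intro i _; simp
    · rintro ⟨i, hi⟩ - h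
      have : i ∉ G := fun hG => h ⟨⟨i, hG⟩, by simp, rfl⟩
      simp only [hG' i this, zero_smul]
    · intro i _; rfl
  -- Two admissible index sets give the same sum, as both agree with their union: the extra terms
  -- carry a vanishing `ρ_i`.
  have hagree : ∀ (Z : Opens M) (F G : Finset ι) (hZV : Z ≤ V) (hF : ∀ i ∈ F, Z ≤ U i)
      (hG : ∀ i ∈ G, Z ≤ U i) (hF' : ∀ i ∉ F, rho (le_top : Z ≤ ⊤) (ρ i) = 0)
      (hG' : ∀ i ∉ G, rho (le_top : Z ≤ ⊤) (ρ i) = 0)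
      (X : Fin q → A.Sec Z),
      ∑ i ∈ F.attach, rho (le_top : Z ≤ ⊤) (ρ i) •
          onOpen (η i) (le_inf hZV (hF i i.2)) X
        = ∑ i ∈ G.attach, rho (le_top : Z ≤ ⊤) (ρ i) •
          onOpen (η i) (le_inf hZV (hG i i.2)) X := by
    intro Z F G hZV hF hG hF' hG' X
    have hFG : ∀ i ∈ F ∪ G, Z ≤ U i := fun i hi => (Finset.mem_union.1 hi).elim (hF i) (hG i)
    rw [← hzero Z (F ∪ G) F hZV hFG hF hF' Finset.subset_union_left,
      ← hzero Z (F ∪ G) G hZV hFG hG hG' Finset.subset_union_right]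
  let ζ : ∀ j : J, Form A j.1.1 q := fun j => ∑ i ∈ j.1.2.attach,
    fsmul (rho le_top (ρ i)) (restrict A (le_inf j.2.1 (j.2.2.1 i i.2)) q (η i))
  have hζ : ∀ (j : J) (Z : Opens M) (hZ : Z ≤ j.1.1) (X : Fin q → A.Sec Z), (ζ j).1 ⟨Z, hZ⟩ X
      = ∑ i ∈ j.1.2.attach, rho (le_top : Z ≤ ⊤) (ρ i) •
        onOpen (η i) (le_inf (hZ.trans j.2.1) (hZ.trans (j.2.2.1 i i.2))) X := by
    intro j Z hZ X
    rw [sum_val]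
    rfl
  have hvan : ∀ (j : J) (Z : Opens M), Z ≤ j.1.1 → ∀ i ∉ j.1.2,
      rho (le_top : Z ≤ ⊤) (ρ i) = 0 := by
    intro j Z hZ i hi
    rw [← rho_rho le_top hZ, j.2.2.2 i hi, map_zero]
  obtain ⟨ξ, hξ⟩ := exists_glue hA (V := V) (fun j : J => j.1.1) (by
      intro x hx
      obtain ⟨W, F, hxW, hF, hF'⟩ := hρ x
      have hle : W ⊓ V ≤ W := inf_le_left
      let j : J := ⟨(W ⊓ V, F), inf_le_right, fun i hi => hle.trans (hF i hi), fun i hi => by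
        rw [← rho_rho le_top hle, hF' i hi, map_zero]⟩
      exact Opens.mem_iSup.2 ⟨j, hxW, hx⟩) ζ (by
      intro j k Z hj hk
      ext X
      rw [hζ, hζ]
      exact hagree Z _ _ (hj.trans j.2.1) (fun i hi => hj.trans (j.2.2.1 i hi))
        (fun i hi => hk.trans (k.2.2.1 i hi)) (hvan j Z hj) (hvan k Z hk) X)
  refine ⟨ξ, fun W F hW hF hF' X => ?_⟩
  rw [onOpen, hξ ⟨(W, F), hW, hF, hF'⟩ W hW le_rfl, hζ]

end Form

end Sheaf

/-! ### Partitions of unity -/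

section PartitionOfUnity
variable {m : ℕ} {M : Type*} [TopologicalSpace M] [ChartedSpace (EuclideanSpace ℝ (Fin m)) M]
  [IsManifold (𝓡 m) ∞ M] [T2Space M] [SecondCountableTopology M]

lemma Sm.sum_apply {W : Opens M} {ι : Type*} (s : Finset ι) (f : ι → Sm m W) (x : W) :
    (∑ i ∈ s, f i) x = ∑ i ∈ s, f i x := by
  induction s using Finset.cons_induction with
  | empty => rfl
  | cons a s ha ih => rw [Finset.sum_cons, Finset.sum_cons, ← ih]; rfl

/-- A smooth partition of unity subordinate to an open cover. -/
lemma exists_partition_of_unity {ι : Type*} (U : ι → Opens M) (hU : ⨆ i, U i = ⊤) :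
    ∃ ρ : ι → Sm m (⊤ : Opens M), ∀ x : M, ∃ (W : Opens M) (F : Finset ι), x ∈ W ∧
      (∀ i ∈ F, W ≤ U i) ∧ (∀ i ∉ F, rho (le_top : W ≤ ⊤) (ρ i) = 0) ∧
      ∑ i ∈ F, rho (le_top : W ≤ ⊤) (ρ i) = 1 := by
  have : LocallyCompactSpace M := ChartedSpace.locallyCompactSpace (EuclideanSpace ℝ (Fin m)) M
  obtain ⟨f, hf⟩ := SmoothPartitionOfUnity.exists_isSubordinate (𝓡 m) (M := M) isClosed_univ
    (fun i => (U i : Set M)) (fun i => (U i).isOpen) (by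
      intro x _
      have hx : x ∈ (⨆ i, U i : Opens M) := by rw [hU]; trivial
      simpa using Opens.mem_iSup.1 hx)
  have hsm : ∀ i, ContMDiff (𝓡 m) 𝓘(ℝ, ℂ) ∞ (fun y : (⊤ : Opens M) => ((f i y : ℝ) : ℂ)) :=
    fun i => (Complex.ofRealCLM.contDiff (n := ∞)).contMDiff.comp
      ((f i).contMDiff.comp contMDiff_subtype_val)
  refine ⟨fun i => Sm.mk _ (hsm i), fun x => ?_⟩
  -- The set `F` consists of the indices whose closed support contains `x`. Closed supports ensure
  -- both that a neighbourhood of `x` lies in `U i` for each such `i` and that, on it, all other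
  -- functions vanish.
  have h1 := f.eventually_fintsupport_subset x
  have h2 : ∀ᶠ y in 𝓝 x, ∀ i ∈ f.fintsupport x, y ∈ U i :=
    (Finset.eventually_all _).2 fun i hi =>
      (U i).isOpen.mem_nhds (hf i ((f.mem_fintsupport_iff x i).1 hi))
  obtain ⟨s, hs, hso, hxs⟩ := eventually_nhds_iff.1 (h1.and h2)
  have hz : ∀ y ∈ s, f.finsupport y ⊆ f.fintsupport x := fun y hy =>
    (f.finsupport_subset_fintsupport y).trans (hs y hy).1
  refine ⟨⟨s, hso⟩, f.fintsupport x, hxs, fun i hi y hy => (hs y hy).2 i hi, ?_, ?_⟩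
  · intro i hi
    ext y
    change ((f i y : ℝ) : ℂ) = 0
    have : i ∉ f.finsupport y := fun h => hi (hz y y.2 h)
    rw [f.mem_finsupport, Function.mem_support, not_not] at this
    rw [this, Complex.ofReal_zero]
  · ext y
    rw [Sm.sum_apply]
    change ∑ i ∈ f.fintsupport x, ((f i y : ℝ) : ℂ) = 1
    rw [← Complex.ofReal_sum, f.sum_finsupport' _ (mem_univ _) (hz y y.2), Complex.ofReal_one]

end PartitionOfUnity

/-! ### Exactness of the Čech complex of forms on the algebroid -/

section Rows
universe u v w x
variable {m : ℕ} {M : Type u} [TopologicalSpace M] [ChartedSpace (EuclideanSpace ℝ (Fin m)) M]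
variable {ι : Type x} [LinearOrder ι] {A : LRPresheaf.{u, v} m M} {U : ι → Opens M} {p q : ℕ}

lemma alternatingMap_sum_apply {J K N : Type*} [AddCommGroup K] [Module ℂ K] [AddCommGroup N]
    [Module ℂ N] (s : Finset J) (f : J → K [⋀^Fin q]→ₗ[ℂ] N) (X : Fin q → K) :
    (∑ j ∈ s, f j) X = ∑ j ∈ s, f j X := by
  induction s using Finset.cons_induction with
  | empty => rfl
  | cons a s ha ih => rw [Finset.sum_cons, Finset.sum_cons, ← ih]; rfl

/-- `Form.onOpen` as a linear map. -/
def Form.onOpenL {V W : Opens M} (h : W ≤ V) :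
    Form A V q →ₗ[ℂ] A.Sec W [⋀^Fin q]→ₗ[ℂ] A.Sec W where
  toFun η := onOpen η h
  map_add' _ _ := rfl
  map_smul' _ _ := rfl

lemma Form.onOpenL_apply {V W : Opens M} (h : W ≤ V) (η : Form A V q) : onOpenL h η = onOpen η h := rfl

/-- The Čech differential of families of forms on a fixed algebroid. -/
def formδ (θ : ∀ σ : Simplex U p, Form A σ.inter q) (σ : Simplex U (p + 1)) : Form A σ.inter q :=
  ∑ k : Fin (p + 2), (-1 : ℂ) ^ ((k : ℕ) + 1) • restrict A (σ.inter_le k) q (θ (σ.face k))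

open Classical in
/-- The values on `W` of a family of forms, as a function of the set of vertices. -/
def cochainVal (θ : ∀ σ : Simplex U p, Form A σ.inter q) (W : Opens M) (S : Finset ι) :
    A.Sec W [⋀^Fin q]→ₗ[ℂ] A.Sec W :=
  if h : ∃ σ : Simplex U p, σ.verts = S ∧ W ≤ σ.inter then Form.onOpen (θ h.choose) h.choose_spec.2 else 0

/-- A simplex is determined by its vertices, so the choice in `cochainVal` is immaterial. -/
lemma cochainVal_verts (θ : ∀ σ : Simplex U p, Form A σ.inter q) {W : Opens M} (σ : Simplex U p)
    (hσ : W ≤ σ.inter) : cochainVal θ W σ.verts = Form.onOpen (θ σ) hσ := by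
  have key : ∀ (τ : Simplex U p) (hτ : W ≤ τ.inter), τ.verts = σ.verts →
      Form.onOpen (θ τ) hτ = Form.onOpen (θ σ) hσ := by
    intro τ hτ h
    obtain rfl := Simplex.verts_injective h
    rfl
  have h : ∃ τ : Simplex U p, τ.verts = σ.verts ∧ W ≤ τ.inter := ⟨σ, rfl, hσ⟩
  rw [cochainVal, dif_pos h]
  exact key _ _ h.choose_spec.1

lemma formδ_onOpen (θ : ∀ σ : Simplex U p, Form A σ.inter q) {W : Opens M} (σ : Simplex U (p + 1))
    (hσ : W ≤ σ.inter) : Form.onOpen (formδ θ σ) hσ = finD (cochainVal θ W) σ.verts := by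
  rw [Simplex.finD_verts, ← Form.onOpenL_apply, formδ, map_sum]
  refine Finset.sum_congr rfl fun k _ => ?_
  rw [map_smul, cochainVal_verts θ (σ.face k) (hσ.trans (σ.inter_le k))]
  rfl

lemma Form.ext_onOpen {V : Opens M} {η ξ : Form A V q}
    (h : ∀ (W : Opens M) (hW : W ≤ V), Form.onOpen η hW = Form.onOpen ξ hW) : η = ξ := by
  ext1; funext W; exact h W.1 W.2

lemma formδ_formδ (θ : ∀ σ : Simplex U p, Form A σ.inter q) : formδ (formδ θ) = 0 := by
  funext σ
  refine Form.ext_onOpen fun W hW => ?_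
  rw [formδ_onOpen, Simplex.finD_verts]
  have : ∀ k, cochainVal (formδ θ) W (σ.face k).verts
      = finD (cochainVal θ W) (σ.face k).verts := fun k => by
    rw [cochainVal_verts _ _ (hW.trans (σ.inter_le k)), formδ_onOpen]
  simp only [this]
  rw [← Simplex.finD_verts, finD_finD]
  rfl

/-- If `W` is nonempty and contained in `U i`, inserting `i` in the vertices of `σ` gives a simplex
whose intersection still contains `W`, and the cocycle condition applies there. Together with
`finD_finH_add`, this makes insertion of `i` a local inverse of `δ` on cocycles. -/
lemma finH_finD_cochainVal {θ : ∀ σ : Simplex U p, Form A σ.inter q} (hθ : formδ θ = 0)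
    {W : Opens M} (σ : Simplex U p) (hσ : W ≤ σ.inter) {i : ι} (hi : W ≤ U i) :
    finH i (finD (cochainVal θ W)) σ.verts = 0 := by
  rw [finH]
  split_ifs with his
  · rfl
  · rcases isEmpty_or_nonempty W with hW | ⟨⟨y, hy⟩⟩
    · have := A.subsingleton_of_isEmpty hW
      exact AlternatingMap.ext fun _ => Subsingleton.elim _ _
    · obtain ⟨τ, hτ⟩ := Simplex.exists_of_finset (U := U) (p := p + 1) (S := insert i σ.verts)
        (x := y) (by rw [Finset.card_insert_of_notMem his, σ.card_verts])
        (fun j hj => (Finset.mem_insert.1 hj).elim (fun h => h ▸ hi hy)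
          (fun h => Simplex.mem_inter.1 (hσ hy) j h))
      have hWτ : W ≤ τ.inter := fun z hz => Simplex.mem_inter.2 fun j hj => by
        rw [hτ] at hj
        exact (Finset.mem_insert.1 hj).elim (fun h => h ▸ hi hz)
          (fun h => Simplex.mem_inter.1 (hσ hz) j h)
      rw [← hτ, ← formδ_onOpen θ τ hWτ, hθ, neg_eq_zero]
      exact smul_zero _

open Classical in
/-- Insertion of the vertex `i`. -/
def insForm (θ : ∀ σ : Simplex U (p + 1), Form A σ.inter q) (τ : Simplex U p) (i : ι) :
    Form A (τ.inter ⊓ U i) q :=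
  if h : ∃ σ : Simplex U (p + 1), σ.verts = insert i τ.verts ∧ i ∉ τ.verts then
    (-posSign τ.verts i) • restrict A (fun y hy => Simplex.mem_inter.2 fun j hj => by
      rw [h.choose_spec.1] at hj
      exact (Finset.mem_insert.1 hj).elim (fun e => e ▸ hy.2)
        (fun e => Simplex.mem_inter.1 hy.1 j e)) q (θ h.choose)
  else 0

/-- `insForm` realizes the contraction `finH i` by genuine forms; these live only on `τ.inter ⊓ U i`
and become forms on `τ.inter` after multiplication by `ρ_i` and summation. -/
lemma insForm_onOpen (θ : ∀ σ : Simplex U (p + 1), Form A σ.inter q) (τ : Simplex U p) (i : ι)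
    {W : Opens M} (hW : W ≤ τ.inter ⊓ U i) :
    Form.onOpen (insForm θ τ i) hW = finH i (cochainVal θ W) τ.verts := by
  rw [finH]
  split_ifs with hi
  · rw [insForm, dif_neg (fun h => h.choose_spec.2 hi)]; rfl
  · by_cases h : ∃ σ : Simplex U (p + 1), σ.verts = insert i τ.verts ∧ i ∉ τ.verts
    · have hle : W ≤ h.choose.inter := fun y hy => Simplex.mem_inter.2 fun j hj => by
        rw [h.choose_spec.1] at hj
        exact (Finset.mem_insert.1 hj).elim (fun e => e ▸ (hW hy).2)
          (fun e => Simplex.mem_inter.1 (hW hy).1 j e)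
      have hc := cochainVal_verts θ h.choose hle
      rw [h.choose_spec.1] at hc
      rw [insForm, dif_pos h, hc, ← neg_smul, ← Form.onOpenL_apply, map_smul]
      rfl
    · rw [insForm, dif_neg h, cochainVal, dif_neg (fun ⟨σ, h1, _⟩ => h ⟨σ, h1, hi⟩), smul_zero,
        neg_zero]
      rfl

variable [IsManifold (𝓡 m) ∞ M] [T2Space M] [SecondCountableTopology M]

/-- The Čech complex of the sheaf of forms is exact in positive degrees. -/
lemma exists_formδ_eq (hA : A.IsLieAlgebroid) (hU : ⨆ i, U i = ⊤)
    {θ : ∀ σ : Simplex U (p + 1), Form A σ.inter q} (hθ : formδ θ = 0) :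
    ∃ η : ∀ σ : Simplex U p, Form A σ.inter q, formδ η = θ := by
  obtain ⟨ρ, hρ⟩ := exists_partition_of_unity (m := m) U hU
  -- The primitive is `∑ ρ_i H_i θ`. It suffices to check `δ η = θ` on small open sets, where the
  -- sum is finite and `∑ ρ_i = 1`.
  have hη : ∀ τ : Simplex U p, _ := fun τ => Form.exists_locally_finite_sum (V := τ.inter) hA ρ
    (fun x => by obtain ⟨W, F, h1, h2, h3, -⟩ := hρ x; exact ⟨W, F, h1, h2, h3⟩) (insForm θ τ)
  choose η hη using hη
  choose W F hxW hWF hWF' hsum using hρ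
  refine ⟨η, funext fun σ => Form.ext_of_cover hA W
    (fun x _ => Opens.mem_iSup.2 ⟨x, hxW x⟩) fun x Z hZ hZW => ?_⟩
  have h1 : ∀ i ∈ F x, Z ≤ U i := fun i hi => hZW.trans (hWF x i hi)
  have h2 : ∀ i ∉ F x, rho (le_top : Z ≤ ⊤) (ρ i) = 0 := fun i hi => by
    rw [← rho_rho le_top hZW, hWF' x i hi, map_zero]
  have h3 : ∑ i ∈ F x, rho (le_top : Z ≤ ⊤) (ρ i) = 1 := by
    have := congrArg (rho hZW) (hsum x)
    rw [map_sum, map_one] at this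
    exact this
  ext X
  change Form.onOpen (formδ η σ) hZ X = Form.onOpen (θ σ) hZ X
  rw [formδ_onOpen, Simplex.finD_verts, alternatingMap_sum_apply]
  have h4 : ∀ k, cochainVal η Z (σ.face k).verts X = ∑ i ∈ (F x).attach,
      rho (le_top : Z ≤ ⊤) (ρ i) • finH i.1 (cochainVal θ Z) (σ.face k).verts X := by
    intro k
    rw [cochainVal_verts η (σ.face k) (hZ.trans (σ.inter_le k)),
      hη (σ.face k) Z (F x) (hZ.trans (σ.inter_le k)) h1 h2]
    refine Finset.sum_congr rfl fun i _ => ?_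
    rw [insForm_onOpen]
  simp only [AlternatingMap.smul_apply, h4, Finset.smul_sum]
  rw [Finset.sum_comm]
  have h5 : ∀ i : {i // i ∈ F x}, ∑ k : Fin (p + 2), (-1 : ℂ) ^ ((k : ℕ) + 1) •
      rho (le_top : Z ≤ ⊤) (ρ i) • finH i.1 (cochainVal θ Z) (σ.face k).verts X
      = rho (le_top : Z ≤ ⊤) (ρ i) • Form.onOpen (θ σ) hZ X := by
    intro i
    have h6 := finD_finH_add i.1 (cochainVal θ Z) σ.verts
    rw [finH_finD_cochainVal hθ σ hZ (h1 i i.2), add_zero, cochainVal_verts θ σ hZ,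
      Simplex.finD_verts] at h6
    rw [← h6, alternatingMap_sum_apply, Finset.smul_sum]
    refine Finset.sum_congr rfl fun k _ => ?_
    rw [AlternatingMap.smul_apply, smul_comm]
  rw [Finset.sum_congr rfl fun i _ => h5 i, ← Finset.sum_smul,
    Finset.sum_attach (F x) (fun i => rho (le_top : Z ≤ ⊤) (ρ i)), h3, one_smul]

omit [IsManifold (𝓡 m) ∞ M] [T2Space M] [SecondCountableTopology M]

lemma Simplex.inter_cover (hU : ⨆ i, U i = ⊤) : (⊤ : Opens M) ≤ ⨆ σ : Simplex U 0, σ.inter := by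
  intro y _
  have hy : y ∈ (⨆ i, U i : Opens M) := by rw [hU]; trivial
  obtain ⟨i, hi⟩ := Opens.mem_iSup.1 hy
  obtain ⟨σ, hσ⟩ := Simplex.exists_of_finset (U := U) (p := 0) (S := {i}) (x := y) (by simp)
    (by simpa using hi)
  exact Opens.mem_iSup.2 ⟨σ, Simplex.mem_inter.2 fun j hj => by
    rw [hσ, Finset.mem_singleton] at hj; rwa [hj]⟩

/-- Global forms are the kernel of the first Čech differential. -/
lemma exists_restrict_eq (hA : A.IsLieAlgebroid) (hU : ⨆ i, U i = ⊤)
    {θ : ∀ σ : Simplex U 0, Form A σ.inter q} (hθ : formδ θ = 0) :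
    ∃ η : Form A (⊤ : Opens M) q, ∀ σ : Simplex U 0, restrict A le_top q η = θ σ := by
  obtain ⟨ξ, hξ⟩ := Form.exists_glue hA (V := ⊤) (fun σ : Simplex U 0 => σ.inter)
    (Simplex.inter_cover hU) θ (by
      intro σ τ Z hσ hτ
      change Form.onOpen (θ σ) hσ = Form.onOpen (θ τ) hτ
      obtain ⟨a, ha⟩ := Finset.card_eq_one.1 σ.card_verts
      obtain ⟨b, hb⟩ := Finset.card_eq_one.1 τ.card_verts
      rcases eq_or_ne a b with rfl | hab
      · obtain rfl := Simplex.verts_injective (ha.trans hb.symm)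
        rfl
      have hZb : Z ≤ U b := fun y hy => Simplex.mem_inter.1 (hτ hy) b (by simp [hb])
      -- At the singleton `{a}` the homotopy identity for the index `b` passes through the empty set
      -- and reads `θ_a = θ_b`, with no distinction between `a < b` and `b < a`.
      have h := finD_finH_add b (cochainVal θ Z) σ.verts
      rw [finH_finD_cochainVal hθ σ hσ hZb, add_zero, cochainVal_verts θ σ hσ, ha, finD,
        Finset.sum_singleton] at h
      rw [← h, ← cochainVal_verts θ τ hτ, hb, finH]
      simp [posSign, Finset.filter_singleton])
  refine ⟨ξ, fun σ => Form.ext_onOpen fun W hW => ?_⟩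
  exact hξ σ W le_top hW

/-- A global form is determined by its restrictions. -/
lemma restrict_injective (hA : A.IsLieAlgebroid) (hU : ⨆ i, U i = ⊤) {η ξ : Form A (⊤ : Opens M) q}
    (h : ∀ σ : Simplex U 0, restrict A (le_top : σ.inter ≤ ⊤) q η = restrict A le_top q ξ) :
    η = ξ := by
  refine Form.ext_of_cover hA (fun σ : Simplex U 0 => σ.inter) (Simplex.inter_cover hU) ?_
  intro σ Z hZ hZσ
  exact congrArg (fun ζ : Form A σ.inter q => ζ.1 ⟨Z, hZσ⟩) (h σ)

/-- The two faces contribute the same restricted form with opposite signs. -/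
lemma formδ_restrict (η : Form A (⊤ : Opens M) q) :
    formδ (fun σ : Simplex U 0 => restrict A le_top q η) = 0 := by
  funext σ
  refine Form.ext_onOpen fun W hW => ?_
  rw [formδ_onOpen, Simplex.finD_verts, Fin.sum_univ_two]
  have : ∀ k, cochainVal (fun σ : Simplex U 0 => restrict A le_top q η) W (σ.face k).verts
      = Form.onOpen η le_top := fun k => by
    rw [cochainVal_verts _ _ (hW.trans (σ.inter_le k))]; rfl
  rw [this, this]
  simp
  rfl

end Rows

/-! ### From forms on the algebroid to their local expressions -/

section Transport
universe u v w x
variable {m : ℕ} {M : Type u} [TopologicalSpace M] [ChartedSpace (EuclideanSpace ℝ (Fin m)) M]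
  [IsManifold (𝓡 m) ∞ M] [T2Space M]
variable {ι : Type x} [LinearOrder ι] {A : LRPresheaf.{u, v} m M} {U : ι → Opens M} {p q : ℕ}
  {g : Type w} [LieRing g] [LieAlgebra ℂ g]

/-- In `S_W⁻¹ S_V (S_V⁻¹ η S_V) S_V⁻¹ S_W` the isomorphism over the larger open set cancels. No
compatibility between the two trivializations is involved. -/
lemma LocalTriv.resMap_pull {V W : Opens M} (TV : LocalTriv A g V) (TW : LocalTriv A g W)
    (h : W ≤ V) (η : Form A V q) :
    TV.resMap TW h q (TV.S.pull q η) = TW.S.pull q (TransLie.restrict A h q η) := by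
  ext1; funext Z; ext X
  have hZ : Z.1 ≤ V := Z.2.trans h
  change (TW.S.e Z.1 Z.2).symm ((TV.S.e Z.1 hZ) ((TV.S.e Z.1 hZ).symm (η.1 ⟨Z.1, hZ⟩ fun k =>
    (TV.S.e Z.1 hZ) ((TV.S.e Z.1 hZ).symm (TW.S.e Z.1 Z.2 (X k)))))) = _
  simp only [LinearEquiv.apply_symm_apply]
  rfl

variable (T : ∀ (p : ℕ) (σ : Simplex U p), LocalTriv A g σ.inter)

/-- The local expressions of a family of forms. -/
def localize (θ : ∀ σ : Simplex U p, Form A σ.inter q) : CechC m g U p q :=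
  fun σ => (T p σ).S.pull q (θ σ)

lemma localize_surjective (ξ : CechC m g U p q) : ∃ θ, localize T θ = ξ :=
  ⟨fun σ => (T p σ).S.symm.pull q (ξ σ), funext fun σ => by
    ext1; funext W; ext X
    change ((T p σ).S.e _ _).symm (((T p σ).S.e _ _) ((ξ σ).1 W _)) = _
    rw [LinearEquiv.symm_apply_apply]
    congr 1
    funext k
    exact LinearEquiv.symm_apply_apply _ _⟩

lemma localize_zero : localize T (0 : ∀ σ : Simplex U p, Form A σ.inter q) = 0 :=
  funext fun σ => map_zero _

lemma pull_injective {V : Opens M} {B : LRPresheaf.{u, w} m M} (E : LRIso A B V) :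
    Function.Injective (E.pull q) := by
  intro η ξ h
  ext1; funext W; ext X
  have h1 := congrArg (fun ζ : Form A V q => ζ.1 W fun k => (E.e W.1 W.2).symm (X k)) h
  simp only [LRIso.pull_apply, LinearEquiv.apply_symm_apply] at h1
  exact (E.e W.1 W.2).symm.injective h1

lemma localize_injective :
    Function.Injective (localize T : (∀ σ : Simplex U p, Form A σ.inter q) → _) :=
  fun _ _ h => funext fun σ => pull_injective (T p σ).S (congrFun h σ)

lemma cechδ_apply (ξ : CechC m g U p q) (σ : Simplex U (p + 1)) :
    cechδ T p q ξ σ = ∑ k : Fin (p + 2), (-1 : ℂ) ^ ((k : ℕ) + 1) •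
      (T p (σ.face k)).resMap (T (p + 1) σ) (σ.inter_le k) q (ξ (σ.face k)) :=
  LinearMap.sum_apply _ _ _

/-- With bijectivity of `localize`, this transfers `δ² = 0` and exactness from the Čech complex of
forms on `A` to the rows of the bicomplex. -/
lemma cechδ_localize (θ : ∀ σ : Simplex U p, Form A σ.inter q) :
    cechδ T p q (localize T θ) = localize T (formδ θ) := by
  funext σ
  rw [cechδ_apply]
  change _ = (T (p + 1) σ).S.pull q (formδ θ σ)
  rw [formδ, map_sum]
  refine Finset.sum_congr rfl fun k _ => ?_
  rw [map_smul, ← LocalTriv.resMap_pull]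
  rfl

lemma cechδ_cechδ (ξ : CechC m g U p q) : cechδ T (p + 1) q (cechδ T p q ξ) = 0 := by
  obtain ⟨θ, rfl⟩ := localize_surjective T ξ
  rw [cechδ_localize, cechδ_localize, formδ_formδ, localize_zero]

lemma cechδ_cechd (ξ : CechC m g U p q) :
    cechδ T p (q + 1) (cechd m g U p q ξ) = cechd m g U (p + 1) q (cechδ T p q ξ) := by
  funext σ
  change _ = dForm (TLA m M g) σ.inter q (cechδ T p q ξ σ)
  rw [cechδ_apply, cechδ_apply, map_sum]
  refine Finset.sum_congr rfl fun k _ => ?_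
  rw [map_smul, ← LocalTriv.resMap_d]
  rfl

lemma dForm_dForm (V : Opens M) (ξ : Form A V q) : dForm A V (q + 1) (dForm A V q ξ) = 0 := by
  ext1; funext W
  exact ceD_ceD _

lemma cechd_cechd (ξ : CechC m g U p q) : cechd m g U p (q + 1) (cechd m g U p q ξ) = 0 :=
  funext fun σ => dForm_dForm (A := TLA m M g) σ.inter (ξ σ)

lemma aug_eq_localize (ξ : Form A (⊤ : Opens M) q) :
    aug T q ξ = localize T fun σ => restrict A le_top q ξ := rfl

lemma aug_dForm (ξ : Form A (⊤ : Opens M) q) :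
    aug T (q + 1) (dForm A ⊤ q ξ) = cechd m g U 0 q (aug T q ξ) :=
  funext fun σ => (T 0 σ).S.pull_d (restrict A le_top q ξ)

lemma aug_injective (hA : A.IsLieAlgebroid) (hU : ⨆ i, U i = ⊤) :
    Function.Injective (aug T q) := by
  intro η ξ h
  rw [aug_eq_localize, aug_eq_localize] at h
  exact restrict_injective hA hU fun σ => congrFun (localize_injective T h) σ

lemma range_aug (hA : A.IsLieAlgebroid) (hU : ⨆ i, U i = ⊤) :
    LinearMap.range (aug T q) = LinearMap.ker (cechδ T 0 q) := by
  ext ξ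
  rw [LinearMap.mem_ker]
  constructor
  · rintro ⟨η, rfl⟩
    rw [aug_eq_localize, cechδ_localize, formδ_restrict, localize_zero]
  · obtain ⟨θ, rfl⟩ := localize_surjective T ξ
    intro h
    rw [cechδ_localize, ← localize_zero] at h
    obtain ⟨η, hη⟩ := exists_restrict_eq hA hU (localize_injective T h)
    exact ⟨η, by rw [aug_eq_localize]; congr 1; exact funext hη⟩

lemma range_cechδ [SecondCountableTopology M] (hA : A.IsLieAlgebroid) (hU : ⨆ i, U i = ⊤) :
    LinearMap.range (cechδ T p q) = LinearMap.ker (cechδ T (p + 1) q) := by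
  ext ξ
  rw [LinearMap.mem_ker]
  constructor
  · rintro ⟨η, rfl⟩
    exact cechδ_cechδ T η
  · obtain ⟨θ, rfl⟩ := localize_surjective T ξ
    intro h
    rw [cechδ_localize, ← localize_zero] at h
    obtain ⟨η, hη⟩ := exists_formδ_eq hA hU (localize_injective T h)
    exact ⟨localize T η, by rw [cechδ_localize, hη]⟩

end Transport

/-! ### Smooth dependence of integrals on parameters -/

section ParametricIntegral
variable {E F : Type} [NormedAddCommGroup E] [NormedSpace ℝ E] [FiniteDimensional ℝ E]
  [NormedAddCommGroup F] [NormedSpace ℝ F]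

lemma hasFDerivAt_integral_param {Φ : E × ℝ → F} (hΦ : ContDiff ℝ 1 Φ) (x : E) :
    HasFDerivAt (fun x => ∫ t in (0 : ℝ)..1, Φ (x, t))
      (∫ t in (0 : ℝ)..1, (fderiv ℝ Φ (x, t)).comp (ContinuousLinearMap.inl ℝ E ℝ)) x := by
  have hc : Continuous fun y : E × ℝ => (fderiv ℝ Φ y).comp (ContinuousLinearMap.inl ℝ E ℝ) :=
    (hΦ.continuous_fderiv (by norm_num)).clm_comp continuous_const
  have : ProperSpace E := FiniteDimensional.proper_real E
  -- Differentiation under the integral needs a dominating function; compactness of the closed ball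
  -- times `[0, 1]` provides a constant one.
  obtain ⟨B, hB⟩ := ((isCompact_closedBall x 1).prod (isCompact_Icc (a := (0 : ℝ)) (b := 1))
    ).exists_bound_of_continuousOn hc.continuousOn
  refine intervalIntegral.hasFDerivAt_integral_of_dominated_of_fderiv_le
    (F' := fun y t => (fderiv ℝ Φ (y, t)).comp (ContinuousLinearMap.inl ℝ E ℝ))
    (bound := fun _ => B) (Metric.closedBall_mem_nhds x one_pos) ?_ ?_ ?_ ?_ ?_ ?_
  · exact Eventually.of_forall fun y =>
      (hΦ.continuous.comp (by fun_prop : Continuous fun t : ℝ => (y, t))).aestronglyMeasurable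
  · exact (hΦ.continuous.comp (by fun_prop : Continuous fun t : ℝ => (x, t))).intervalIntegrable _ _
  · exact (hc.comp (by fun_prop : Continuous fun t : ℝ => (x, t))).aestronglyMeasurable
  · refine Eventually.of_forall fun t ht y hy => hB (y, t) ⟨hy, ?_⟩
    rw [uIoc_of_le zero_le_one] at ht
    exact Ioc_subset_Icc_self ht
  · exact intervalIntegrable_const
  · refine Eventually.of_forall fun t _ y _ => ?_
    exact ((hΦ.differentiable (by norm_num)) (y, t)).hasFDerivAt.comp y (hasFDerivAt_prodMk_left y t)

/-- The derivative is an integral of the same kind, with values in linear maps; the induction is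
therefore over all target spaces. -/
lemma contDiff_integral_param_nat (n : ℕ) {F : Type} [NormedAddCommGroup F] [NormedSpace ℝ F]
    {Φ : E × ℝ → F} (hΦ : ContDiff ℝ n Φ) :
    ContDiff ℝ n (fun x => ∫ t in (0 : ℝ)..1, Φ (x, t)) := by
  induction n generalizing F with
  | zero =>
    rw [Nat.cast_zero, contDiff_zero] at hΦ ⊢
    exact intervalIntegral.continuous_parametric_intervalIntegral_of_continuous' (by
      exact hΦ) 0 1
  | succ n ih =>
    rw [Nat.cast_succ] at hΦ ⊢
    refine contDiff_succ_iff_hasFDerivAt.2 ⟨_, ih (Φ := fun y : E × ℝ =>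
      (fderiv ℝ Φ y).comp (ContinuousLinearMap.inl ℝ E ℝ)) ?_,
      fun x => hasFDerivAt_integral_param (hΦ.of_le (by simp)) x⟩
    exact (hΦ.fderiv_right le_rfl).clm_comp contDiff_const

lemma contDiff_integral_param {Φ : E × ℝ → F} (hΦ : ContDiff ℝ ∞ Φ) :
    ContDiff ℝ ∞ (fun x => ∫ t in (0 : ℝ)..1, Φ (x, t)) :=
  contDiff_infty.2 fun n => contDiff_integral_param_nat n (contDiff_infty.1 hΦ n)

lemma fderiv_integral_param_apply {Φ : E × ℝ → F} (hΦ : ContDiff ℝ ∞ Φ) (x v : E) :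
    fderiv ℝ (fun x => ∫ t in (0 : ℝ)..1, Φ (x, t)) x v
      = ∫ t in (0 : ℝ)..1, fderiv ℝ Φ (x, t) (v, 0) := by
  have h1 : ContDiff ℝ 1 Φ := hΦ.of_le (by exact_mod_cast le_top)
  have hc : Continuous fun y : E × ℝ => (fderiv ℝ Φ y).comp (ContinuousLinearMap.inl ℝ E ℝ) :=
    (h1.continuous_fderiv (by norm_num)).clm_comp continuous_const
  rw [(hasFDerivAt_integral_param h1 x).fderiv]
  rw [ContinuousLinearMap.intervalIntegral_apply]
  · simp
  · exact (hc.comp (by fun_prop : Continuous fun t : ℝ => (x, t))).intervalIntegrable _ _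

end ParametricIntegral

/-! ### Antiderivatives and Hadamard's lemma in Euclidean space -/

section Euclidean
variable {m : ℕ}

local notation "𝔼" => EuclideanSpace ℝ (Fin m)

/-- The partial derivative. -/
def pd (k : Fin m) (f : 𝔼 → ℂ) (x : 𝔼) : ℂ := fderiv ℝ f x (EuclideanSpace.single k 1)

lemma contDiff_pd (k : Fin m) {f : 𝔼 → ℂ} (hf : ContDiff ℝ ∞ f) : ContDiff ℝ ∞ (pd k f) :=
  (hf.fderiv_right (m := ∞) (by simp)).clm_apply contDiff_const

lemma fderiv_apply_eq_sum (f : 𝔼 → ℂ) (x v : 𝔼) : fderiv ℝ f x v = ∑ i, (v i : ℂ) * pd i f x := by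
  have hv : v = ∑ i, v i • EuclideanSpace.single i (1 : ℝ) := by
    ext j
    simp [Finset.sum_apply, Pi.single_apply]
  conv_lhs => rw [hv]
  rw [map_sum]
  simp [pd]

/-- The point with `k`-th coordinate multiplied by `t`. -/
def squeeze (k : Fin m) (y : 𝔼 × ℝ) : 𝔼 := y.1 + ((y.2 - 1) * y.1 k) • EuclideanSpace.single k 1

lemma contDiff_coord (k : Fin m) : ContDiff ℝ ∞ (fun x : 𝔼 => x k) :=
  (EuclideanSpace.proj (𝕜 := ℝ) k : 𝔼 →L[ℝ] ℝ).contDiff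

lemma contDiff_squeeze (k : Fin m) : ContDiff ℝ ∞ (squeeze k : 𝔼 × ℝ → 𝔼) := by
  have := (contDiff_coord k).comp (contDiff_fst (𝕜 := ℝ) (E := 𝔼) (F := ℝ) (n := ∞))
  exact contDiff_fst.add (((contDiff_snd.sub contDiff_const).mul this).smul contDiff_const)

lemma hasFDerivAt_coord (k : Fin m) (x : 𝔼) :
    HasFDerivAt (fun x : 𝔼 => x k) (EuclideanSpace.proj (𝕜 := ℝ) k : 𝔼 →L[ℝ] ℝ) x :=
  (EuclideanSpace.proj (𝕜 := ℝ) k : 𝔼 →L[ℝ] ℝ).hasFDerivAt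

lemma hasDerivAt_line {f : 𝔼 → ℂ} (hf : ContDiff ℝ ∞ f) (a v : 𝔼) (t : ℝ) :
    HasDerivAt (fun t : ℝ => f (a + t • v)) (fderiv ℝ f (a + t • v) v) t := by
  have h1 : HasDerivAt (fun t : ℝ => a + t • v) v t := by
    simpa using ((hasDerivAt_id t).smul_const v).const_add a
  exact ((hf.differentiable (by simp)) _).hasFDerivAt.comp_hasDerivAt t h1

/-- The antiderivative in the `k`-th variable. -/
def antiderivative (k : Fin m) (f : 𝔼 → ℂ) (x : 𝔼) : ℂ :=
  (x k : ℂ) * ∫ t in (0 : ℝ)..1, f (squeeze k (x, t))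

lemma contDiff_antiderivative (k : Fin m) {f : 𝔼 → ℂ} (hf : ContDiff ℝ ∞ f) :
    ContDiff ℝ ∞ (antiderivative k f) :=
  (Complex.ofRealCLM.contDiff.comp (contDiff_coord k)).mul
    (contDiff_integral_param (hf.comp (contDiff_squeeze k)))

lemma fderiv_comp_squeeze (k : Fin m) {f : 𝔼 → ℂ} (hf : ContDiff ℝ ∞ f) (x v : 𝔼) (t : ℝ) :
    fderiv ℝ (f ∘ squeeze k) (x, t) (v, 0) = fderiv ℝ f (squeeze k (x, t))
      (v + ((t - 1) * v k) • EuclideanSpace.single k 1) := by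
  have hs : DifferentiableAt ℝ (squeeze k : 𝔼 × ℝ → 𝔼) (x, t) :=
    (contDiff_squeeze k).differentiable (by simp) _
  rw [fderiv_comp _ ((hf.differentiable (by simp)) _) hs, ContinuousLinearMap.comp_apply]
  congr 1
  have h1 : HasFDerivAt (fun y : 𝔼 => squeeze k (y, t))
      ((fderiv ℝ (squeeze k) (x, t)).comp (ContinuousLinearMap.inl ℝ 𝔼 ℝ)) x :=
    HasFDerivAt.comp (g := squeeze k) (f := fun e : 𝔼 => (e, t)) x hs.hasFDerivAt
      (hasFDerivAt_prodMk_left x t)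
  have h2 : HasFDerivAt (fun y : 𝔼 => squeeze k (y, t))
      (ContinuousLinearMap.id ℝ 𝔼 + ((t - 1) • (EuclideanSpace.proj (𝕜 := ℝ) k : 𝔼 →L[ℝ] ℝ)).smulRight
        (EuclideanSpace.single k 1)) x :=
    (hasFDerivAt_id x).add (((hasFDerivAt_coord k x).const_mul (t - 1)).smul_const _)
  have := congrArg (fun L : 𝔼 →L[ℝ] 𝔼 => L v) (h1.unique h2)
  simpa using this

/-- One product-rule computation for both cases: for `j ≠ k` the antiderivative commutes with `∂_j`,
for `j = k` the integrand becomes a total derivative in `t`. -/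
lemma pd_antiderivative (j k : Fin m) {f : 𝔼 → ℂ} (hf : ContDiff ℝ ∞ f) (x : 𝔼) :
    pd j (antiderivative k f) x = (if j = k then 1 else 0) * (∫ t in (0 : ℝ)..1, f (squeeze k (x, t)))
      + (x k : ℂ) * ∫ t in (0 : ℝ)..1, fderiv ℝ f (squeeze k (x, t))
        (EuclideanSpace.single j 1 + ((t - 1) * (if j = k then 1 else 0)) •
          EuclideanSpace.single k 1) := by
  have hΦ := hf.comp (contDiff_squeeze k)
  have h1 : HasFDerivAt (fun x : 𝔼 => (x k : ℂ))
      (Complex.ofRealCLM.comp (EuclideanSpace.proj (𝕜 := ℝ) k : 𝔼 →L[ℝ] ℝ)) x :=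
    Complex.ofRealCLM.hasFDerivAt.comp x (hasFDerivAt_coord k x)
  have h2 : HasFDerivAt (fun x => ∫ t in (0 : ℝ)..1, (f ∘ squeeze k) (x, t)) _ x :=
    (((contDiff_integral_param hΦ).differentiable (by simp)) x).hasFDerivAt
  have h3 := (h1.mul h2).fderiv
  have h4 : pd j (antiderivative k f) x = _ := congrArg (fun L : 𝔼 →L[ℝ] ℂ => L (EuclideanSpace.single j 1)) h3
  rw [h4]
  simp only [add_apply, smul_apply,
    fderiv_integral_param_apply hΦ, fderiv_comp_squeeze k hf]
  simp [add_comm, eq_comm, mul_comm]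
  split_ifs <;> simp

lemma pd_antiderivative_of_ne {j k : Fin m} (h : j ≠ k) {f : 𝔼 → ℂ} (hf : ContDiff ℝ ∞ f) :
    pd j (antiderivative k f) = antiderivative k (pd j f) := by
  funext x
  rw [pd_antiderivative j k hf x]
  simp [h, antiderivative, pd]

lemma pd_antiderivative_self (k : Fin m) {f : 𝔼 → ℂ} (hf : ContDiff ℝ ∞ f) :
    pd k (antiderivative k f) = f := by
  funext x
  have hcf : Continuous fun t : ℝ => f (squeeze k (x, t)) :=
    (hf.continuous.comp (contDiff_squeeze k).continuous).comp
      (by fun_prop : Continuous fun t : ℝ => (x, t))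
  have hcd : Continuous fun t : ℝ => pd k f (squeeze k (x, t)) :=
    ((contDiff_pd k hf).continuous.comp (contDiff_squeeze k).continuous).comp
      (by fun_prop : Continuous fun t : ℝ => (x, t))
  rw [pd_antiderivative k k hf x, if_pos rfl, one_mul]
  have h1 : ∀ t : ℝ, fderiv ℝ f (squeeze k (x, t)) (EuclideanSpace.single k 1 +
      ((t - 1) * 1) • EuclideanSpace.single k 1) = (t : ℂ) * pd k f (squeeze k (x, t)) := by
    intro t
    have : (EuclideanSpace.single k 1 + ((t - 1) * 1) • EuclideanSpace.single k 1 : 𝔼)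
        = t • EuclideanSpace.single k 1 := by
      rw [mul_one, sub_smul, one_smul]; abel
    rw [this, map_smul, pd, Complex.real_smul]
  simp only [if_true, h1]
  have h2 : ∀ t : ℝ, HasDerivAt (fun t : ℝ => f (squeeze k (x, t)))
      ((x k : ℂ) * pd k f (squeeze k (x, t))) t := by
    intro t
    -- As a function of `t`, `squeeze` runs along a line parallel to the `k`-th axis, from the point
    -- with `k`-th coordinate zero at `t = 0` to `x` at `t = 1`.
    have hl := hasDerivAt_line hf (x - x k • EuclideanSpace.single k 1)
      (x k • EuclideanSpace.single k 1) t
    have hs : ∀ s : ℝ, x - x k • EuclideanSpace.single k 1 + s • x k • EuclideanSpace.single k 1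
        = squeeze k (x, s) := by
      intro s
      simp only [squeeze, sub_mul, sub_smul, one_mul, smul_smul]
      abel
    simp only [hs] at hl
    rwa [map_smul, Complex.real_smul] at hl
  -- The integrand is the derivative of `t · f(squeeze k (x, t))`, whose values at `1` and `0` are
  -- `f x` and `0`.
  have h3 : ∀ t ∈ uIcc (0 : ℝ) 1, HasDerivAt (fun t : ℝ => (t : ℂ) * f (squeeze k (x, t)))
      (f (squeeze k (x, t)) + (x k : ℂ) * ((t : ℂ) * pd k f (squeeze k (x, t)))) t := by
    intro t _
    have := (Complex.ofRealCLM.hasDerivAt (x := t)).mul (h2 t)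
    refine HasDerivAt.congr_deriv this ?_
    change (1 : ℂ) * _ + (t : ℂ) * _ = _
    ring
  have h4 : Continuous fun t : ℝ => (t : ℂ) * pd k f (squeeze k (x, t)) :=
    Complex.continuous_ofReal.mul hcd
  have h6 : Continuous fun t : ℝ => (x k : ℂ) * ((t : ℂ) * pd k f (squeeze k (x, t))) :=
    continuous_const.mul h4
  have h5 := intervalIntegral.integral_eq_sub_of_hasDerivAt h3
    ((hcf.add h6).intervalIntegrable _ _)
  rw [intervalIntegral.integral_add (hcf.intervalIntegrable _ _)
    (h6.intervalIntegrable _ _), intervalIntegral.integral_const_mul] at h5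
  rw [h5]
  simp [squeeze]

/-- Hadamard's lemma. -/
lemma hadamard {f : 𝔼 → ℂ} (hf : ContDiff ℝ ∞ f) (a y : 𝔼) :
    f y = f a + ∑ i, ((y i : ℂ) - a i) * ∫ t in (0 : ℝ)..1, pd i f (a + t • (y - a)) := by
  have hc : Continuous fun t : ℝ => a + t • (y - a) := by fun_prop
  have h1 := intervalIntegral.integral_eq_sub_of_hasDerivAt
    (fun t _ => hasDerivAt_line hf a (y - a) t)
    ((((hf.continuous_fderiv (by simp)).comp hc).clm_apply continuous_const).intervalIntegrable 0 1)
  simp only [fderiv_apply_eq_sum] at h1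
  have h2 : ∀ i, Continuous fun t : ℝ => ((y - a) i : ℂ) * pd i f (a + t • (y - a)) := fun i =>
    continuous_const.mul ((contDiff_pd i hf).continuous.comp hc)
  rw [intervalIntegral.integral_finsetSum fun i _ => (h2 i).intervalIntegrable _ _] at h1
  simp only [intervalIntegral.integral_const_mul] at h1
  simp at h1
  simp [h1]

lemma contDiff_hadamard {f : 𝔼 → ℂ} (hf : ContDiff ℝ ∞ f) (a : 𝔼) (i : Fin m) :
    ContDiff ℝ ∞ fun y : 𝔼 => ∫ t in (0 : ℝ)..1, pd i f (a + t • (y - a)) := by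
  refine contDiff_integral_param (Φ := fun y : 𝔼 × ℝ => pd i f (a + y.2 • (y.1 - a))) ?_
  exact (contDiff_pd i hf).comp
    (contDiff_const.add (contDiff_snd.smul (contDiff_fst.sub contDiff_const)))

end Euclidean

/-! ### Coordinate frames on an open set diffeomorphic to Euclidean space -/

section FrameDef
variable {m : ℕ} {M : Type*} [TopologicalSpace M] [ChartedSpace (EuclideanSpace ℝ (Fin m)) M]

variable (m) in
/-- Global coordinates `x i` on an open subset, the partial derivatives `D i` and
antiderivatives `J i`, subject to Hadamard's lemma. -/
structure Frame (V : Opens M) where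
  x : Fin m → Sm m V
  D : Fin m → VF m V
  J : Fin m → Sm m V →ₗ[ℂ] Sm m V
  D_x : ∀ i j, D i (x j) = if i = j then 1 else 0
  D_J : ∀ k f, D k (J k f) = f
  D_J_of_ne : ∀ j k f, j ≠ k → D j (J k f) = J k (D j f)
  hadamard : ∀ (f : Sm m V) (a : V), ∃ h : Fin m → Sm m V,
    f = algebraMap ℂ (Sm m V) (f a) + ∑ i, (x i - algebraMap ℂ (Sm m V) (x i a)) * h i ∧
      ∀ i, D i f = 0 → h i = 0

section Construct
variable {V : Opens M} (φ : V ≃ₘ^∞⟮𝓡 m, 𝓡 m⟯ EuclideanSpace ℝ (Fin m))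

/-- A smooth function in the coordinates given by a diffeomorphism. -/
def Sm.toEuclidean (f : Sm m V) : EuclideanSpace ℝ (Fin m) → ℂ := fun y => f (φ.symm y)

/-- The smooth function with a given expression in coordinates. -/
def Sm.ofEuclidean (f : EuclideanSpace ℝ (Fin m) → ℂ) (hf : ContDiff ℝ ∞ f) : Sm m V :=
  Sm.mk (fun y => f (φ y)) (hf.contMDiff.comp φ.contMDiff)

lemma Sm.contDiff_toEuclidean (f : Sm m V) : ContDiff ℝ ∞ (f.toEuclidean φ) :=
  contMDiff_iff_contDiff.1 (f.contMDiff.comp φ.symm.contMDiff)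

@[simp] lemma Sm.ofEuclidean_apply (f : EuclideanSpace ℝ (Fin m) → ℂ) (hf : ContDiff ℝ ∞ f) (y : V) :
    Sm.ofEuclidean φ f hf y = f (φ y) := rfl

lemma Sm.toEuclidean_apply (f : Sm m V) (y : V) : f.toEuclidean φ (φ y) = f y := by
  simp [Sm.toEuclidean]

lemma Sm.toEuclidean_ofEuclidean (f : EuclideanSpace ℝ (Fin m) → ℂ) (hf : ContDiff ℝ ∞ f) :
    (Sm.ofEuclidean φ f hf).toEuclidean φ = f := by
  funext y; simp [Sm.toEuclidean]

lemma antiderivative_add (k : Fin m) {f h : EuclideanSpace ℝ (Fin m) → ℂ} (hf : ContDiff ℝ ∞ f)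
    (hh : ContDiff ℝ ∞ h) (x : EuclideanSpace ℝ (Fin m)) :
    antiderivative k (fun y => f y + h y) x = antiderivative k f x + antiderivative k h x := by
  have hc : Continuous fun t : ℝ => squeeze k (x, t) :=
    (contDiff_squeeze k).continuous.comp (by fun_prop : Continuous fun t : ℝ => (x, t))
  have h1 : Continuous fun t : ℝ => f (squeeze k (x, t)) := hf.continuous.comp hc
  have h2 : Continuous fun t : ℝ => h (squeeze k (x, t)) := hh.continuous.comp hc
  rw [antiderivative, intervalIntegral.integral_add (h1.intervalIntegrable _ _)
    (h2.intervalIntegrable _ _), mul_add]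
  rfl

lemma antiderivative_const_mul (k : Fin m) (c : ℂ) (f : EuclideanSpace ℝ (Fin m) → ℂ)
    (x : EuclideanSpace ℝ (Fin m)) :
    antiderivative k (fun y => c * f y) x = c * antiderivative k f x := by
  rw [antiderivative, intervalIntegral.integral_const_mul, antiderivative]; ring

/-- The partial derivatives in the coordinates given by a diffeomorphism. -/
def partialVF (i : Fin m) : VF m V :=
  Derivation.mk' (R := ℂ) (A := Sm m V) (M := Sm m V)
    { toFun := fun f => Sm.ofEuclidean φ (pd i (f.toEuclidean φ))
        (contDiff_pd i (f.contDiff_toEuclidean φ))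
      map_add' := fun f h => by
        ext y
        have hf := (f.contDiff_toEuclidean φ).differentiable (by simp) (φ y)
        have hh := (h.contDiff_toEuclidean φ).differentiable (by simp) (φ y)
        have : (f + h).toEuclidean φ = f.toEuclidean φ + h.toEuclidean φ := rfl
        rw [Sm.add_apply, Sm.ofEuclidean_apply, pd, this, fderiv_add hf hh]
        rfl
      map_smul' := fun c f => by
        ext y
        have hf := (f.contDiff_toEuclidean φ).differentiable (by simp) (φ y)
        have : (c • f).toEuclidean φ = fun z => c * f.toEuclidean φ z := rfl
        rw [RingHom.id_apply, Sm.smul_apply, Sm.ofEuclidean_apply, pd, this, fderiv_const_mul hf]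
        rfl }
    (fun f h => by
        ext y
        have hf := (f.contDiff_toEuclidean φ).differentiable (by simp) (φ y)
        have hh := (h.contDiff_toEuclidean φ).differentiable (by simp) (φ y)
        have : (f * h).toEuclidean φ = f.toEuclidean φ * h.toEuclidean φ := rfl
        change pd i ((f * h).toEuclidean φ) (φ y) = f y * pd i (h.toEuclidean φ) (φ y)
          + h y * pd i (f.toEuclidean φ) (φ y)
        rw [pd, this, fderiv_mul hf hh, Sm.toEuclidean_apply, Sm.toEuclidean_apply]
        rfl)

lemma partialVF_apply (i : Fin m) (f : Sm m V) (y : V) :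
    partialVF φ i f y = pd i (f.toEuclidean φ) (φ y) := rfl

lemma contDiff_complex_coord (i : Fin m) :
    ContDiff ℝ ∞ fun y : EuclideanSpace ℝ (Fin m) => (y i : ℂ) :=
  Complex.ofRealCLM.contDiff.comp (contDiff_coord i)

lemma Sm.sum_mul_apply {J : Type*} (s : Finset J) (f h : J → Sm m V) (x : V) :
    (∑ i ∈ s, f i * h i) x = ∑ i ∈ s, f i x * h i x := by
  induction s using Finset.cons_induction with
  | empty => rfl
  | cons a s ha ih => rw [Finset.sum_cons, Finset.sum_cons, ← ih]; rfl

/-- The frame given by a diffeomorphism with the Euclidean space. -/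
def Frame.ofDiffeo : Frame m V where
  x i := Sm.ofEuclidean φ (fun y => (y i : ℂ)) (contDiff_complex_coord i)
  D := partialVF φ
  J k :=
    { toFun := fun f => Sm.ofEuclidean φ (antiderivative k (f.toEuclidean φ))
        (contDiff_antiderivative k (f.contDiff_toEuclidean φ))
      map_add' := fun f h => by
        ext y
        exact antiderivative_add k (f.contDiff_toEuclidean φ) (h.contDiff_toEuclidean φ) (φ y)
      map_smul' := fun c f => by
        ext y
        exact antiderivative_const_mul k c (f.toEuclidean φ) (φ y) }
  D_x i j := by
    ext y
    rw [partialVF_apply, Sm.toEuclidean_ofEuclidean, pd]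
    have h1 : HasFDerivAt (fun x : EuclideanSpace ℝ (Fin m) => (x j : ℂ))
        (Complex.ofRealCLM.comp (EuclideanSpace.proj (𝕜 := ℝ) j)) (φ y) :=
      Complex.ofRealCLM.hasFDerivAt.comp (φ y) (hasFDerivAt_coord j (φ y))
    rw [h1.fderiv]
    rcases eq_or_ne i j with rfl | hij
    · simp
    · simp [hij, hij.symm]
  D_J k f := by
    ext y
    rw [partialVF_apply]
    simp only [LinearMap.coe_mk, AddHom.coe_mk]
    rw [Sm.toEuclidean_ofEuclidean,
      pd_antiderivative_self k (f.contDiff_toEuclidean φ), Sm.toEuclidean_apply]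
  D_J_of_ne j k f hjk := by
    ext y
    rw [partialVF_apply]
    simp only [LinearMap.coe_mk, AddHom.coe_mk]
    rw [Sm.toEuclidean_ofEuclidean,
      pd_antiderivative_of_ne hjk (f.contDiff_toEuclidean φ), Sm.ofEuclidean_apply]
    congr 1
    funext z
    change _ = pd j (f.toEuclidean φ) (φ (φ.symm z))
    simp
  hadamard f a := by
    refine ⟨fun i => Sm.ofEuclidean φ _
      (contDiff_hadamard (f.contDiff_toEuclidean φ) (φ a) i), ?_, ?_⟩
    · ext y
      have := TransLie.hadamard (f.contDiff_toEuclidean φ) (φ a) (φ y)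
      rw [Sm.toEuclidean_apply, Sm.toEuclidean_apply] at this
      rw [Sm.add_apply, Sm.sum_mul_apply]
      exact this
    · intro i hi
      have h0 : pd i (f.toEuclidean φ) = 0 := by
        funext z
        have := congrArg (fun F : Sm m V => F (φ.symm z)) hi
        simpa [partialVF_apply] using this
      ext y
      simp [h0]

end Construct

namespace Frame
variable {V W : Opens M} (Fm : Frame m V)

/-- All remainder functions in Hadamard's lemma vanish, leaving the value at the base point. -/
lemma eq_const (f : Sm m V) (hf : ∀ i, Fm.D i f = 0) (a : V) :
    f = algebraMap ℂ (Sm m V) (f a) := by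
  obtain ⟨h, h1, h2⟩ := Fm.hadamard f a
  rw [Finset.sum_eq_zero fun i _ => by rw [h2 i (hf i), mul_zero], add_zero] at h1
  exact h1

variable [IsManifold (𝓡 m) ∞ M] [T2Space M]

/-- Applying a derivation to Hadamard's expansion at `a` and evaluating at `a` leaves only the terms
where the coordinates are differentiated. The coefficients do not depend on the derivation, so a
vector field is determined by its values on coordinates. -/
lemma exists_apply_eq_sum (hW : W ≤ V) (f : Sm m V) (a : W) :
    ∃ c : Fin m → ℂ, ∀ X : VF m W, X (rho hW f) a = ∑ i, X (rho hW (Fm.x i)) a * c i := by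
  obtain ⟨h, h1, -⟩ := Fm.hadamard f (inclusion hW a)
  refine ⟨fun i => h i (inclusion hW a), fun X => ?_⟩
  have hc : ∀ c : ℂ, X (rho hW (algebraMap ℂ (Sm m V) c)) = 0 := fun c => by
    rw [AlgHom.commutes, Derivation.map_algebraMap]
  have := congrArg (fun F : Sm m V => X (rho hW F) a) h1
  simp only [map_add, map_sum, map_mul, map_sub, hc, Derivation.leibniz, sub_zero,
    zero_add, smul_eq_mul] at this
  rw [this, Finset.sum_add_distrib, Sm.add_apply, Sm.sum_mul_apply, Sm.sum_mul_apply,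
    ← Finset.sum_add_distrib]
  refine Finset.sum_congr rfl fun i _ => ?_
  change (Fm.x i (inclusion hW a) - Fm.x i (inclusion hW a)) * _
    + h i (inclusion hW a) * _ = _ * h i (inclusion hW a)
  ring

lemma vf_ext (hW : W ≤ V) {X Y : VF m W}
    (h : ∀ i, X (rho hW (Fm.x i)) = Y (rho hW (Fm.x i))) : X = Y := by
  refine VF.ext_rho hW fun f => ?_
  ext a
  obtain ⟨c, hc⟩ := Fm.exists_apply_eq_sum hW f a
  rw [hc, hc]
  simp only [h]

lemma res_D_x (hW : W ≤ V) (i j : Fin m) :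
    VF.res hW (Fm.D i) (rho hW (Fm.x j)) = if i = j then 1 else 0 := by
  rw [VF.res_rho, D_x]
  split_ifs
  · exact map_one _
  · exact map_zero _

/-- Both second derivatives of every coordinate vanish, and vector fields are detected on
coordinates; symmetry of second derivatives of functions is not needed. -/
lemma lie_D (i j : Fin m) : ⁅Fm.D i, Fm.D j⁆ = 0 := by
  refine Fm.vf_ext le_rfl fun k => ?_
  have h : ∀ i' j', Fm.D i' (Fm.D j' (Fm.x k)) = 0 := fun i' j' => by
    rw [D_x]; split_ifs
    · exact (Fm.D i').map_one_eq_zero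
    · exact map_zero _
  rw [rho_refl, Derivation.commutator_apply, h, h]
  simp

lemma _root_.TransLie.VF.sum_apply {J : Type*} (s : Finset J) (X : J → VF m W) (f : Sm m W) :
    (∑ i ∈ s, X i) f = ∑ i ∈ s, X i f := by
  induction s using Finset.cons_induction with
  | empty => rfl
  | cons a s ha ih => rw [Finset.sum_cons, Finset.sum_cons, ← ih]; rfl

/-- Vector fields in coordinates. -/
def vfEquiv (hW : W ≤ V) : VF m W ≃ₗ[Sm m W] (Fin m → Sm m W) where
  toFun X i := X (rho hW (Fm.x i))
  map_add' _ _ := rfl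
  map_smul' _ _ := rfl
  invFun v := ∑ i, v i • VF.res hW (Fm.D i)
  left_inv X := by
    refine Fm.vf_ext hW fun j => ?_
    simp [VF.sum_apply, res_D_x]
  right_inv v := by
    funext j
    simp [VF.sum_apply, res_D_x]

end Frame

end FrameDef

/-- Naturality of the Chevalley–Eilenberg differential with respect to the Lie algebra and the
module. -/
lemma ceD_map {K K' N N' : Type*} [LieRing K] [LieAlgebra ℂ K] [LieRing K'] [LieAlgebra ℂ K']
    [AddCommGroup N] [Module ℂ N] [LieRingModule K N] [LieModule ℂ K N]
    [AddCommGroup N'] [Module ℂ N'] [LieRingModule K' N'] [LieModule ℂ K' N']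
    {q : ℕ} (r : K' →ₗ⁅ℂ⁆ K) (s : N →ₗ[ℂ] N') (η : K [⋀^Fin q]→ₗ[ℂ] N) (ξ : K' [⋀^Fin q]→ₗ[ℂ] N')
    (hs : ∀ x (Y : Fin q → K'), s ⁅r x, η (fun i => r (Y i))⁆ = ⁅x, s (η fun i => r (Y i))⁆)
    (h : ∀ Y : Fin q → K', s (η fun i => r (Y i)) = ξ Y) (X : Fin (q + 1) → K') :
    s (ceD η fun i => r (X i)) = ceD ξ X := by
  have hu : ∀ (Y : Fin q → K') (k : Fin q) (z : K'),
      Function.update (fun i => r (Y i)) k (r z) = (fun i => r (Function.update Y k z i)) := by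
    intro Y k z; funext i
    rcases eq_or_ne i k with rfl | hik
    · simp
    · simp [hik]
  rw [ceD_apply, ceD_apply, map_sub, map_sum, map_sum]
  congr 1
  · refine Finset.sum_congr rfl fun i _ => ?_
    rw [map_zsmul, ← h, ← hs]; rfl
  · refine Finset.sum_congr rfl fun i _ => ?_
    rw [map_sum]
    refine Finset.sum_congr rfl fun k _ => ?_
    split_ifs
    · rw [map_zsmul, ← h, ← hu, LieHom.map_lie]; rfl
    · exact map_zero s

/-! ### Alternating maps with prescribed values on a basis -/

section Extend
variable {O T P I : Type*} [CommRing O] [AddCommGroup T] [Module O T] [AddCommGroup P] [Module O P]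
  [Fintype I] {q : ℕ}

/-- The alternating map with given values on the elements of a basis. -/
def extendAlternating (coord : T →ₗ[O] I → O) (v : (Fin q → I) → P)
    (h0 : ∀ f i j, f i = f j → i ≠ j → v f = 0)
    (h1 : ∀ (f : Fin q → I) i j, i ≠ j → v (f ∘ Equiv.swap i j) = - v f) : T [⋀^Fin q]→ₗ[O] P where
  toMultilinearMap := ∑ f : Fin q → I, (MultilinearMap.mkPiRing O (Fin q) (v f)).compLinearMap
    fun k => LinearMap.proj (f k) ∘ₗ coord
  map_eq_zero_of_eq' := by
    classical
    intro Y i j hY hij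
    change (∑ f : Fin q → I, (MultilinearMap.mkPiRing O (Fin q) (v f)).compLinearMap
      fun k => LinearMap.proj (f k) ∘ₗ coord) Y = 0
    rw [sum_apply]
    -- Swapping the values at `i` and `j` preserves the product of coordinates, since the two
    -- arguments coincide, and changes the sign of the prescribed value.
    refine Finset.sum_involution (fun f _ => f ∘ Equiv.swap i j) ?_ ?_ ?_ ?_
    · intro f _
      change (∏ k, coord (Y k) (f k)) • v f + (∏ k, coord (Y k) (f (Equiv.swap i j k))) • v _ = 0
      have : ∏ k, coord (Y k) (f (Equiv.swap i j k)) = ∏ k, coord (Y k) (f k) := by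
        rw [← Equiv.prod_comp (Equiv.swap i j)]
        refine Finset.prod_congr rfl fun k _ => ?_
        rw [Equiv.swap_apply_self]
        rcases eq_or_ne k i with rfl | hki
        · rw [Equiv.swap_apply_left, hY]
        · rcases eq_or_ne k j with rfl | hkj
          · rw [Equiv.swap_apply_right, hY]
          · rw [Equiv.swap_apply_of_ne_of_ne hki hkj]
      rw [this, h1 f i j hij, smul_neg, add_neg_cancel]
    · intro f _ hf hff
      apply hf
      change (∏ k, coord (Y k) (f k)) • v f = 0
      have : f i = f j := by
        have := congrFun hff j
        simpa using this
      rw [h0 f i j this hij, smul_zero]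
    · exact fun _ _ => Finset.mem_univ _
    · intro f _
      funext k
      simp

lemma extendAlternating_apply (coord : T →ₗ[O] I → O) (v : (Fin q → I) → P) (h0) (h1)
    (Y : Fin q → T) :
    extendAlternating coord v h0 h1 Y = ∑ f : Fin q → I, (∏ k, coord (Y k) (f k)) • v f := by
  change (∑ f : Fin q → I, (MultilinearMap.mkPiRing O (Fin q) (v f)).compLinearMap
      fun k => LinearMap.proj (f k) ∘ₗ coord) Y = _
  rw [sum_apply]
  rfl

lemma extendAlternating_basis [DecidableEq I] (coord : T →ₗ[O] I → O) (v : (Fin q → I) → P) (h0) (h1)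
    (Y : Fin q → T) (f : Fin q → I) (hY : ∀ k, coord (Y k) = Pi.single (f k) 1) :
    extendAlternating coord v h0 h1 Y = v f := by
  rw [extendAlternating_apply, Finset.sum_eq_single f]
  · simp [hY]
  · intro f' _ hf'
    obtain ⟨k, hk⟩ := Function.ne_iff.1 hf'
    rw [Finset.prod_eq_zero (Finset.mem_univ k), zero_smul]
    rw [hY, Pi.single_eq_of_ne hk]
  · exact fun h => absurd (Finset.mem_univ _) h

end Extend

/-! ### Sections with constant coefficients and their action -/

section FrameForms
variable {m : ℕ} {M : Type*} [TopologicalSpace M] [ChartedSpace (EuclideanSpace ℝ (Fin m)) M]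
variable [IsManifold (𝓡 m) ∞ M] [T2Space M]
variable {g : Type*} [LieRing g] [LieAlgebra ℂ g]
variable {V W : Opens M}

/-- The action of the trivial Lie algebroid on sections of the trivial bundle. -/
@[reducible] def TSec.moduleG : LieRingModule (TSec m g V) (GSec m g V) where
  bracket s n := s.X.act n + ⁅s.γ, n⁆
  add_lie s t n := by
    change (s.X + t.X).act n + ⁅s.γ + t.γ, n⁆ = (s.X.act n + ⁅s.γ, n⁆) + (t.X.act n + ⁅t.γ, n⁆)
    rw [VF.add_act, add_lie]; abel
  lie_add s n n' := by
    change s.X.act (n + n') + ⁅s.γ, n + n'⁆ = (s.X.act n + ⁅s.γ, n⁆) + (s.X.act n' + ⁅s.γ, n'⁆)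
    rw [map_add, lie_add]; abel
  leibniz_lie s t n := by
    change s.X.act (t.X.act n + ⁅t.γ, n⁆) + ⁅s.γ, t.X.act n + ⁅t.γ, n⁆⁆
      = (⁅s, t⁆.X.act n + ⁅⁅s, t⁆.γ, n⁆) + (t.X.act (s.X.act n + ⁅s.γ, n⁆) + ⁅t.γ, s.X.act n + ⁅s.γ, n⁆⁆)
    simp only [TSec.lie_X, TSec.lie_γ, VF.lie_act, map_add, VF.act_lie, lie_add, add_lie, sub_lie,
      leibniz_lie s.γ t.γ n]
    abel

namespace Frame
variable (Fm : Frame m V)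

variable (g) in
/-- The Lie algebra `ℂ^m × g`, of the sections of the trivial Lie algebroid with constant
coefficients in a frame. -/
def K (_ : Frame m V) : Type _ := (Fin m → ℂ) × g

instance : AddCommGroup (Fm.K g) := inferInstanceAs (AddCommGroup ((Fin m → ℂ) × g))
instance : Module ℂ (Fm.K g) := inferInstanceAs (Module ℂ ((Fin m → ℂ) × g))

instance : LieRing (Fm.K g) where
  bracket x y := ((0, ⁅x.2, y.2⁆) : (Fin m → ℂ) × g)
  add_lie x y z := Prod.ext (add_zero (0 : Fin m → ℂ)).symm (add_lie x.2 y.2 z.2)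
  lie_add x y z := Prod.ext (add_zero (0 : Fin m → ℂ)).symm (lie_add x.2 y.2 z.2)
  lie_self x := Prod.ext rfl (lie_self x.2)
  leibniz_lie x y z := Prod.ext (add_zero (0 : Fin m → ℂ)).symm (leibniz_lie x.2 y.2 z.2)

instance : LieAlgebra ℂ (Fm.K g) where
  lie_smul c x y := Prod.ext (smul_zero c).symm (lie_smul c x.2 y.2)

lemma K_lie (x y : Fm.K g) : ⁅x, y⁆ = ((0, ⁅x.2, y.2⁆) : (Fin m → ℂ) × g) := rfl

lemma sum_D_lie (v w : Fin m → ℂ) : ⁅∑ i, v i • Fm.D i, ∑ i, w i • Fm.D i⁆ = 0 := by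
  rw [sum_lie]
  refine Finset.sum_eq_zero fun i _ => ?_
  rw [lie_sum]
  refine Finset.sum_eq_zero fun j _ => ?_
  rw [smul_lie, lie_smul, lie_D, smul_zero, smul_zero]

variable (g) in
/-- Sections with constant coefficients. -/
def const : Fm.K g →ₗ⁅ℂ⁆ TSec m g V where
  toFun x := ⟨∑ i, x.1 i • Fm.D i, 1 ⊗ₜ x.2⟩
  map_add' x y := by
    ext1
    · change ∑ i, (x.1 i + y.1 i) • Fm.D i = _
      simp only [add_smul, Finset.sum_add_distrib]; rfl
    · exact TensorProduct.tmul_add _ _ _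
  map_smul' c x := by
    ext1
    · change ∑ i, (c * x.1 i) • Fm.D i = c • ∑ i, x.1 i • Fm.D i
      simp only [mul_smul, Finset.smul_sum]
    · exact TensorProduct.tmul_smul _ _ _
  map_lie' {x y} := by
    change (⟨∑ i, (⁅x, y⁆ : Fm.K g).1 i • Fm.D i, 1 ⊗ₜ (⁅x, y⁆ : Fm.K g).2⟩ : TSec m g V) = _
    rw [K_lie]
    ext1
    · rw [TSec.lie_X, sum_D_lie]
      simp
    · rw [TSec.lie_γ]
      simp

lemma const_X (x : Fm.K g) : (Fm.const g x).X = ∑ i, x.1 i • Fm.D i := rfl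
lemma const_γ (x : Fm.K g) : (Fm.const g x).γ = 1 ⊗ₜ x.2 := rfl

attribute [local instance] TSec.moduleG in
instance : LieRingModule (Fm.K g) (GSec m g V) := LieRingModule.compLieHom (GSec m g V) (Fm.const g)

lemma lie_def (x : Fm.K g) (n : GSec m g V) :
    ⁅x, n⁆ = (Fm.const g x).X.act n + ⁅(Fm.const g x).γ, n⁆ := rfl

instance : LieModule ℂ (Fm.K g) (GSec m g V) where
  smul_lie c x n := by
    rw [lie_def, lie_def, map_smul, TSec.csmul_X, TSec.csmul_γ, VF.smul_const_act, smul_lie, smul_add]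
  lie_smul c x n := by
    rw [lie_def, lie_def, map_smul, lie_smul, smul_add]

variable (g) in
/-- The elements of `ℂ^m × g` corresponding to the partial derivatives. -/
def e (j : Fin m) : Fm.K g := (Pi.single j 1, 0)

lemma e_lie (j : Fin m) (y : Fm.K g) : ⁅Fm.e g j, y⁆ = 0 := by
  exact Prod.ext rfl (zero_lie y.2)

lemma const_e (j : Fin m) : Fm.const g (Fm.e g j) = ⟨Fm.D j, 0⟩ := by
  ext1
  · rw [const_X]
    change ∑ i, (Pi.single j 1 : Fin m → ℂ) i • Fm.D i = _
    rw [Finset.sum_eq_single j]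
    · simp
    · intro i _ hi; simp [hi]
    · simp
  · exact TensorProduct.tmul_zero _ _

/-- The action of `ℂ^m` is differentiation along the coordinates. With the centrality in `e_lie` and
the antiderivatives `JG`, this supplies the hypotheses of the elimination argument. -/
lemma e_lie_module (j : Fin m) (n : GSec m g V) : ⁅Fm.e g j, n⁆ = (Fm.D j).act n := by
  rw [lie_def, const_e]
  change _ + ⁅(0 : GSec m g V), n⁆ = _
  rw [zero_lie, add_zero]

variable (g) in
/-- Antiderivatives of sections of the trivial bundle. -/
def JG (k : Fin m) : GSec m g V →ₗ[ℂ] GSec m g V := (Fm.J k).rTensor g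

lemma e_lie_JG (k : Fin m) (n : GSec m g V) : ⁅Fm.e g k, Fm.JG g k n⁆ = n := by
  rw [e_lie_module]
  exact GSec.hom_ext (φ := (Fm.D k).act ∘ₗ Fm.JG g k) (ψ := LinearMap.id)
    (fun f a => by simp [JG, D_J]) n

lemma e_lie_JG_of_ne (j k : Fin m) (h : k < j) (n : GSec m g V) (hn : ⁅Fm.e g j, n⁆ = 0) :
    ⁅Fm.e g j, Fm.JG g k n⁆ = 0 := by
  rw [e_lie_module] at hn ⊢
  have := GSec.hom_ext (φ := (Fm.D j).act ∘ₗ Fm.JG g k) (ψ := Fm.JG g k ∘ₗ (Fm.D j).act)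
    (fun f a => by simp [JG, D_J_of_ne _ _ _ _ h.ne']) n
  change (Fm.D j).act (Fm.JG g k n) = Fm.JG g k ((Fm.D j).act n) at this
  rw [this, hn, map_zero]

variable [FiniteDimensional ℂ g]

variable (m g) in
/-- The index set of the basis of the trivial Lie algebroid. -/
abbrev Idx : Type := Fin m ⊕ Fin (Module.finrank ℂ g)

variable (g) in
/-- The coordinates of a section of the trivial Lie algebroid. -/
def coord (hW : W ≤ V) : TSec m g W ≃ₗ[Sm m W] (Idx m g → Sm m W) where
  toFun s := Sum.elim (Fm.vfEquiv hW s.X)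
    ((Algebra.TensorProduct.basis (Sm m W) (Module.finBasis ℂ g)).equivFun s.γ)
  map_add' s t := by
    funext i; cases i <;> simp
  map_smul' c s := by
    funext i; cases i <;> simp
  invFun v := ⟨(Fm.vfEquiv hW).symm (v ∘ Sum.inl),
    (Algebra.TensorProduct.basis (Sm m W) (Module.finBasis ℂ g)).equivFun.symm (v ∘ Sum.inr)⟩
  left_inv s := by
    ext1
    · exact LinearEquiv.symm_apply_apply _ _
    · exact LinearEquiv.symm_apply_apply _ _
  right_inv v := by
    funext i
    cases i with
    | inl i => exact congrFun (LinearEquiv.apply_symm_apply (Fm.vfEquiv hW) (v ∘ Sum.inl)) i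
    | inr i => exact congrFun (LinearEquiv.apply_symm_apply
        (Algebra.TensorProduct.basis (Sm m W) (Module.finBasis ℂ g)).equivFun (v ∘ Sum.inr)) i

variable (g) in
/-- The basis of `ℂ^m × g`. -/
def basisK : Module.Basis (Idx m g) ℂ (Fm.K g) :=
  (Pi.basisFun ℂ (Fin m)).prod (Module.finBasis ℂ g)

variable (g) in
/-- The basis of the trivial Lie algebroid. -/
def basisT (hW : W ≤ V) : Module.Basis (Idx m g) (Sm m W) (TSec m g W) :=
  Module.Basis.ofEquivFun (Fm.coord g hW)

lemma basisK_inl (i : Fin m) : Fm.basisK g (Sum.inl i) = Fm.e g i :=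
  Prod.ext (by
    rw [basisK]
    exact (Module.Basis.prod_apply_inl_fst _ _ i).trans (Pi.basisFun_apply ℂ _ i))
    (Module.Basis.prod_apply_inl_snd _ _ i)

lemma basisK_inr (i : Fin (Module.finrank ℂ g)) :
    Fm.basisK g (Sum.inr i) = ((0, Module.finBasis ℂ g i) : (Fin m → ℂ) × g) :=
  Prod.ext (Module.Basis.prod_apply_inr_fst _ _ i) (Module.Basis.prod_apply_inr_snd _ _ i)

/-- Restriction of sections of the trivial Lie algebroid. -/
def resT (hW : W ≤ V) (s : TSec m g V) : TSec m g W := (TLA m M g).res hW s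

/-- Constant sections, restricted to any smaller open set, form a basis over the functions there;
forms are therefore governed by their values on constants. -/
lemma coord_basisK (hW : W ≤ V) (i : Idx m g) :
    Fm.coord g hW (resT hW (Fm.const g (Fm.basisK g i))) = Pi.single i 1 := by
  have hc : ∀ s : TSec m g W, Fm.coord g hW s = Sum.elim (Fm.vfEquiv hW s.X)
    ((Algebra.TensorProduct.basis (Sm m W) (Module.finBasis ℂ g)).equivFun s.γ) := fun _ => rfl
  cases i with
  | inl i =>
    rw [basisK_inl, const_e, hc]
    funext j
    cases j with
    | inl j =>
      change VF.res hW (Fm.D i) (rho hW (Fm.x j)) = _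
      rw [res_D_x, Pi.single_apply]
      simp [eq_comm]
    | inr j =>
      change (Algebra.TensorProduct.basis (Sm m W) (Module.finBasis ℂ g)).equivFun
        (GSec.res hW 0) j = _
      simp
  | inr i =>
    rw [basisK_inr, hc]
    funext j
    cases j with
    | inl j =>
      change VF.res hW (∑ i, (0 : Fin m → ℂ) i • Fm.D i) (rho hW (Fm.x j)) = _
      rw [VF.res_rho]
      simp
    | inr j =>
      change (Algebra.TensorProduct.basis (Sm m W) (Module.finBasis ℂ g)).equivFun
        (GSec.res hW (1 ⊗ₜ Module.finBasis ℂ g i)) j = _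
      rw [GSec.res_tmul, map_one, ← Algebra.TensorProduct.basis_apply,
        Module.Basis.equivFun_self]
      simp [Pi.single_apply, eq_comm]

lemma basisT_apply (hW : W ≤ V) (i : Idx m g) :
    Fm.basisT g hW i = resT hW (Fm.const g (Fm.basisK g i)) := by
  classical
  rw [basisT, Module.Basis.coe_ofEquivFun]
  change (Fm.coord g hW).symm (Pi.single i 1) = _
  rw [← Fm.coord_basisK hW, LinearEquiv.symm_apply_apply]

end Frame
end FrameForms

/-! ### Forms as cochains of `ℂ^m × g`, and basic cochains as cochains of `g` -/

section FrameCoh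
variable {m : ℕ} {M : Type*} [TopologicalSpace M] [ChartedSpace (EuclideanSpace ℝ (Fin m)) M]
variable [IsManifold (𝓡 m) ∞ M] [T2Space M]
variable {g : Type*} [LieRing g] [LieAlgebra ℂ g]
variable {V W Z : Opens M} {q : ℕ}

/-- The value on `W` of a form on the trivial Lie algebroid. -/
def Form.onT (η : Form (TLA m M g) V q) (hW : W ≤ V) : TSec m g W [⋀^Fin q]→ₗ[ℂ] TSec m g W :=
  Form.onOpen η hW

lemma Form.ext_onT {η ξ : Form (TLA m M g) V q}
    (h : ∀ (W : Opens M) (hW : W ≤ V), Form.onT η hW = Form.onT ξ hW) : η = ξ := by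
  ext1; funext W; exact h W.1 W.2

lemma Form.onT_smul (η : Form (TLA m M g) V q) (hW : W ≤ V) (X : Fin q → TSec m g W) (i : Fin q)
    (f : Sm m W) (Y : TSec m g W) :
    Form.onT η hW (Function.update X i (f • Y)) = f • Form.onT η hW (Function.update X i Y) :=
  η.2.smul ⟨W, hW⟩ X i f Y

lemma Form.onT_X (η : Form (TLA m M g) V q) (hW : W ≤ V) (X : Fin q → TSec m g W) :
    (Form.onT η hW X).X = 0 := by
  ext1 f
  exact η.2.mem_ker ⟨W, hW⟩ X f

lemma Form.onT_res (η : Form (TLA m M g) V q) (hW : W ≤ V) (hZ : Z ≤ W) (X : Fin q → TSec m g W) :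
    Frame.resT hZ (Form.onT η hW X) = Form.onT η (hZ.trans hW) fun i => Frame.resT hZ (X i) :=
  η.2.res ⟨W, hW⟩ ⟨Z, hZ.trans hW⟩ hZ X

lemma Form.onT_dForm (η : Form (TLA m M g) V q) (hW : W ≤ V) :
    Form.onT (dForm (TLA m M g) V q η) hW = ceD (Form.onT η hW) := rfl

/-- The value on `W` of a form, as a multilinear map over the smooth functions. -/
def Form.onTO (η : Form (TLA m M g) V q) (hW : W ≤ V) :
    TSec m g W [⋀^Fin q]→ₗ[Sm m W] TSec m g W where
  toFun := Form.onT η hW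
  map_update_add' X i a b := (Form.onT η hW).map_update_add X i a b
  map_update_smul' := by
    intro inst X i c a
    obtain rfl := Subsingleton.elim inst (instDecidableEqFin q)
    exact Form.onT_smul η hW X i c a
  map_eq_zero_of_eq' X i j h hij := (Form.onT η hW).map_eq_zero_of_eq X h hij

/-- A form with values in the sections of the trivial bundle. -/
def Form.ofG (η : ∀ W, W ≤ V → TSec m g W [⋀^Fin q]→ₗ[Sm m W] GSec m g W)
    (hη : ∀ W (hW : W ≤ V) Z (hZ : Z ≤ W) (X : Fin q → TSec m g W),
      GSec.res hZ (η W hW X) = η Z (hZ.trans hW) fun i => Frame.resT hZ (X i)) :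
    Form (TLA m M g) V q :=
  ⟨fun W => show TSec m g W.1 [⋀^Fin q]→ₗ[ℂ] TSec m g W.1 from
    { toFun := fun X => ⟨0, η W.1 W.2 X⟩
      map_update_add' := by
        intro inst X i a b
        ext1
        · exact (add_zero _).symm
        · exact (η W.1 W.2).map_update_add X i a b
      map_update_smul' := by
        intro inst X i c a
        ext1
        · exact (smul_zero c).symm
        · have h1 : c • a = algebraMap ℂ (Sm m W.1) c • a := (algebraMap_smul (Sm m W.1) c a).symm
          rw [h1]
          refine ((η W.1 W.2).map_update_smul X i _ a).trans ?_
          exact algebraMap_smul (Sm m W.1) c _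
      map_eq_zero_of_eq' := by
        intro X i j h hij
        ext1
        · rfl
        · exact (η W.1 W.2).map_eq_zero_of_eq X h hij },
    { smul := fun W X i f Y => by
        apply TSec.ext
        · exact (smul_zero f).symm
        · exact (η W.1 W.2).map_update_smul X i f Y
      mem_ker := fun W X f => rfl
      res := fun W Z h X => by
        apply TSec.ext
        · exact (VF.ext_rho h fun F => (VF.res_rho h 0 F).trans (map_zero _))
        · exact hη W.1 W.2 Z.1 h X }⟩

lemma Form.ofG_onT (η : ∀ W, W ≤ V → TSec m g W [⋀^Fin q]→ₗ[Sm m W] GSec m g W) (hη)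
    (hW : W ≤ V) (X : Fin q → TSec m g W) :
    Form.onT (Form.ofG η hη) hW X = ⟨0, η W hW X⟩ := rfl

variable (m g V) in
/-- The second component as a linear map. -/
def TSec.γL : TSec m g V →ₗ[ℂ] GSec m g V where
  toFun s := s.γ
  map_add' _ _ := rfl
  map_smul' _ _ := rfl

namespace Frame
variable (Fm : Frame m V)

/-- Evaluation of a form on sections with constant coefficients. -/
def onConst : Form (TLA m M g) V q →ₗ[ℂ] (Fm.K g [⋀^Fin q]→ₗ[ℂ] GSec m g V) where
  toFun η := (TSec.γL m g V).compAlternatingMap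
    ((Form.onT η le_rfl).compLinearMap (Fm.const g : Fm.K g →ₗ[ℂ] TSec m g V))
  map_add' _ _ := rfl
  map_smul' _ _ := rfl

lemma onConst_apply (η : Form (TLA m M g) V q) (Y : Fin q → Fm.K g) :
    Fm.onConst η Y = (Form.onT η le_rfl fun i => Fm.const g (Y i)).γ := rfl

/-- Taking the second component is not equivariant on all sections, but it is on those without
vector-field component, and forms take values there. Hence `ceD_map` asks for equivariance only on
values of the cochain. -/
lemma onConst_dForm (η : Form (TLA m M g) V q) :
    Fm.onConst (dForm (TLA m M g) V q η) = ceD (Fm.onConst η) := by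
  ext Y
  rw [onConst_apply, Form.onT_dForm]
  refine ceD_map (Fm.const g) (TSec.γL m g V) (Form.onT η le_rfl) (Fm.onConst η) ?_
    (fun _ => rfl) Y
  intro x Y
  change (⁅Fm.const g x, Form.onT η le_rfl fun i => Fm.const g (Y i)⁆ : TSec m g V).γ = _
  rw [TSec.lie_γ, Form.onT_X, lie_def]
  have : (0 : VF m V).act (Fm.const g x).γ = 0 :=
    GSec.hom_ext (φ := (0 : VF m V).act) (ψ := 0) (fun f a => by simp) _
  rw [this, sub_zero]
  rfl

variable [FiniteDimensional ℂ g]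

lemma onT_basisT (η : Form (TLA m M g) V q) (hW : W ≤ V) (v : Fin q → Idx m g) :
    (Form.onT η hW fun i => Fm.basisT g hW (v i)) =
      resT hW ⟨0, Fm.onConst η fun i => Fm.basisK g (v i)⟩ := by
  simp only [basisT_apply]
  rw [← Form.onT_res η le_rfl hW]
  congr 1
  ext1
  · exact Form.onT_X _ _ _
  · rfl

/-- By linearity over functions a form on `W` is determined on a basis, and the basis elements are
restricted from `V`, so naturality reduces everything to values on `V`. -/
lemma onConst_injective : Function.Injective (Fm.onConst : Form (TLA m M g) V q → _) := by
  intro η ξ h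
  refine Form.ext_onT fun W hW => ?_
  have hA : Form.onTO η hW = Form.onTO ξ hW := by
    refine Module.Basis.ext_alternating (Fm.basisT g hW) fun v _ => ?_
    change Form.onT η hW (fun i => Fm.basisT g hW (v i)) = Form.onT ξ hW (fun i => Fm.basisT g hW (v i))
    rw [onT_basisT, onT_basisT, h]
  ext1 X
  exact congrArg (fun c : TSec m g W [⋀^Fin q]→ₗ[Sm m W] TSec m g W => c X) hA

/-- Coordinates commute with restriction; this makes the extension by linearity in `ofConst` natural
in the open set. -/
lemma coord_resT (hW : W ≤ V) (hZ : Z ≤ W) (s : TSec m g W) (i : Idx m g) :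
    Fm.coord g (hZ.trans hW) (resT hZ s) i = rho hZ (Fm.coord g hW s i) := by
  classical
  have hadd : ∀ s t : TSec m g W, resT hZ (s + t) = resT hZ s + resT hZ t :=
    (TLA m M g).res_add hZ
  have hsmul : ∀ (f : Sm m W) (s : TSec m g W), resT hZ (f • s) = rho hZ f • resT hZ s :=
    (TLA m M g).res_smul hZ
  have hres : ∀ s : TSec m g V, resT hZ (resT hW s) = resT (hZ.trans hW) s :=
    (TLA m M g).res_res hW hZ
  let R : TSec m g W →+ TSec m g Z := AddMonoidHom.mk' (resT hZ) hadd
  have hs : resT hZ s = ∑ j, rho hZ (Fm.coord g hW s j) • Fm.basisT g (hZ.trans hW) j := by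
    conv_lhs => rw [← (Fm.basisT g hW).sum_equivFun s]
    change R _ = _
    rw [map_sum]
    refine Finset.sum_congr rfl fun j _ => ?_
    change resT hZ _ = _
    rw [hsmul, basisT_apply, basisT_apply, hres]
    congr 2
  rw [hs, map_sum, Finset.sum_apply]
  simp only [map_smul, basisT_apply, coord_basisK]
  simp [Pi.single_apply]

/-- The form with given values on the sections with constant coefficients. -/
def ofConst (c : Fm.K g [⋀^Fin q]→ₗ[ℂ] GSec m g V) : Form (TLA m M g) V q :=
  Form.ofG (fun W hW => extendAlternating (Fm.coord g hW).toLinearMap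
      (fun f => GSec.res hW (c fun k => Fm.basisK g (f k)))
      (fun f i j hf hij => by
        rw [c.map_eq_zero_of_eq _ (by rw [hf]) hij, map_zero])
      (fun f i j hij => by
        rw [← map_neg]
        congr 1
        exact c.map_swap (fun k => Fm.basisK g (f k)) hij))
    (by
      intro W hW Z hZ X
      rw [extendAlternating_apply, extendAlternating_apply, map_sum]
      refine Finset.sum_congr rfl fun f _ => ?_
      rw [GSec.res_smul, GSec.res_res, map_prod]
      congr 1
      exact Finset.prod_congr rfl fun k _ => (Fm.coord_resT hW hZ (X k) (f k)).symm)

lemma onConst_ofConst (c : Fm.K g [⋀^Fin q]→ₗ[ℂ] GSec m g V) : Fm.onConst (Fm.ofConst c) = c := by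
  classical
  refine Module.Basis.ext_alternating (Fm.basisK g) fun v _ => ?_
  rw [onConst_apply, ofConst, Form.ofG_onT]
  change extendAlternating _ _ _ _ _ = _
  rw [extendAlternating_basis _ _ _ _ _ v]
  · exact GSec.res_refl _
  · intro k
    rw [LinearEquiv.coe_coe, ← Fm.coord_basisK le_rfl]
    congr 1
    exact ((TLA m M g).res_refl _).symm

/-- Forms on the trivial Lie algebroid as cochains with values in the sections. -/
def formEquiv : Form (TLA m M g) V q ≃ₗ[ℂ] (Fm.K g [⋀^Fin q]→ₗ[ℂ] GSec m g V) :=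
  LinearEquiv.ofBijective Fm.onConst ⟨Fm.onConst_injective,
    fun c => ⟨Fm.ofConst c, Fm.onConst_ofConst c⟩⟩

/-- The cochain with constant values attached to a cochain of `g`. -/
def constCochain : (g [⋀^Fin q]→ₗ[ℂ] g) →ₗ[ℂ] (Fm.K g [⋀^Fin q]→ₗ[ℂ] GSec m g V) where
  toFun c := (TensorProduct.mk ℂ (Sm m V) g 1).compAlternatingMap
    (c.compLinearMap (LinearMap.snd ℂ (Fin m → ℂ) g : Fm.K g →ₗ[ℂ] g))
  map_add' c c' := by
    ext Y
    exact TensorProduct.tmul_add _ _ _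
  map_smul' a c := by
    ext Y
    exact TensorProduct.tmul_smul _ _ _

lemma constCochain_apply (c : g [⋀^Fin q]→ₗ[ℂ] g) (Y : Fin q → Fm.K g) :
    Fm.constCochain c Y = 1 ⊗ₜ c fun i => (Y i).2 := rfl

lemma constCochain_ceD (c : g [⋀^Fin q]→ₗ[ℂ] g) :
    Fm.constCochain (ceD c) = ceD (Fm.constCochain c) := by
  let r : Fm.K g →ₗ⁅ℂ⁆ g :=
    { toFun := fun x => x.2
      map_add' := fun _ _ => rfl
      map_smul' := fun _ _ => rfl
      map_lie' := rfl }
  ext Y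
  refine ceD_map r (TensorProduct.mk ℂ (Sm m V) g 1) c (Fm.constCochain c) ?_ (fun _ => rfl) Y
  intro x Y
  rw [lie_def, const_γ]
  simp
  rfl

/-- Evaluation of sections at a point. -/
def evalG (a : V) : GSec m g V →ₗ[ℂ] g :=
  (TensorProduct.lid ℂ g).toLinearMap ∘ₗ LinearMap.rTensor g
    ({ toFun := fun f : Sm m V => f a, map_add' := fun _ _ => rfl, map_smul' := fun _ _ => rfl } :
      Sm m V →ₗ[ℂ] ℂ)

lemma evalG_tmul (a : V) (f : Sm m V) (x : g) : evalG a (f ⊗ₜ[ℂ] x) = f a • x := rfl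

/-- Evaluation at a point recovers the cochain; this is where nonemptiness of the open set is
needed. -/
lemma constCochain_injective (a : V) :
    Function.Injective (Fm.constCochain : (g [⋀^Fin q]→ₗ[ℂ] g) → _) := by
  intro c c' h
  ext Y
  have : (1 : ℂ) • c Y = (1 : ℂ) • c' Y := congrArg (fun η : Fm.K g [⋀^Fin q]→ₗ[ℂ] GSec m g V =>
    evalG a (η fun i => ((0, Y i) : (Fin m → ℂ) × g))) h
  rwa [one_smul, one_smul] at this

/-- The coefficients of `n` in a basis of `g` have vanishing partial derivatives, hence are constant
by Hadamard's lemma. -/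
lemma eq_one_tmul (a : V) (n : GSec m g V) (hn : ∀ i, ⁅Fm.e g i, n⁆ = 0) : 1 ⊗ₜ evalG a n = n := by
  let b := Module.finBasis ℂ g
  let B := Algebra.TensorProduct.basis (Sm m V) b
  have hrepr : ∀ i n k, B.repr ((Fm.D i).act n) k = Fm.D i (B.repr n k) := by
    intro i n k
    refine GSec.hom_ext (φ := (Finsupp.lapply k ∘ₗ B.repr.toLinearMap.restrictScalars ℂ) ∘ₗ (Fm.D i).act)
      (ψ := (Fm.D i).toLinearMap ∘ₗ Finsupp.lapply k ∘ₗ B.repr.toLinearMap.restrictScalars ℂ) ?_ n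
    intro f x
    simp [B, Algebra.TensorProduct.basis_repr_tmul, mul_comm]
  have hk : ∀ k, B.repr n k = algebraMap ℂ (Sm m V) (B.repr n k a) := fun k =>
    Fm.eq_const _ (fun i => by
      rw [← hrepr, ← e_lie_module, hn]; simp) a
  have hn' : n = 1 ⊗ₜ ∑ k, B.repr n k a • b k := by
    conv_lhs => rw [← B.sum_repr n]
    rw [TensorProduct.tmul_sum]
    refine Finset.sum_congr rfl fun k _ => ?_
    rw [TensorProduct.tmul_smul, ← algebraMap_smul (Sm m V) (B.repr n k a), ← hk]
    congr 1
    exact Algebra.TensorProduct.basis_apply _ k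
  have : evalG a n = ∑ k, B.repr n k a • b k := by
    conv_lhs => rw [hn']
    rw [evalG_tmul, Sm.one_apply, one_smul]
  rw [this, ← hn']

lemma basicFrom_constCochain (c : g [⋀^Fin q]→ₗ[ℂ] g) : BasicFrom (Fm.e g) 0 (Fm.constCochain c) := by
  intro j _
  constructor
  · cases q with
    | zero => trivial
    | succ q =>
      change (Fm.constCochain c).curryLeft (Fm.e g j) = 0
      ext Y
      rw [AlternatingMap.curryLeft_apply_apply, constCochain_apply, c.map_coord_zero 0]
      · simp
      · rfl
  · intro Y
    rw [e_lie_module, constCochain_apply, VF.act_tmul, Derivation.map_one_eq_zero]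
    exact TensorProduct.zero_tmul _ _

lemma exists_constCochain (a : V) {η : Fm.K g [⋀^Fin q]→ₗ[ℂ] GSec m g V}
    (h : BasicFrom (Fm.e g) 0 η) : ∃ c, Fm.constCochain c = η := by
  let inr : g →ₗ[ℂ] Fm.K g := LinearMap.inr ℂ (Fin m → ℂ) g
  refine ⟨(evalG a).compAlternatingMap (η.compLinearMap inr), ?_⟩
  refine Module.Basis.ext_alternating (Fm.basisK g) fun v _ => ?_
  -- On basis vectors: if one of them lies in `ℂ^m`, both sides vanish, by horizontality on the side
  -- of `η`. Otherwise all arguments come from `g`, and the value, being invariant, is constant.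
  by_cases hv : ∃ k j, v k = Sum.inl j
  · obtain ⟨k, j, hkj⟩ := hv
    rw [constCochain_apply, AlternatingMap.map_coord_zero _ k, TensorProduct.tmul_zero]
    · symm
      cases q with
      | zero => exact k.elim0
      | succ q =>
        rw [← Fin.insertNth_self_removeNth k fun i => Fm.basisK g (v i), AlternatingMap.map_insertNth]
        rw [hkj, basisK_inl, ← AlternatingMap.curryLeft_apply_apply,
          show η.curryLeft (Fm.e g j) = 0 from (h j (Nat.zero_le _)).1]
        simp
    · rw [hkj, basisK_inl]; rfl
  · push Not at hv
    have hv' : ∀ k, inr ((Fm.basisK g (v k)).2) = Fm.basisK g (v k) := by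
      intro k
      cases hk : v k with
      | inl j => exact absurd hk (hv k j)
      | inr j => rw [basisK_inr]; rfl
    rw [constCochain_apply]
    change 1 ⊗ₜ evalG a (η fun k => inr ((Fm.basisK g (v k)).2)) = _
    simp only [hv']
    exact Fm.eq_one_tmul a _ fun i => (h i (Nat.zero_le _)).2 _

end Frame
end FrameCoh

/-! ### The cohomology of the trivial Lie algebroid over a contractible open set -/

section ConstCoh
variable {m : ℕ} {M : Type*} [TopologicalSpace M] [ChartedSpace (EuclideanSpace ℝ (Fin m)) M]
variable [IsManifold (𝓡 m) ∞ M] [T2Space M]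
variable {g : Type*} [LieRing g] [LieAlgebra ℂ g] [FiniteDimensional ℂ g]
variable {V W : Opens M} {q : ℕ}

namespace Frame
variable (Fm : Frame m V)

/-- The projection of a section to its component along the trivial bundle. -/
def vertical : TSec m g W →ₗ[Sm m W] TSec m g W where
  toFun s := ⟨0, s.γ⟩
  map_add' _ _ := TSec.ext (add_zero _).symm rfl
  map_smul' f _ := TSec.ext (smul_zero f).symm rfl

lemma vertical_inl (hW : W ≤ V) (i : Fin m) : vertical (Fm.basisT g hW (Sum.inl i)) = 0 := by
  rw [basisT_apply, basisK_inl, const_e]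
  exact TSec.ext rfl (map_zero (GSec.res hW))

lemma vertical_inr (hW : W ≤ V) (i) :
    vertical (Fm.basisT g hW (Sum.inr i)) = Fm.basisT g hW (Sum.inr i) := by
  rw [basisT_apply, basisK_inr]
  refine TSec.ext ?_ rfl
  change 0 = VF.res hW (∑ i, (0 : Fin m → ℂ) i • Fm.D i)
  refine VF.ext_rho hW fun f => ?_
  rw [VF.res_rho]
  simp

variable (g) in
/-- The constant form attached to a cochain of `g`. -/
def constForm (q : ℕ) : (g [⋀^Fin q]→ₗ[ℂ] g) →ₗ[ℂ] Form (TLA m M g) V q :=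
  Fm.formEquiv.symm.toLinearMap ∘ₗ Fm.constCochain

lemma onConst_constForm (c : g [⋀^Fin q]→ₗ[ℂ] g) :
    Fm.onConst (Fm.constForm g q c) = Fm.constCochain c :=
  Fm.formEquiv.apply_symm_apply (Fm.constCochain c)

lemma constForm_ceD (c : g [⋀^Fin q]→ₗ[ℂ] g) :
    Fm.constForm g (q + 1) (ceD c) = dForm (TLA m M g) V q (Fm.constForm g q c) := by
  apply Fm.onConst_injective
  rw [onConst_constForm, onConst_dForm, onConst_constForm, constCochain_ceD]

/-- The form was defined through constant sections only; linearity over functions shows that it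
ignores arbitrary vector-field components, as required by the formula for constant forms. -/
lemma constForm_onT_vertical (c : g [⋀^Fin q]→ₗ[ℂ] g) (hW : W ≤ V) (s : Fin q → TSec m g W) :
    Form.onT (Fm.constForm g q c) hW s = Form.onT (Fm.constForm g q c) hW fun k => vertical (s k) := by
  have h : Form.onTO (Fm.constForm g q c) hW
      = (Form.onTO (Fm.constForm g q c) hW).compLinearMap vertical := by
    refine Module.Basis.ext_alternating (Fm.basisT g hW) fun v _ => ?_
    change Form.onT (Fm.constForm g q c) hW (fun i => Fm.basisT g hW (v i))
      = Form.onT (Fm.constForm g q c) hW (fun i => vertical (Fm.basisT g hW (v i)))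
    by_cases hv : ∃ k j, v k = Sum.inl j
    · obtain ⟨k, j, hkj⟩ := hv
      rw [AlternatingMap.map_coord_zero _ (m := fun i => vertical (Fm.basisT g hW (v i))) k
        (by rw [hkj, vertical_inl]), onT_basisT, onConst_constForm, constCochain_apply,
        AlternatingMap.map_coord_zero _ k (by rw [hkj, basisK_inl]; rfl), TensorProduct.tmul_zero]
      exact (TLA m M g).res_zero hW
    · push Not at hv
      congr 1
      funext k
      cases hk : v k with
      | inl j => exact absurd hk (hv k j)
      | inr j => rw [vertical_inr]
  exact congrArg (fun c : TSec m g W [⋀^Fin q]→ₗ[Sm m W] TSec m g W => c s) h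

lemma constForm_apply (c : g [⋀^Fin q]→ₗ[ℂ] g) (hW : W ≤ V) (X : Fin q → VF m W) (a : Fin q → g) :
    (Form.onT (Fm.constForm g q c) hW fun k => ⟨X k, 1 ⊗ₜ a k⟩) = ⟨0, 1 ⊗ₜ c a⟩ := by
  -- Once the vector field is dropped, the argument is the restriction of a constant section of `V`,
  -- and the value can be computed on `V`.
  have h1 : ∀ (X : VF m W) (a : g), vertical (⟨X, 1 ⊗ₜ a⟩ : TSec m g W)
      = resT hW (vertical (Fm.const g ((0, a) : (Fin m → ℂ) × g))) := fun X a =>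
    TSec.ext (VF.ext_rho hW fun f => ((VF.res_rho hW 0 f).trans (map_zero _)).symm) rfl
  rw [constForm_onT_vertical]
  simp only [h1]
  rw [← Form.onT_res _ le_rfl hW, ← constForm_onT_vertical]
  refine TSec.ext ?_ ?_
  · change VF.res hW (TSec.X _) = 0
    rw [Form.onT_X]
    exact VF.ext_rho hW fun f => (VF.res_rho hW 0 f).trans (map_zero _)
  · change GSec.res hW (Fm.onConst (Fm.constForm g q c) fun k => ((0, a k) : (Fin m → ℂ) × g)) = _
    rw [onConst_constForm]
    rfl

lemma constForm_injective (a : V) : Function.Injective (Fm.constForm g q) := fun c c' h =>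
  Fm.constCochain_injective a (by rw [← onConst_constForm, h, onConst_constForm])

lemma exists_constForm (a : V) {η : Form (TLA m M g) V q} (h : BasicFrom (Fm.e g) 0 (Fm.onConst η)) :
    ∃ c, Fm.constForm g q c = η := by
  obtain ⟨c, hc⟩ := Fm.exists_constCochain a h
  exact ⟨c, Fm.onConst_injective (by rw [onConst_constForm, hc])⟩

lemma exists_constForm_sub_mem_cobd (a : V) (η : Form (TLA m M g) V q)
    (hη : dForm (TLA m M g) V q η = 0) :
    ∃ c, η - Fm.constForm g q c ∈ cobd (dForm (TLA m M g) V) q := by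
  have h0 : ceD (Fm.onConst η) = 0 := by rw [← onConst_dForm, hη, map_zero]
  cases q with
  | zero =>
    obtain ⟨c, hc⟩ := Fm.exists_constForm a (exists_basic_cocycle_zero Fm.e_lie h0)
    exact ⟨c, by rw [hc, sub_self]; exact zero_mem _⟩
  | succ q =>
    obtain ⟨β, hβ⟩ := exists_basic_cocycle Fm.e_lie Fm.e_lie_JG Fm.e_lie_JG_of_ne h0
    obtain ⟨β, rfl⟩ := Fm.formEquiv.surjective β
    have h1 : Fm.onConst η - ceD (Fm.formEquiv β)
        = Fm.onConst (η - dForm (TLA m M g) V q β) := by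
      rw [map_sub, onConst_dForm]; rfl
    rw [h1] at hβ
    obtain ⟨c, hc⟩ := Fm.exists_constForm a hβ
    exact ⟨c, β, by rw [hc, sub_sub_cancel]⟩

/-- A primitive of a constant form need not be constant, but it can be replaced by a basic one with
the same differential, and basic cochains are constant. -/
lemma constForm_mem_cobd_iff (a : V) (c : g [⋀^Fin q]→ₗ[ℂ] g) :
    Fm.constForm g q c ∈ cobd (dForm (TLA m M g) V) q ↔
      c ∈ cobd (fun q => ceD (K := g) (N := g) (q := q)) q := by
  cases q with
  | zero =>
    change Fm.constForm g 0 c = 0 ↔ c = 0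
    rw [← map_zero (Fm.constForm g 0)]
    exact (Fm.constForm_injective a).eq_iff
  | succ q =>
    constructor
    · rintro ⟨β, hβ⟩
      have h1 : BasicFrom (Fm.e g) 0 (ceD (Fm.onConst β)) := by
        rw [← onConst_dForm, hβ, onConst_constForm]
        exact Fm.basicFrom_constCochain c
      obtain ⟨β', h2, h3⟩ := exists_basic_primitive Fm.e_lie Fm.e_lie_JG Fm.e_lie_JG_of_ne h1
      obtain ⟨c', rfl⟩ := Fm.exists_constCochain a h2
      refine ⟨c', Fm.constCochain_injective a ?_⟩
      change Fm.constCochain (ceD c') = _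
      rw [constCochain_ceD, h3, ← onConst_dForm, hβ, onConst_constForm]
    · rintro ⟨c', rfl⟩
      exact ⟨Fm.constForm g q c', (Fm.constForm_ceD c').symm⟩

/-- The constant forms compute the cohomology of the trivial Lie algebroid. -/
lemma exists_coh_equiv (Fm : Frame m V) (a : V) (q : ℕ) :
    ∃ Θ : Coh (fun q => ceD (K := g) (N := g) (q := q)) q ≃ₗ[ℂ] Coh (dForm (TLA m M g) V) q,
      ∀ (c : g [⋀^Fin q]→ₗ[ℂ] g) (hc : ceD c = 0),
        ∃ (η : Form (TLA m M g) V q) (hη : dForm (TLA m M g) V q η = 0),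
          (∀ W (X : Fin q → VF m W.1) (a : Fin q → g),
            η.1 W (fun k => (⟨X k, 1 ⊗ₜ a k⟩ : TSec m g W.1)) =
              (⟨0, 1 ⊗ₜ c a⟩ : TSec m g W.1)) ∧
          Θ (Coh.mk (fun q => ceD (K := g) (N := g) (q := q)) c hc) =
            Coh.mk (dForm (TLA m M g) V) η hη := by
  let f := Coh.map (fun q => ceD (K := g) (N := g) (q := q)) (dForm (TLA m M g) V)
    (Fm.constForm g) (fun q => Fm.constForm_ceD) q ∘ₗ
      Coh.mkL (fun q => ceD (K := g) (N := g) (q := q)) q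
  have hd : ∀ c : g [⋀^Fin q]→ₗ[ℂ] g, ceD c = 0 →
      dForm (TLA m M g) V q (Fm.constForm g q c) = 0 := fun c hc => by
    rw [← constForm_ceD, hc, map_zero]
  have hf : ∀ x, f x = Coh.mk (dForm (TLA m M g) V) (Fm.constForm g q x.1) (hd x.1 x.2) :=
    fun _ => rfl
  refine (Coh.exists_equiv (fun q => ceD (K := g) (N := g) (q := q)) f ?_ ?_).elim fun Θ hΘ =>
    ⟨Θ, fun c hc => ⟨Fm.constForm g q c, hd c hc, fun W X a => Fm.constForm_apply c W.2 X a, hΘ c hc⟩⟩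
  · intro y
    obtain ⟨η, hη, rfl⟩ := Coh.mk_surjective _ y
    obtain ⟨c, hc⟩ := Fm.exists_constForm_sub_mem_cobd a η hη
    -- The reduction provides `c` only as a cochain; it is closed because the constant form differs
    -- from a closed form by a coboundary and `constForm` is injective and commutes with the
    -- differentials.
    have hc0 : ceD c = 0 := by
      refine Fm.constForm_injective a ?_
      have h1 : dForm (TLA m M g) V q (η - Fm.constForm g q c) = 0 := by
        cases q with
        | zero => rw [show η - Fm.constForm g 0 c = 0 from hc, map_zero]
        | succ q =>
          obtain ⟨β, hβ⟩ := hc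
          rw [← hβ, dForm_dForm]
      rw [map_sub, hη, zero_sub, neg_eq_zero] at h1
      rw [constForm_ceD, h1, map_zero]
    refine ⟨⟨c, hc0⟩, ?_⟩
    rw [hf]
    refine (Coh.mk_eq_iff _).2 ?_
    rw [← neg_sub]
    exact neg_mem hc
  · intro x
    rw [hf]
    exact (Coh.mk_eq_zero_iff _).trans (Fm.constForm_mem_cobd_iff a x.1)

end Frame
end ConstCoh

/-! ### Vertical cohomology of the Čech bicomplex -/

section CechCohomology
universe u v w x
variable {m : ℕ} {M : Type u} [TopologicalSpace M] [ChartedSpace (EuclideanSpace ℝ (Fin m)) M]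
variable [IsManifold (𝓡 m) ∞ M] [T2Space M] {ι : Type x} [LinearOrder ι]
variable {A : LRPresheaf.{u, v} m M} {g : Type w} [LieRing g] [LieAlgebra ℂ g] {U : ι → Opens M}
variable {p q : ℕ}

variable (m g U) in
/-- The class map from closed cochains to `C^p(𝒰, ℋ^q)`. -/
def CechH.mkL (p q : ℕ) : LinearMap.ker (cechd m g U p q) →ₗ[ℂ] CechH m g U q p where
  toFun x := CechH.mk x.1 x.2
  map_add' _ _ := rfl
  map_smul' _ _ := rfl

lemma CechH.mkL_surjective (p q : ℕ) : Function.Surjective (CechH.mkL m g U p q) := by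
  intro y
  choose c hc h using fun σ => Coh.mk_surjective (dForm (TLA m M g) σ.inter) (y σ)
  exact ⟨⟨c, funext hc⟩, funext fun σ => (h σ).symm⟩

/-- Primitives can be chosen independently on each simplex, so the vertical cohomology of a product
is the product of the cohomologies. -/
lemma mem_cobd_cechd {c : CechC m g U p q} :
    c ∈ cobd (cechd m g U p) q ↔ ∀ σ, c σ ∈ cobd (dForm (TLA m M g) σ.inter) q := by
  cases q with
  | zero => exact ⟨fun h σ => congrFun (show c = 0 from h) σ, fun h => (funext h : c = 0)⟩
  | succ q =>
    constructor
    · rintro ⟨b, rfl⟩ σ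
      exact ⟨b σ, rfl⟩
    · intro h
      choose b hb using h
      exact ⟨b, funext hb⟩

lemma CechH.mkL_eq_zero_iff (p q : ℕ) (x : LinearMap.ker (cechd m g U p q)) :
    CechH.mkL m g U p q x = 0 ↔ x.1 ∈ cobd (cechd m g U p) q :=
  (funext_iff.trans (forall_congr' fun σ =>
    Coh.mk_eq_zero_iff (hx := congrFun (show cechd m g U p q x.1 = 0 from x.2) σ) _)).trans mem_cobd_cechd.symm

variable (T : ∀ (p : ℕ) (σ : Simplex U p), LocalTriv A g σ.inter)

/-- Restriction maps in cohomology are induced by those on forms, and taking classes is linear; this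
is the compatibility needed to read off the second page. -/
lemma cechδH_mk (c : CechC m g U p q) (hc : cechd m g U p q c = 0)
    (h : cechd m g U (p + 1) q (cechδ T p q c) = 0) :
    cechδH T q p (CechH.mk c hc) = CechH.mk (cechδ T p q c) h := by
  funext σ
  have hres : ∀ k : Fin (p + 2), dForm (TLA m M g) σ.inter q
      ((T p (σ.face k)).resMap (T (p + 1) σ) (σ.inter_le k) q (c (σ.face k))) = 0 := fun k => by
    rw [← LocalTriv.resMap_d, show dForm (TLA m M g) _ q (c (σ.face k)) = 0 from congrFun hc _,
      map_zero]
  let z : Fin (p + 2) → LinearMap.ker (dForm (TLA m M g) σ.inter q) := fun k => ⟨_, hres k⟩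
  have h1 : cechδH T q p (CechH.mk c hc) σ =
      ∑ k : Fin (p + 2), (-1 : ℂ) ^ ((k : ℕ) + 1) • Coh.mkL (dForm (TLA m M g) σ.inter) q (z k) :=
    LinearMap.sum_apply _ _ _
  have h2 : CechH.mk (cechδ T p q c) h σ = Coh.mkL (dForm (TLA m M g) σ.inter) q
      (∑ k : Fin (p + 2), (-1 : ℂ) ^ ((k : ℕ) + 1) • z k) := by
    rw [Coh.mkL_apply]
    refine (Coh.mk_eq_iff _).2 ?_
    rw [cechδ_apply, AddSubmonoidClass.coe_finsetSum]
    have : ∀ x y : Form (TLA m M g) σ.inter q, x = y →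
        x - y ∈ cobd (dForm (TLA m M g) σ.inter) q := fun x y hxy => by
      rw [hxy, sub_self]; exact zero_mem _
    exact this _ _ rfl
  rw [h1, h2, map_sum]
  simp only [map_smul]

end CechCohomology

end TransLie

end

theorem mainTheorem3 {m : ℕ} {M : Type*} [TopologicalSpace M]
    [ChartedSpace (EuclideanSpace ℝ (Fin m)) M] [IsManifold (𝓡 m) ∞ M]
    [T2Space M] [SecondCountableTopology M]
    -- a transitive Lie algebroid
    (A : LRPresheaf m M) (hA : A.IsLieAlgebroid) (hA' : A.IsTransitive)
    {g : Type*} [LieRing g] [LieAlgebra ℂ g] [FiniteDimensional ℂ g]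
    -- a good cover, with trivializations over all its nonempty finite intersections
    {ι : Type*} [LinearOrder ι] (U : ι → Opens M) (hU : IsGoodCover m U)
    (T : ∀ (p : ℕ) (σ : Simplex U p), LocalTriv A g σ.inter) :
    -- the bicomplex
    (∀ q (ξ : Form A ⊤ q), dForm A ⊤ (q + 1) (dForm A ⊤ q ξ) = 0) ∧
    (∀ p q (ξ : CechC m g U p q), cechd m g U p (q + 1) (cechd m g U p q ξ) = 0) ∧
    (∀ p q (ξ : CechC m g U p q), cechδ T (p + 1) q (cechδ T p q ξ) = 0) ∧
    (∀ p q (ξ : CechC m g U p q),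
      cechδ T p (q + 1) (cechd m g U p q ξ) = cechd m g U (p + 1) q (cechδ T p q ξ)) ∧
    (∀ q (ξ : Form A ⊤ q), aug T (q + 1) (dForm A ⊤ q ξ) = cechd m g U 0 q (aug T q ξ)) ∧
    -- exactness of the augmented rows
    (∀ q, Function.Injective (aug T q)) ∧
    (∀ q, LinearMap.range (aug T q) = LinearMap.ker (cechδ T 0 q)) ∧
    (∀ p q, LinearMap.range (cechδ T p q) = LinearMap.ker (cechδ T (p + 1) q)) ∧
    -- the augmentation induces an isomorphism onto the cohomology of the total complex
    (∀ n : ℕ, ∃ Φ : Coh (dForm A ⊤) n ≃ₗ[ℂ] totH (cechδ T) (cechd m g U) n,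
      ∀ (ξ : Form A ⊤ n) (hξ : dForm A ⊤ n ξ = 0),
        ∃ h : single 0 n (aug T n ξ) ∈ totZ (cechδ T) (cechd m g U) n,
        Φ (Coh.mk (dForm A ⊤) ξ hξ) = totH.mk (cechδ T) (cechd m g U) _ h) ∧
    -- the terms `E_r` are the pages of a spectral sequence
    HasPages (cechδ T) (cechd m g U) ∧
    -- `E_1^{p,q} = C^p(𝒰, ℋ^q)`
    (∀ p q : ℕ, ∃ θ : page (cechδ T) (cechd m g U) 1 p q ≃ₗ[ℂ] CechH m g U q p,
      ∀ c (hc : c ∈ pageZ (cechδ T) (cechd m g U) 1 p q),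
        ∃ h : cechd m g U p q (c p q) = 0,
        θ (page.mk (cechδ T) (cechd m g U) c hc) = CechH.mk (c p q) h) ∧
    -- `E_2^{p,q} = H^p(𝒰; ℋ^q)`
    (∀ p q : ℕ, ∃ θ : page (cechδ T) (cechd m g U) 2 p q ≃ₗ[ℂ] Coh (cechδH T q) p,
      ∀ c (hc : c ∈ pageZ (cechδ T) (cechd m g U) 2 p q),
        ∃ (h : cechd m g U p q (c p q) = 0)
        (h' : cechδH T q p (CechH.mk (c p q) h) = 0),
        θ (page.mk (cechδ T) (cechd m g U) c hc) =
          Coh.mk (cechδH T q) (CechH.mk (c p q) h) h') ∧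
    -- `ℋ^q(U_{i₀ ⋯ i_p}) = H^q(g; g)`, through the constant forms
    (∀ (p : ℕ) (σ : Simplex U p) (q : ℕ),
      ∃ Θ : Coh (fun q => ceD (K := g) (N := g) (q := q)) q ≃ₗ[ℂ]
          Coh (dForm (TLA m M g) σ.inter) q,
        ∀ (c : g [⋀^Fin q]→ₗ[ℂ] g) (hc : ceD c = 0),
          ∃ (η : Form (TLA m M g) σ.inter q) (hη : dForm (TLA m M g) σ.inter q η = 0),
            (∀ W (X : Fin q → VF m W.1) (a : Fin q → g),
              η.1 W (fun k => (⟨X k, 1 ⊗ₜ a k⟩ : TSec m g W.1)) =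
                (⟨0, 1 ⊗ₜ c a⟩ : TSec m g W.1)) ∧
            Θ (Coh.mk (fun q => ceD (K := g) (N := g) (q := q)) c hc) =
              Coh.mk (dForm (TLA m M g) σ.inter) η hη) := by
  have hδ : ∀ p q (ξ : CechC m g U p q), cechδ T (p + 1) q (cechδ T p q ξ) = 0 :=
    fun _ _ ξ => cechδ_cechδ T ξ
  have hd : ∀ p q (ξ : CechC m g U p q), cechd m g U p (q + 1) (cechd m g U p q ξ) = 0 :=
    fun _ _ ξ => cechd_cechd ξ
  have hδd : ∀ p q (ξ : CechC m g U p q),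
      cechδ T p (q + 1) (cechd m g U p q ξ) = cechd m g U (p + 1) q (cechδ T p q ξ) :=
    fun _ _ ξ => cechδ_cechd T ξ
  have hε : ∀ q (ξ : Form A ⊤ q),
      aug T (q + 1) (dForm A ⊤ q ξ) = cechd m g U 0 q (aug T q ξ) := fun _ ξ => aug_dForm T ξ
  have hinj : ∀ q, Function.Injective (aug T q) := fun _ => aug_injective T hA hU.cover
  have h0 : ∀ q, LinearMap.range (aug T q) = LinearMap.ker (cechδ T 0 q) :=
    fun _ => range_aug T hA hU.cover
  have hex : ∀ p q, LinearMap.range (cechδ T p q) = LinearMap.ker (cechδ T (p + 1) q) :=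
    fun _ _ => range_cechδ T hA hU.cover
  have hD := totD_totD (cechδ T) (cechd m g U) hδ hd hδd
  refine ⟨fun _ ξ => dForm_dForm ⊤ ξ, hd, hδ, hδd, hε, hinj, h0, hex,
    fun n => exists_totH_equiv hD hε hinj h0 hex n, hasPages hD,
    fun p q => exists_page_one_equiv (CechH.mkL m g U) CechH.mkL_surjective
      CechH.mkL_eq_zero_iff p q,
    fun p q => exists_page_two_equiv (CechH.mkL m g U) CechH.mkL_surjective
      CechH.mkL_eq_zero_iff (cechδH T) (fun _ _ c hc h => cechδH_mk T c hc h) hD hδd p q,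
    fun p σ q => ?_⟩
  -- Only the last claim uses that the intersections are diffeomorphic to `ℝ^m`: the diffeomorphism
  -- gives the frame, and a point of the intersection serves for evaluation.
  obtain ⟨φ⟩ := hU.diffeo p σ
  obtain ⟨a, ha⟩ := σ.nonempty
  exact (Frame.ofDiffeo φ).exists_coh_equiv ⟨a, ha⟩ q
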